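/- **Setting.** Fix $d,m\ge 1$ and $L,S,\sigma,\lambda,\eta>0$. In a linear contextual bandit with $K$ arms, in round $t=1,\dots,T$ contexts $x_{t,a}\in\mathbb R^d$ ($a\in[K]$) with $\|x_{t,a}\|_2\le L$ are revealed (they may depend arbitrarily on the past), an action $a_t$ is played, and a reward $r_t=\langle x_{t,a_t},\theta^\star\rangle+\eta_t\in[0,1]$ is observed, where $\|\theta^\star\|_2\le S$ and the noise $\eta_t$ is, conditionally on the past, centred and $\sigma$-sub-Gaussian. The regret is $R_T=\sum_{t=1}^T\big(\max_a\langle x_{t,a},\theta^\star\rangle-\langle x_{t,a_t},\theta^\star\rangle\big)$. **Local privatizer.** For $\varepsilon_0>0$ let $p=2/(e^{2\varepsilon_0/(md(d+3))}+1)$. On input $(x,r)$ with $\|x\|_2\le L$, $r\in[0,1]$, $\mathcal M_{\rm LDP}$ encodes each number $y$ among $\frac{r x_i}{2L}+\frac12$ ($i\le d$) and $\frac{x_ix_j}{2L^2}+\frac12$ ($j\le i\le d$) by $m$ bits: with $\mu=\lceil my\rceil$, bit $k$ is $1$ if $k<\mu$, is $\mathrm{Ber}(my-\mu+1)$ if $k=\mu$,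 and is $0$ if $k>\mu$. Each bit is then, independently, kept with probability $1-p$ and replaced by a $\mathrm{Ber}(1/2)$ bit with probability $p$. The output is the resulting bits $\tilde b_{i,q}$ and $\tilde w_{i,j,q}=\tilde w_{j,i,q}$ ($q\le m$). A mechanism $\mathcal M$ is $\varepsilon_0$-LDP if $\mathbb P(\mathcal M(u)\in O)\le e^{\varepsilon_0}\,\mathbb P(\mathcal M(u')\in O)$ for all admissible inputs $u,u'$ and all events $O$; SBLB is called $\varepsilon_0$-LDP if the mechanism through which users send their data is. **SBLB** with inputs $T,\varepsilon_0,\varepsilon,\delta_0,\delta,\lambda,\eta,m,L,S,\sigma$. The shuffler batch length $l$ is the least integer such that $lp\ge 14\log(8mT/\delta_0)$ and $$\sqrt{(2+A)^2-4}\ \ge\ 1-2p+2\sqrt{\tfrac{2\log(2mT/\delta_0)}{l}}+A,\qquad A=\Big(\tfrac{\varepsilon l}{32d(d+3)\log(8mT/\delta_0)\sqrt{2T\ln(2T/\delta_0)}}\Big)^2 .$$ For $t\ge1$ put $$\lambda(t)=\tfrac{\sqrt{8t\ln(2t/\delta)}}{m}+\tfrac{2\sqrt{8t\ln(2t/\delta)}}{(1-p)\sqrt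 m}+\lambda,$$ $$\beta(t)=\sigma\sqrt{8\log\tfrac{2t}\delta+d\log\big(3+\tfrac{tL^2}{\lambda(t)}\big)}+S\sqrt{3\lambda(t)}+\tfrac d{\sqrt{\lambda(t)}}\Big(2\sqrt{p(1-\tfrac p2)tm\log\tfrac{2t}\delta}+\tfrac83\log\tfrac{2t}\delta+\tfrac{\sqrt8}m\sqrt{t\log\tfrac{2t}\delta}\Big),$$ and for $t=0$ use the same formulas with every term containing $t$ dropped (so $\lambda(0)=\lambda$ and $\beta(0)=\sigma\sqrt{d\log 3}+S\sqrt{3\lambda}$). The model starts as $t_0=0$, $\tilde\theta_0=0$, $\tilde V_0=\lambda I$, $\tilde B_0=0$. In each round the user plays $a_t\in\arg\max_a\langle x_{t,a},\tilde\theta_j\rangle+\beta(t_j)\|x_{t,a}\|_{\tilde V_j^{-1}}$, $j$ being the index of the current model, and sends $\mathcal M_{\rm LDP}(x_{t,a_t},r_t)$ to the shuffler. Whenever $l$ new reports have been collected, the shuffler permutes them and sends the sums $Z_i=\sum_{n,q}\tilde b_{n,i,q}$ and $U_{i,k}=\sum_{n,q}\tilde w_{n,i,k,q}$ over them. If this occurs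 after $t$ rounds, the algorithm forms $$\tilde B=\tilde B_j+\sum\Big(\tfrac{Z}{m(1-p)}-\tfrac{l}{2(1-p)}\mathbf 1\Big),\qquad \tilde V=\tilde V_j+\sum\Big(\tfrac{U}{m(1-p)}-\tfrac{l}{2(1-p)}\mathbf 1\mathbf 1^{\mathsf T}\Big)+2\big(\lambda(t)-\lambda(t_j)\big)I,$$ the sums being over all statistics received after round $t_j$. If $\det\tilde V\ge(1+\eta)\det\tilde V_j$, it sets $t_{j+1}=t$, $\tilde V_{j+1}=\tilde V$, $\tilde B_{j+1}=\tilde B$, $\tilde\theta_{j+1}=\frac1L\tilde V^{-1}\tilde B$; otherwise the model is unchanged. **Claim.** For every $\varepsilon_0>0$, SBLB is $\varepsilon_0$-LDP. Moreover there are constants $C,\kappa\ge0$, $k\in\mathbb N$, depending only on $d,m,L,S,\sigma,\lambda,\eta$, with $\kappa=0$ if $LS\ge1$, such that for all $\varepsilon_0>0$, $\delta\in(0,1)$, $T\ge1$, all $K$, and every environment as above, SBLB run with $\varepsilon=\sqrt{e^{\varepsilon_0}-1}$ and $\delta_0=\delta$ satisfies, with probability at least $1-\delta$, $$R_T\le C\,\delta^{-\kappa}\,\log^k\!\Big(\frac{2T}\delta\Big)\left(\frac{T^{3/4}\sqrt{e^{\varepsilon_0}+1}}{\sqrt{e^{\varepsilon_0}-1}}+\frac{\log(T)\,(e^{\varepsilon_0}+1)^2}{4}+\frac{\sqrt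 T}{\sqrt{e^{\varepsilon_0}-1}}\right).$$ -/

import Mathlib

open MeasureTheory ProbabilityTheory Matrix
open scoped ENNReal

namespace SBLB

noncomputable section

/-! ### Local differential privacy -/

/-- `(ε, δ)`-local differential privacy of a randomized mechanism `M` (given by the law `M u` of its
output on the data `u` of one user) over the data domain `D`. -/
def IsLDP {α β : Type*} [MeasurableSpace β] (M : α → Measure β) (D : Set α) (ε δ : ℝ) : Prop :=
  ∀ u ∈ D, ∀ u' ∈ D, ∀ O : Set β, MeasurableSet O →
    M u O ≤ ENNReal.ofReal (Real.exp ε) * M u' O + ENNReal.ofReal δ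

/-- The space `𝓑(0, L) × [0, 1]` of (context, reward) pairs of a user. -/
def userData (d : ℕ) (L : ℝ) : Set (EuclideanSpace ℝ (Fin d) × ℝ) :=
  Metric.closedBall 0 L ×ˢ Set.Icc 0 1

/-! ### The local privatizer -/

/-- `Ber(q)` on `Bool` (the parameters used below lie in `[0, 1]`, on which the projection is the
identity). -/
def ber (q : ℝ) : Measure Bool :=
  bernoulliMeasure true false (Set.projIcc (0 : ℝ) 1 zero_le_one q)

/-- The randomizer `R_p^{0/1}`: draw `c ∼ Ber(p)`; return `x` if `c = 0` and a draw of `Ber(1/2)`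
if `c = 1`. -/
def randomizer (p : ℝ) (x : Bool) : Measure Bool :=
  (ber p).bind fun c => if c then ber (1 / 2) else Measure.dirac x

/-- The law of the `k`-th bit, `k = 1, …, m`, of the `m`-bit encoding of `y ∈ [0, 1]`: with
`μ = ⌈y m⌉`, it is `1` if `k < μ`, `Ber(m y - μ + 1)` if `k = μ`, and `0` if `k > μ`.
(The index `q : Fin m` stands for `k = q + 1`.) -/
def encoder (m : ℕ) (y : ℝ) (q : Fin m) : Measure Bool :=
  if (q : ℤ) + 1 < ⌈y * m⌉ then Measure.dirac true
  else if (q : ℤ) + 1 = ⌈y * m⌉ then ber (m * y - ⌈y * m⌉ + 1)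
  else Measure.dirac false

/-- The law of the `q`-th privatized bit of `y`: encode, then randomize. -/
def privateBit (m : ℕ) (p y : ℝ) (q : Fin m) : Measure Bool :=
  (encoder m y q).bind (randomizer p)

/-- The data that a user sends to the shuffler: `m` bits for each entry of the vector `r x` and for
each entry `(i, j)`, `j ≤ i`, of the symmetric matrix `x xᵀ`. -/
abbrev Report (d m : ℕ) : Type :=
  (Fin d → Fin m → Bool) × ({ij : Fin d × Fin d // ij.2 ≤ ij.1} → Fin m → Bool)

/-- The bits `b̃_i`. -/
def Report.b {d m : ℕ} (z : Report d m) (i : Fin d) (q : Fin m) : Bool := z.1 i q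

/-- The bits `w̃_{i,j}`, extended to all pairs by `w̃_{j,i} = w̃_{i,j}`. -/
def Report.w {d m : ℕ} (z : Report d m) (i j : Fin d) (q : Fin m) : Bool :=
  if h : j ≤ i then z.2 ⟨(i, j), h⟩ q else z.2 ⟨(j, i), (not_le.mp h).le⟩ q

/-- The flipping probability `p = 2 / (exp(2 ε₀ / (m d (d + 3))) + 1)`. -/
def flipProb (d m : ℕ) (ε₀ : ℝ) : ℝ := 2 / (Real.exp (2 * ε₀ / (m * d * (d + 3))) + 1)

/-- The local privatizer `M_LDP(x, r, L, ε₀, m)`, as the law of the report: all bits are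
independent, and they privatize the entries of `r x / (2 L) + 1 / 2` and of
`x xᵀ / (2 L ^ 2) + 𝟙 𝟙ᵀ / 2`. -/
def localPrivatizer (d m : ℕ) (L ε₀ : ℝ) (u : EuclideanSpace ℝ (Fin d) × ℝ) :
    Measure (Report d m) :=
  (Measure.pi fun i : Fin d => Measure.pi fun q : Fin m =>
      privateBit m (flipProb d m ε₀) (u.2 * u.1 i / (2 * L) + 1 / 2) q).prod
    (Measure.pi fun ij : {ij : Fin d × Fin d // ij.2 ≤ ij.1} => Measure.pi fun q : Fin m =>
      privateBit m (flipProb d m ε₀) (u.1 ij.1.1 * u.1 ij.1.2 / (2 * L ^ 2) + 1 / 2) q)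

/-! ### The algorithm -/

/-- The inputs of the algorithm, in dimension `d` and with encoding parameter `m`. -/
structure Params (d m : ℕ) where
  /-- horizon -/
  T : ℕ
  /-- LDP parameter `ε₀` -/
  epsLocal : ℝ
  /-- privacy parameter `ε` -/
  eps : ℝ
  /-- privacy parameter `δ₀` -/
  deltaPriv : ℝ
  /-- failure probability `δ` -/
  delta : ℝ
  /-- regularizer `λ` -/
  lam : ℝ
  /-- low switching parameter `η` -/
  eta : ℝ
  /-- bound on the norm of the contexts -/
  L : ℝ
  /-- bound on the norm of the parameter `θ⋆` -/
  S : ℝ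
  /-- sub-Gaussian constant of the noise -/
  σ : ℝ

namespace Params

variable {d m : ℕ} (P : Params d m)

/-- The flipping probability `p` of the local randomizer. -/
def p : ℝ := flipProb d m P.epsLocal

/-- The requirements on the length `l` of a shuffler batch under which the outputs of the shuffler
are centrally `(ε, δ₀ + δ)`-differentially private. -/
def AdmissibleLength (l : ℕ) : Prop :=
  let A : ℝ := (P.eps * l / (32 * d * (d + 3) * Real.log (8 * m * P.T / P.deltaPriv) *
    √(2 * P.T * Real.log (2 * P.T / P.deltaPriv)))) ^ 2
  14 * Real.log (8 * m * P.T / P.deltaPriv) ≤ l * P.p ∧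
  1 - 2 * P.p + 2 * √(2 * Real.log (2 * m * P.T / P.deltaPriv) / l) + A ≤ √((2 + A) ^ 2 - 4)

/-- The length `l⋆` of a shuffler batch: the least admissible one. -/
def batchLength : ℕ := sInf {l : ℕ | P.AdmissibleLength l}

/-- The regularizer `λ_j` of a bandit batch that starts after `t = t_j` rounds. -/
def reg (t : ℕ) : ℝ :=
  √(8 * t * Real.log (2 * t / P.delta)) / m
    + 2 * √(8 * t * Real.log (2 * t / P.delta)) / ((1 - P.p) * √m) + P.lam

/-- The confidence width `β_j` of a bandit batch that starts after `t = t_j` rounds.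
For the initial batch, `t = 0`, Lean's convention `log 0 = 0` makes it
`σ √(d log 3) + S √(3 λ)`. -/
def width (t : ℕ) : ℝ :=
  P.σ * √(8 * Real.log (2 * t / P.delta) + d * Real.log (3 + t * P.L ^ 2 / P.reg t))
    + P.S * √(3 * P.reg t)
    + d / √(P.reg t) *
      (2 * √(P.p * (1 - P.p / 2) * t * m * Real.log (2 * t / P.delta))
        + 8 * Real.log (2 * t / P.delta) / 3
        + √8 / m * √(t * Real.log (2 * t / P.delta)))

end Params

/-- The state of the bandit algorithm. -/
structure State (d : ℕ) where
  /-- the number `t_j` of rounds before the start of the current bandit batch `j` -/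
  t : ℕ
  /-- the estimate `θ̃_j` -/
  θ : EuclideanSpace ℝ (Fin d)
  /-- the design matrix `Ṽ_j` -/
  V : Matrix (Fin d) (Fin d) ℝ
  /-- the vector `B̃_j` -/
  B : Fin d → ℝ
  /-- the debiased matrix statistics received since round `t_j` -/
  dV : Matrix (Fin d) (Fin d) ℝ
  /-- the debiased vector statistics received since round `t_j` -/
  dB : Fin d → ℝ

section Algorithm

variable {d m : ℕ} (P : Params d m)

/-- The initial state: `θ̃_0 = 0` and `Ṽ_0 = λ I`. -/
def State.init : State d := ⟨0, 0, P.lam • 1, 0, 0, 0⟩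

/-- The aggregate `Z` that the shuffler computes on its `k`-th batch (the rounds
`k l, …, k l + l - 1`, rounds and batches being counted from `0`), permuted by `π k`. -/
def aggZ (ρ : ℕ → Report d m) (π : ℕ → Equiv.Perm (Fin P.batchLength)) (k : ℕ) (i : Fin d) : ℝ :=
  ∑ n : Fin P.batchLength, ∑ q : Fin m,
    (((ρ (k * P.batchLength + (π k n : ℕ))).b i q).toNat : ℝ)

/-- The aggregate `U` that the shuffler computes on its `k`-th batch, permuted by `π k`. -/
def aggU (ρ : ℕ → Report d m) (π : ℕ → Equiv.Perm (Fin P.batchLength)) (k : ℕ) (i j : Fin d) : ℝ :=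
  ∑ n : Fin P.batchLength, ∑ q : Fin m,
    (((ρ (k * P.batchLength + (π k n : ℕ))).w i j q).toNat : ℝ)

/-- The action of the bandit algorithm on receiving the aggregates `Z`, `U` after `t` rounds: the
candidate statistics are the current `B̃_j`, `Ṽ_j` plus all debiased aggregates received since
round `t_j`, plus `2 (λ_{j+1} - λ_j) I` for the matrix; they become the new model, and a new bandit
batch starts, if the determinant has grown by the factor `1 + η`. -/
def State.step (t : ℕ) (Z : Fin d → ℝ) (U : Fin d → Fin d → ℝ) (s : State d) : State d :=
  let dB : Fin d → ℝ := fun i =>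
    s.dB i + Z i / (m * (1 - P.p)) - P.batchLength / (2 * (1 - P.p))
  let dV : Matrix (Fin d) (Fin d) ℝ := Matrix.of fun i j =>
    s.dV i j + U i j / (m * (1 - P.p)) - P.batchLength / (2 * (1 - P.p))
  let B : Fin d → ℝ := s.B + dB
  let V : Matrix (Fin d) (Fin d) ℝ := s.V + dV + (2 * (P.reg t - P.reg s.t)) • 1
  if (1 + P.eta) * s.V.det ≤ V.det then
    { t := t, θ := WithLp.toLp 2 ((1 / P.L) • (V⁻¹ *ᵥ B)), V := V, B := B, dV := 0, dB := 0 }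
  else { s with dV := dV, dB := dB }

/-- The state of the bandit algorithm once the shuffler has sent its first `k` batches. -/
def stateAfter (ρ : ℕ → Report d m) (π : ℕ → Equiv.Perm (Fin P.batchLength)) : ℕ → State d
  | 0 => State.init P
  | k + 1 => State.step P ((k + 1) * P.batchLength) (aggZ P ρ π k) (aggU P ρ π k)
      (stateAfter ρ π k)

/-- The state of the bandit algorithm that the user of round `t` (counted from `0`) is given;
`t / l` shuffler batches are complete at that time. -/
def stateAt (ρ : ℕ → Report d m) (π : ℕ → Equiv.Perm (Fin P.batchLength)) (t : ℕ) : State d :=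
  stateAfter P ρ π (t / P.batchLength)

/-- The optimistic index `⟨x, θ̃_j⟩ + β_j ‖x‖_{Ṽ_j⁻¹}`. -/
def index (s : State d) (x : EuclideanSpace ℝ (Fin d)) : ℝ :=
  inner ℝ x s.θ + P.width s.t * √(x.ofLp ⬝ᵥ (s.V⁻¹ *ᵥ x.ofLp))

end Algorithm

/-! ### The interaction and the regret -/

/-- A run of the algorithm for `T` rounds (counted from `0`) with `K` arms on a probability space,
in an environment with parameter `θ⋆`. The contexts are arbitrary: they may depend on the whole
past and on extra randomness. `ℱ t` is the information available in round `t` before the reward. -/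
structure Run {Ω : Type*} [mΩ : MeasurableSpace Ω] (μ : Measure Ω) {d m : ℕ} (P : Params d m)
    (K : ℕ) (θstar : EuclideanSpace ℝ (Fin d)) where
  /-- the history -/
  ℱ : Filtration ℕ mΩ
  /-- the feature vector `x_{t,a}` -/
  context : ℕ → Ω → Fin K → EuclideanSpace ℝ (Fin d)
  /-- the action `a_t` -/
  action : ℕ → Ω → Fin K
  /-- the reward `r_t` -/
  reward : ℕ → Ω → ℝ
  /-- the privatized data that the user of round `t` sends to the shuffler -/
  report : ℕ → Ω → Report d m
  /-- the permutation that the shuffler applies to its `k`-th batch -/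
  perm : ℕ → Ω → Equiv.Perm (Fin P.batchLength)
  measurable_context : ∀ t < P.T, ∀ a, Measurable[ℱ t] fun ω => context t ω a
  measurable_action : ∀ t < P.T, Measurable[ℱ t] (action t)
  measurable_reward : ∀ t < P.T, Measurable[ℱ (t + 1)] (reward t)
  measurable_report : ∀ t < P.T, Measurable[ℱ (t + 1)] (report t)
  /-- contexts are bounded by `L` -/
  norm_context_le : ∀ t < P.T, ∀ ω a, ‖context t ω a‖ ≤ P.L
  /-- noisy rewards lie in `[0, 1]` -/
  reward_mem : ∀ t < P.T, ∀ ω, reward t ω ∈ Set.Icc (0 : ℝ) 1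
  /-- the noise has conditional mean zero -/
  noise_mean : ∀ t < P.T,
    μ[fun ω => reward t ω - inner ℝ (context t ω (action t ω)) θstar | ℱ t] =ᵐ[μ] 0
  /-- the noise is conditionally `σ`-sub-Gaussian -/
  noise_subgaussian : ∀ t < P.T, ∀ c : ℝ,
    μ[fun ω => Real.exp (c * (reward t ω - inner ℝ (context t ω (action t ω)) θstar)) | ℱ t]
      ≤ᵐ[μ] fun _ => Real.exp (P.σ ^ 2 * c ^ 2 / 2)
  /-- given the past and the reward, the report is drawn by the local privatizer -/
  report_law : ∀ t < P.T, ∀ z : Report d m,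
    μ[(report t ⁻¹' {z}).indicator (fun _ => (1 : ℝ)) |
        (ℱ t : MeasurableSpace Ω) ⊔ MeasurableSpace.comap (reward t) inferInstance]
      =ᵐ[μ] fun ω => (localPrivatizer d m P.L P.epsLocal
        (context t ω (action t ω), reward t ω)).real {z}
  /-- the action maximizes the optimistic index -/
  action_optimistic : ∀ t < P.T, ∀ ω a,
    index P (stateAt P (fun s => report s ω) (fun k => perm k ω) t) (context t ω a) ≤
      index P (stateAt P (fun s => report s ω) (fun k => perm k ω) t)
        (context t ω (action t ω))

/-- The regret `R_T = ∑_{t < T} (max_a ⟨x_{t,a}, θ⋆⟩ - ⟨x_{t,a_t}, θ⋆⟩)`. -/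
def Run.regret {Ω : Type*} [MeasurableSpace Ω] {μ : Measure Ω} {d m : ℕ} {P : Params d m}
    {K : ℕ} {θstar : EuclideanSpace ℝ (Fin d)} (R : Run μ P K θstar) (ω : Ω) : ℝ :=
  ∑ t ∈ Finset.range P.T,
    ((⨆ a : Fin K, inner ℝ (R.context t ω a) θstar)
      - inner ℝ (R.context t ω (R.action t ω)) θstar)

end

end SBLB

/-! Privacy. A randomized bit takes each value with probability between `p / 2` and `1 - p / 2`, so
a change of input changes this probability by a factor of at most `(1 - p / 2) / (p / 2) = exp (2 ε₀
/ (m d (d + 3)))`. A report consists of `m d (d + 3) / 2` independent bits, and the factors multiply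
to `exp ε₀`.

Validity of the statistics. The debiased reports have conditional means `r x / (2 L)` and `x xᵀ / (2
L ^ 2)`. Let `X` be `gram`, let `N` and `E` be the privacy noises `noiseMat` and `noiseVec`, let `W`
be `rewardNoise`, and let `M = N + (2 λ(t) - λ) I`. Then `Ṽ = X + M` and `B̃ / L - Ṽ θ⋆ = (W + E) /
L - M θ⋆`. Privacy noise has size `w = √(t log) / ((1 - p) √m)`, and `λ(t) ≥ 4 √2 w` dominates it,
so `M` is comparable with `λ(t) I`. Cauchy-Schwarz for `M` then bounds the error by `S √(3 λ(t))` in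
the norm of `Ṽ` (`validAt_of_deviation`). This summand of `β(t)` alone yields optimism; the others
are only estimated from above. The reward noise is of lower order because `λ(t)` grows like `√t`; it
is absorbed once `t ^ (1 / 4)` exceeds a multiple of the logarithm.

Deviations. In a fixed direction each noise has an exponential supermartingale, controlled up to
time `T` by a first-passage bound (`measure_exists_sum_ge_le`); nets of directions and dyadic blocks
of time make the bounds uniform (`Run.exists_scale_event`). Since `E / L` has to be small compared
with `S λ(t)`, while `λ(t)` is prescribed, the noise is controlled at level `s w` with `s = min 1 (L
S)`. The failure probability of the block at `2 ^ k` is then only of order `(δ / 2 ^ (k + 1)) ^ (s ^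
2)`. From a block `2 ^ k₀` of order `δ ^ (-(1 / s ^ 2 - 1))` on, up to logarithms, these sum to at
most `δ`. This is the origin of `κ`, and of `κ = 0` when `L S ≥ 1`.

Burn-in. Nothing is known about models formed before `τ = 2 ^ k₀`, and one of them might stay in
use. Its determinant is bounded through its entries, whereas valid determinants exceed a power of
`λ(t)`; hence it is replaced after about `(τ log) ^ 2` rounds (`le_of_det_lt`). Both bounds carry
the same power of `1 / (1 - p)`, so this time does not depend on `ε₀`. Earlier regret is bounded
trivially.

Afterwards, optimism bounds the regret of a round by `2 β` times the norm of the feature in `Ṽ_j⁻¹`.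
The determinant test and `det_le_det_and_quad_inv_le` replace `Ṽ_j` by `1 + gram` at the last
complete shuffler batch. It can be replaced by `1 + gram` at the present round unless its
determinant has doubled since; such rounds are charged to the growth of `logDet` over the last `l`
rounds, which sums to `l d log` (`sum_sub_shift_le`). The elliptical potential gives `β √T` up to
logarithms. With `β` of order `T ^ (1 / 4) / √(1 - p)` and `l` of order `1 / p + √T / ε`, again up
to logarithms, the three terms of the rate appear. -/

namespace SBLB

set_option linter.unusedSectionVars false

/-! ### Quadratic forms and determinants -/

section LinearAlgebra

variable {n : Type*} [Fintype n] [DecidableEq n]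

theorem dotProduct_mulVec_symm {A : Matrix n n ℝ} (hA : Aᵀ = A) (x y : n → ℝ) :
    x ⬝ᵥ (A *ᵥ y) = y ⬝ᵥ (A *ᵥ x) := by
  rw [dotProduct_mulVec, ← mulVec_transpose, hA, dotProduct_comm]

theorem posDef_transpose_eq {A : Matrix n n ℝ} (hA : A.PosDef) : Aᵀ = A := by
  rw [← conjTranspose_eq_transpose_of_trivial]
  exact hA.isHermitian.eq

theorem posDef_quad_nonneg {A : Matrix n n ℝ} (hA : A.PosDef) (x : n → ℝ) :
    0 ≤ x ⬝ᵥ (A *ᵥ x) := by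
  simpa using hA.posSemidef.dotProduct_mulVec_nonneg x

theorem posDef_of_quad_ge {A : Matrix n n ℝ} (hA : Aᵀ = A) {c : ℝ} (hc : 0 < c)
    (h : ∀ u : n → ℝ, c * (u ⬝ᵥ u) ≤ u ⬝ᵥ (A *ᵥ u)) : A.PosDef := by
  refine PosDef.of_dotProduct_mulVec_pos ((conjTranspose_eq_transpose_of_trivial A).trans hA) ?_
  intro x hx
  have h1 : 0 < x ⬝ᵥ x := by
    rcases (dotProduct_self_star_nonneg x).lt_or_eq with h | h
    · simpa using h
    · exact absurd (dotProduct_self_eq_zero.mp (by simpa using h.symm)) hx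
  simpa using (mul_pos hc h1).trans_le (h x)

theorem posDef_mul_inv_cancel {A : Matrix n n ℝ} (hA : A.PosDef) : A * A⁻¹ = 1 :=
  mul_nonsing_inv A ((isUnit_iff_isUnit_det A).mp hA.isUnit)

theorem posDef_inv_mul_cancel {A : Matrix n n ℝ} (hA : A.PosDef) : A⁻¹ * A = 1 :=
  nonsing_inv_mul A ((isUnit_iff_isUnit_det A).mp hA.isUnit)

/-- Expanding the square of `x - A B⁻¹ x` in the norm of `A⁻¹` gives `2 x·B⁻¹x ≤ x·A⁻¹x +
(B⁻¹x)·A(B⁻¹x)`, and by hypothesis the last term is at most `x·B⁻¹x`. -/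
theorem quad_inv_le_of_le {A B : Matrix n n ℝ} (hA : A.PosDef) (hB : B.PosDef)
    (h : ∀ u : n → ℝ, u ⬝ᵥ (A *ᵥ u) ≤ u ⬝ᵥ (B *ᵥ u)) (x : n → ℝ) :
    x ⬝ᵥ (B⁻¹ *ᵥ x) ≤ x ⬝ᵥ (A⁻¹ *ᵥ x) := by
  have hi := posDef_transpose_eq hA.inv
  have h1 := posDef_quad_nonneg hA.inv (x - A *ᵥ (B⁻¹ *ᵥ x))
  have h2 := h (B⁻¹ *ᵥ x)
  have h3 : B *ᵥ (B⁻¹ *ᵥ x) = x := by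
    rw [mulVec_mulVec, posDef_mul_inv_cancel hB, one_mulVec]
  have h4 : A⁻¹ *ᵥ (A *ᵥ (B⁻¹ *ᵥ x)) = B⁻¹ *ᵥ x := by
    rw [mulVec_mulVec, posDef_inv_mul_cancel hA, one_mulVec]
  rw [mulVec_sub, h4, sub_dotProduct, dotProduct_sub, dotProduct_sub,
    dotProduct_mulVec_symm hi (A *ᵥ (B⁻¹ *ᵥ x)) x, h4,
    dotProduct_comm (A *ᵥ (B⁻¹ *ᵥ x))] at h1
  rw [h3, dotProduct_comm _ x] at h2
  linarith

/-- The eigenvalues lie in `(0, 1]`, so their product is at most each of them, in particular at most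
the least one. -/
theorem det_mul_le_quad_of_le_one {D : Matrix n n ℝ} (hD : D.PosDef)
    (h : ∀ u : n → ℝ, u ⬝ᵥ (D *ᵥ u) ≤ u ⬝ᵥ u) :
    D.det ≤ 1 ∧ ∀ y : n → ℝ, D.det * (y ⬝ᵥ y) ≤ y ⬝ᵥ (D *ᵥ y) := by
  have hH := hD.isHermitian
  have hpos : ∀ i, 0 < hH.eigenvalues i := fun i => hD.eigenvalues_pos i
  have hle : ∀ i, hH.eigenvalues i ≤ 1 := by
    intro i
    rw [hH.eigenvalues_eq i]
    have h1 := h (⇑(hH.eigenvectorBasis i))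
    have h2 := hH.eigenvectorBasis.orthonormal.1 i
    have h3 : (hH.eigenvectorBasis i).ofLp ⬝ᵥ (hH.eigenvectorBasis i).ofLp = 1 := by
      have := EuclideanSpace.real_norm_sq_eq (hH.eigenvectorBasis i)
      rw [h2] at this
      simp only [dotProduct, ← sq]
      linarith
    simp only [RCLike.re_to_real]
    calc _ ≤ _ := by simpa using h1
      _ = 1 := h3
  have hdet : D.det = ∏ i, hH.eigenvalues i := by simpa using hH.det_eq_prod_eigenvalues
  refine ⟨hdet ▸ Finset.prod_le_one (fun i _ => (hpos i).le) fun i _ => hle i, fun y => ?_⟩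
  have hdi : ∀ i, D.det ≤ hH.eigenvalues i := by
    intro i
    rw [hdet, ← Finset.mul_prod_erase _ _ (Finset.mem_univ i)]
    exact mul_le_of_le_one_right (hpos i).le
      (Finset.prod_le_one (fun j _ => (hpos j).le) fun j _ => hle j)
  set U : Matrix n n ℝ := (hH.eigenvectorUnitary : Matrix n n ℝ) with hU
  have hUU : U * star U = 1 := Unitary.coe_mul_star_self hH.eigenvectorUnitary
  have hsp : D = U * diagonal hH.eigenvalues * star U := by
    have := hH.spectral_theorem
    rw [Unitary.conjStarAlgAut_apply] at this
    exact this
  have hst : star U = Uᵀ := by ext i j; simp [star_apply]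
  set z := Uᵀ *ᵥ y with hz
  have e1 : y ⬝ᵥ (D *ᵥ y) = ∑ i, hH.eigenvalues i * z i ^ 2 := by
    have hDy : D *ᵥ y = U *ᵥ (diagonal hH.eigenvalues *ᵥ (Uᵀ *ᵥ y)) := by
      rw [mulVec_mulVec, mulVec_mulVec, ← hst, ← hsp]
    rw [hDy, ← hz, dotProduct_mulVec, ← mulVec_transpose, ← hz]
    simp only [dotProduct, mulVec_diagonal]
    exact Finset.sum_congr rfl fun i _ => by ring
  have e2 : y ⬝ᵥ y = ∑ i, z i ^ 2 := by
    have : y ⬝ᵥ y = z ⬝ᵥ z := by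
      rw [hz, ← dotProduct_transpose_mulVec, mulVec_mulVec, transpose_transpose, ← hst, hUU,
        one_mulVec]
    rw [this]
    simp [dotProduct, sq]
  rw [e1, e2, Finset.mul_sum]
  exact Finset.sum_le_sum fun i _ => mul_le_mul_of_nonneg_right (hdi i) (sq_nonneg _)

open scoped MatrixOrder in
-- With `A = Rᵀ R`, the matrix `R B⁻¹ Rᵀ` is at most the identity and has determinant `det A / det
-- B`, so the preceding lemma applies to it. This is how a bound on determinants becomes a bound on
-- norms for a model that is updated rarely.
theorem det_le_det_and_quad_inv_le {A B : Matrix n n ℝ} (hA : A.PosDef) (hB : B.PosDef)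
    (h : ∀ u : n → ℝ, u ⬝ᵥ (A *ᵥ u) ≤ u ⬝ᵥ (B *ᵥ u)) :
    A.det ≤ B.det ∧
      ∀ x : n → ℝ, x ⬝ᵥ (A⁻¹ *ᵥ x) ≤ B.det / A.det * (x ⬝ᵥ (B⁻¹ *ᵥ x)) := by
  obtain ⟨R, hR⟩ : ∃ R : Matrix n n ℝ, A = Rᴴ * R :=
    CStarAlgebra.nonneg_iff_eq_star_mul_self.mp hA.posSemidef.nonneg
  have hRt : Rᴴ = Rᵀ := by ext; simp
  rw [hRt] at hR
  have hAd := hA.det_pos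
  have hBd := hB.det_pos
  have hRd : A.det = R.det * R.det := by rw [hR, det_mul, det_transpose]
  have hRu : IsUnit R.det := by
    refine isUnit_iff_ne_zero.mpr fun h0 => ?_
    rw [h0] at hRd
    simp [hRd] at hAd
  have hRtu : IsUnit Rᵀ.det := by rwa [det_transpose]
  set D := R * B⁻¹ * Rᵀ with hDdef
  have hquad : ∀ y : n → ℝ, y ⬝ᵥ (D *ᵥ y) = (Rᵀ *ᵥ y) ⬝ᵥ (B⁻¹ *ᵥ (Rᵀ *ᵥ y)) := by
    intro y
    rw [hDdef, ← mulVec_mulVec, ← mulVec_mulVec, dotProduct_mulVec, ← mulVec_transpose]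
  have hquadA : ∀ y : n → ℝ, (Rᵀ *ᵥ y) ⬝ᵥ (A⁻¹ *ᵥ (Rᵀ *ᵥ y)) = y ⬝ᵥ y := by
    intro y
    have : A⁻¹ *ᵥ (Rᵀ *ᵥ y) = R⁻¹ *ᵥ y := by
      rw [hR, Matrix.mul_inv_rev, mulVec_mulVec, Matrix.mul_assoc, nonsing_inv_mul _ hRtu, Matrix.mul_one]
    rw [this, mulVec_transpose, ← dotProduct_mulVec, mulVec_mulVec, mul_nonsing_inv _ hRu,
      one_mulVec]
  have hDpos : D.PosDef := by
    refine PosDef.of_dotProduct_mulVec_pos ?_ ?_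
    · have := posDef_transpose_eq hB.inv
      simp only [IsHermitian, conjTranspose_eq_transpose_of_trivial, hDdef, transpose_mul,
        transpose_transpose, this, Matrix.mul_assoc]
    · intro y hy
      simp only [star_trivial]
      rw [hquad]
      have hne : Rᵀ *ᵥ y ≠ 0 := by
        intro h0
        apply hy
        have : (Rᵀ)⁻¹ *ᵥ (Rᵀ *ᵥ y) = y := by
          rw [mulVec_mulVec, nonsing_inv_mul _ hRtu, one_mulVec]
        rw [← this, h0, mulVec_zero]
      simpa using hB.inv.dotProduct_mulVec_pos hne
  have hle : ∀ u : n → ℝ, u ⬝ᵥ (D *ᵥ u) ≤ u ⬝ᵥ u := by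
    intro u
    rw [hquad, ← hquadA u]
    exact quad_inv_le_of_le hA hB h _
  obtain ⟨h1, h2⟩ := det_mul_le_quad_of_le_one hDpos hle
  have hDd : D.det = A.det / B.det := by
    rw [hDdef, det_mul, det_mul, det_transpose, det_nonsing_inv, Ring.inverse_eq_inv', hRd]
    field_simp
  rw [hDd] at h1 h2
  refine ⟨by rwa [div_le_one hBd] at h1, fun x => ?_⟩
  have hx : Rᵀ *ᵥ ((Rᵀ)⁻¹ *ᵥ x) = x := by
    rw [mulVec_mulVec, mul_nonsing_inv _ hRtu, one_mulVec]
  have h3 := h2 ((Rᵀ)⁻¹ *ᵥ x)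
  rw [hquad, ← hquadA, hx] at h3
  have : x ⬝ᵥ (A⁻¹ *ᵥ x) = B.det / A.det * (A.det / B.det * (x ⬝ᵥ (A⁻¹ *ᵥ x))) := by
    field_simp
  rw [this]
  exact mul_le_mul_of_nonneg_left h3 (by positivity)

theorem det_add_vecMulVec_self {A : Matrix n n ℝ} (hA : A.PosDef) (x : n → ℝ) :
    (A + vecMulVec x x).det = A.det * (1 + x ⬝ᵥ (A⁻¹ *ᵥ x)) := by
  rw [vecMulVec_eq Unit, det_add_replicateCol_mul_replicateRow
    ((isUnit_iff_isUnit_det A).mp hA.isUnit), Matrix.det_unique (n := Unit)]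
  congr 1
  simp only [Matrix.add_apply, one_apply_eq, mul_apply, replicateRow_apply, replicateCol_apply,
    dotProduct, mulVec, Finset.sum_mul, Finset.mul_sum]
  rw [Finset.sum_comm]
  congr 1
  exact Finset.sum_congr rfl fun i _ => Finset.sum_congr rfl fun j _ => by ring

/-- Substitute `u = V⁻¹ x`. This turns control of the error vector `E` into a width for the
prediction at `x`. -/
theorem abs_dotProduct_inv_mulVec_le {V : Matrix n n ℝ} (hV : V.PosDef) {E : n → ℝ} {b : ℝ}
    (h : ∀ u : n → ℝ, |u ⬝ᵥ E| ≤ b * √(u ⬝ᵥ (V *ᵥ u))) (x : n → ℝ) :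
    |x ⬝ᵥ (V⁻¹ *ᵥ E)| ≤ b * √(x ⬝ᵥ (V⁻¹ *ᵥ x)) := by
  have hi := posDef_transpose_eq hV.inv
  have h1 := h (V⁻¹ *ᵥ x)
  rw [mulVec_mulVec, posDef_mul_inv_cancel hV, one_mulVec, dotProduct_comm _ x,
    dotProduct_comm _ E, dotProduct_mulVec_symm hi] at h1
  exact h1

theorem quad_vecMulVec (x u : n → ℝ) : u ⬝ᵥ (vecMulVec x x *ᵥ u) = (u ⬝ᵥ x) ^ 2 := by
  rw [vecMulVec_mulVec, dotProduct_smul]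
  simp [dotProduct_comm x u, sq]

end LinearAlgebra


/-! ### The local privatizer -/

/-- Hoeffding's lemma for a single Bernoulli variable. It is the source of every variance constant
below. -/
theorem bernoulli_mgf_le {q : ℝ} (hq : q ∈ Set.Icc (0 : ℝ) 1) (c : ℝ) :
    1 - q + q * Real.exp c ≤ Real.exp (c * q + c ^ 2 / 8) := by
  set X : Bool → ℝ := fun b => if b then 1 else 0 with hX
  set μ : Measure Bool := bernoulliMeasure true false ⟨q, hq⟩ with hμ
  have h := hasSubgaussianMGF_of_mem_Icc (μ := μ) (X := X) (a := 0) (b := 1)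
    (measurable_of_finite X).aemeasurable (Filter.Eventually.of_forall fun b => by
      cases b <;> simp [X])
  have hm : ∫ b, X b ∂μ = q := by
    rw [hμ, integral_bernoulliMeasure]
    simp [X]
  have h1 := h.mgf_le c
  rw [mgf, hm, hμ, integral_bernoulliMeasure] at h1
  simp only [X, if_true, Bool.false_eq_true, if_false, smul_eq_mul] at h1
  have h2 := mul_le_mul_of_nonneg_left h1 (Real.exp_pos (c * q)).le
  rw [← Real.exp_add] at h2
  have e1 : Real.exp (c * q) * Real.exp (c * (0 - q)) = 1 := by
    rw [← Real.exp_add]; simp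
  have e2 : Real.exp (c * q) * Real.exp (c * (1 - q)) = Real.exp c := by
    rw [← Real.exp_add]; ring_nf
  calc 1 - q + q * Real.exp c
      = q * (Real.exp (c * q) * Real.exp (c * (1 - q))) +
        (1 - q) * (Real.exp (c * q) * Real.exp (c * (0 - q))) := by rw [e1, e2]; ring
    _ ≤ _ := by
        refine le_trans (le_of_eq ?_) (h2.trans (le_of_eq ?_))
        · ring
        · congr 1
          simp
          ring

instance (q : ℝ) : IsProbabilityMeasure (ber q) := by unfold ber; infer_instance

theorem ber_real_true {q : ℝ} (hq : q ∈ Set.Icc (0 : ℝ) 1) : (ber q).real {true} = q := by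
  rw [ber, bernoulliMeasure_real_apply_of_mem_of_notMem _ (by measurability) (by simp) (by simp),
    Set.projIcc_of_mem _ hq]

theorem real_false_eq (ν : Measure Bool) [IsProbabilityMeasure ν] :
    ν.real {false} = 1 - ν.real {true} := by
  have h := probReal_add_probReal_compl (μ := ν) (s := {true}) (by measurability)
  have : ({true} : Set Bool)ᶜ = {false} := by ext b; cases b <;> simp
  rw [this] at h
  linarith

theorem bind_real_bool (ν : Measure Bool) [IsProbabilityMeasure ν] (f : Bool → Measure Bool)
    [∀ b, IsProbabilityMeasure (f b)] (s : Set Bool) :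
    (ν.bind f).real s = ν.real {true} * (f true).real s + ν.real {false} * (f false).real s := by
  rw [measureReal_def, Measure.bind_apply (by measurability) (measurable_of_finite f).aemeasurable,
    lintegral_fintype]
  simp only [Fintype.sum_bool]
  rw [ENNReal.toReal_add (by finiteness) (by finiteness), ENNReal.toReal_mul, ENNReal.toReal_mul]
  simp only [measureReal_def]
  ring

theorem bind_isProbabilityMeasure (ν : Measure Bool) [IsProbabilityMeasure ν]
    (f : Bool → Measure Bool) [∀ b, IsProbabilityMeasure (f b)] :
    IsProbabilityMeasure (ν.bind f) :=
  isProbabilityMeasure_bind (measurable_of_finite f).aemeasurable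
    (Filter.Eventually.of_forall fun _ => inferInstance)

instance (p : ℝ) (x : Bool) : IsProbabilityMeasure (randomizer p x) := by
  unfold randomizer
  have : ∀ c : Bool, IsProbabilityMeasure (if c then ber (1 / 2) else Measure.dirac x) := by
    intro c; cases c <;> simp <;> infer_instance
  exact bind_isProbabilityMeasure _ _

instance (m : ℕ) (y : ℝ) (q : Fin m) : IsProbabilityMeasure (encoder m y q) := by
  unfold encoder
  split_ifs <;> infer_instance

instance (m : ℕ) (p y : ℝ) (q : Fin m) : IsProbabilityMeasure (privateBit m p y q) :=
  bind_isProbabilityMeasure _ _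

theorem randomizer_real_true {p : ℝ} (hp : p ∈ Set.Icc (0 : ℝ) 1) (x : Bool) :
    (randomizer p x).real {true} = (if x then 1 - p / 2 else p / 2) := by
  have : ∀ c : Bool, IsProbabilityMeasure (if c then ber (1 / 2) else Measure.dirac x) := by
    intro c; cases c <;> simp <;> infer_instance
  rw [randomizer, bind_real_bool, real_false_eq, ber_real_true hp]
  simp only [if_true, Bool.false_eq_true, if_false]
  rw [ber_real_true (by norm_num)]
  cases x <;> simp [measureReal_def] <;> ring

theorem privateBit_real_true {m : ℕ} {p : ℝ} (hp : p ∈ Set.Icc (0 : ℝ) 1) (y : ℝ) (q : Fin m) :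
    (privateBit m p y q).real {true} = (1 - p) * (encoder m y q).real {true} + p / 2 := by
  rw [privateBit, bind_real_bool, randomizer_real_true hp, randomizer_real_true hp, real_false_eq]
  simp
  ring

theorem privateBit_real_bounds {m : ℕ} {p : ℝ} (hp : p ∈ Set.Icc (0 : ℝ) 1) (y : ℝ) (q : Fin m)
    (b : Bool) :
    p / 2 ≤ (privateBit m p y q).real {b} ∧ (privateBit m p y q).real {b} ≤ 1 - p / 2 := by
  have h1 := privateBit_real_true hp y q
  have h2 : (encoder m y q).real {true} ≤ 1 := measureReal_le_one
  have h3 : 0 ≤ (encoder m y q).real {true} := measureReal_nonneg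
  have h4 : (1 - p) * (encoder m y q).real {true} ≤ 1 - p :=
    mul_le_of_le_one_right (by linarith [hp.2]) h2
  have h5 : 0 ≤ (1 - p) * (encoder m y q).real {true} := mul_nonneg (by linarith [hp.2]) h3
  cases b
  · rw [real_false_eq, h1]; constructor <;> linarith
  · rw [h1]; constructor <;> linarith

theorem sum_ite_lt_eq {m n : ℕ} (hn : n < m) (f : ℝ) :
    ∑ q : Fin m, (if (q : ℕ) < n then (1 : ℝ) else if (q : ℕ) = n then f else 0) = n + f := by
  have h1 : ∀ q : Fin m, (if (q : ℕ) < n then (1 : ℝ) else if (q : ℕ) = n then f else 0) =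
      (if (q : ℕ) < n then (1 : ℝ) else 0) + if (q : ℕ) = n then f else 0 := by
    intro q
    split_ifs <;> first | omega | simp
  simp_rw [h1]
  rw [Finset.sum_add_distrib,
    Fin.sum_univ_eq_sum_range (fun q : ℕ => if q < n then (1 : ℝ) else 0),
    Fin.sum_univ_eq_sum_range (fun q : ℕ => if q = n then f else 0)]
  congr 1
  · rw [Finset.sum_ite, Finset.sum_const_zero, add_zero, Finset.sum_const]
    have : (Finset.range m).filter (fun q => q < n) = Finset.range n := by
      ext q; simp only [Finset.mem_filter, Finset.mem_range]; omega
    rw [this]; simp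
  · rw [Finset.sum_ite_eq' (Finset.range m) n (fun _ => f)]; simp [hn]

/-- The bits are not identically distributed, but the certain ones and the fractional one add up:
the encoding is unbiased in the sum, which is all that the statistics use. -/
theorem sum_encoder_real_true {m : ℕ} {y : ℝ} (hy : y ∈ Set.Icc (0 : ℝ) 1) :
    ∑ q : Fin m, (encoder m y q).real {true} = m * y := by
  have hym : 0 ≤ y * m := mul_nonneg hy.1 (Nat.cast_nonneg m)
  have hE : ∀ q : Fin m, (encoder m y q).real {true} = if (q : ℤ) + 1 < ⌈y * m⌉ then (1 : ℝ)
      else if (q : ℤ) + 1 = ⌈y * m⌉ then m * y - ⌈y * m⌉ + 1 else 0 := by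
    intro q
    unfold encoder
    have h1 := Int.ceil_lt_add_one (y * m)
    have h2 := Int.le_ceil (y * m)
    split_ifs
    · simp [measureReal_def]
    · exact ber_real_true ⟨by nlinarith, by nlinarith⟩
    · simp [measureReal_def]
  simp_rw [hE]
  obtain ⟨k, hk⟩ := Int.eq_ofNat_of_zero_le (Int.ceil_nonneg hym)
  rw [hk]
  rcases Nat.eq_zero_or_pos k with h0 | h0
  · subst h0
    have : y * m ≤ 0 := by have := Int.le_ceil (y * m); rw [hk] at this; simpa using this
    rw [Finset.sum_eq_zero]
    · linarith
    · intro q _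
      rw [if_neg (by simp; omega), if_neg (by simp; omega)]
  · obtain ⟨n, rfl⟩ : ∃ n, k = n + 1 := ⟨k - 1, by omega⟩
    have hn : n < m := by
      have : ⌈y * m⌉ ≤ (m : ℤ) := Int.ceil_le.mpr (by
        simpa using mul_le_mul_of_nonneg_right hy.2 (Nat.cast_nonneg m))
      omega
    have := sum_ite_lt_eq hn (m * y - n)
    push_cast
    refine Eq.trans ?_ (this.trans (by ring))
    refine Finset.sum_congr rfl fun q _ => ?_
    have e1 : ((q : ℤ) + 1 < (n : ℤ) + 1) ↔ (q : ℕ) < n := by omega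
    have e2 : ((q : ℤ) + 1 = (n : ℤ) + 1) ↔ (q : ℕ) = n := by omega
    simp only [e1, e2]
    split_ifs <;> first | rfl | ring

theorem sum_privateBit_real_true {m : ℕ} {p y : ℝ} (hp : p ∈ Set.Icc (0 : ℝ) 1)
    (hy : y ∈ Set.Icc (0 : ℝ) 1) :
    ∑ q : Fin m, (privateBit m p y q).real {true} = m * ((1 - p) * y + p / 2) := by
  simp_rw [privateBit_real_true hp]
  rw [Finset.sum_add_distrib, ← Finset.mul_sum, sum_encoder_real_true hy]
  simp
  ring

theorem prod_integral_privateBit_le {m : ℕ} {p y : ℝ} (hp : p ∈ Set.Icc (0 : ℝ) 1)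
    (hy : y ∈ Set.Icc (0 : ℝ) 1) (c : ℝ) :
    ∏ q : Fin m, ∫ b, Real.exp (c * (b.toNat : ℝ)) ∂(privateBit m p y q) ≤
      Real.exp (c * (m * ((1 - p) * y + p / 2)) + m * c ^ 2 / 8) := by
  have h1 : ∀ q : Fin m, ∫ b, Real.exp (c * (b.toNat : ℝ)) ∂(privateBit m p y q) ≤
      Real.exp (c * (privateBit m p y q).real {true} + c ^ 2 / 8) := by
    intro q
    rw [integral_fintype .of_finite]
    simp only [Fintype.sum_bool, smul_eq_mul, real_false_eq]
    refine le_trans (le_of_eq ?_) (bernoulli_mgf_le ⟨measureReal_nonneg, measureReal_le_one⟩ c)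
    simp
    ring
  refine (Finset.prod_le_prod (fun q _ => integral_nonneg fun b => (Real.exp_pos _).le)
    fun q _ => h1 q).trans (le_of_eq ?_)
  rw [← Real.exp_sum, Finset.sum_add_distrib, ← Finset.mul_sum, sum_privateBit_real_true hp hy]
  simp
  ring

theorem flipProb_pos (d m : ℕ) (ε₀ : ℝ) : 0 < flipProb d m ε₀ := by
  unfold flipProb; positivity

theorem flipProb_lt_one {d m : ℕ} (hd : 0 < d) (hm : 0 < m) {ε₀ : ℝ} (h : 0 < ε₀) :
    flipProb d m ε₀ < 1 := by
  unfold flipProb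
  rw [div_lt_one (by positivity)]
  have : 1 < Real.exp (2 * ε₀ / (m * d * (d + 3))) := Real.one_lt_exp_iff.mpr (by positivity)
  linarith

theorem flipProb_mem {d m : ℕ} {ε₀ : ℝ} (h : 0 < ε₀) :
    flipProb d m ε₀ ∈ Set.Icc (0 : ℝ) 1 := by
  refine ⟨(flipProb_pos d m ε₀).le, ?_⟩
  unfold flipProb
  rw [div_le_one (by positivity)]
  have : 1 ≤ Real.exp (2 * ε₀ / (m * d * (d + 3))) := Real.one_le_exp (by positivity)
  linarith

instance (d m : ℕ) (L ε₀ : ℝ) (u : EuclideanSpace ℝ (Fin d) × ℝ) :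
    IsProbabilityMeasure (localPrivatizer d m L ε₀ u) := by
  unfold localPrivatizer; infer_instance

theorem localPrivatizer_real_singleton (d m : ℕ) (L ε₀ : ℝ) (u : EuclideanSpace ℝ (Fin d) × ℝ)
    (z : Report d m) :
    (localPrivatizer d m L ε₀ u).real {z} =
      (∏ i, ∏ q, (privateBit m (flipProb d m ε₀) (u.2 * u.1 i / (2 * L) + 1 / 2) q).real
        {z.1 i q}) *
      ∏ ij, ∏ q, (privateBit m (flipProb d m ε₀)
        (u.1 ij.1.1 * u.1 ij.1.2 / (2 * L ^ 2) + 1 / 2) q).real {z.2 ij q} := by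
  have : ({z} : Set (Report d m)) = {z.1} ×ˢ {z.2} := by
    rw [Set.singleton_prod_singleton]
  rw [localPrivatizer, measureReal_def, this, Measure.prod_prod, ENNReal.toReal_mul]
  simp only [Measure.pi_singleton, ENNReal.toReal_prod, measureReal_def]

theorem card_lower (d : ℕ) :
    2 * Fintype.card {ij : Fin d × Fin d // ij.2 ≤ ij.1} = d * (d + 1) := by
  rw [Fintype.card_subtype, Finset.card_filter, Fintype.sum_prod_type]
  have : ∀ i : Fin d, ∑ j : Fin d, (if j ≤ i then 1 else 0) = (i : ℕ) + 1 := by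
    intro i
    rw [← Finset.card_filter, ← Fin.card_Iic]
    congr 1
    ext j; simp
  simp only [this]
  rw [Fin.sum_univ_eq_sum_range (fun i => i + 1), mul_comm]
  have h := Finset.sum_range_succ' (fun i => i) d
  rw [add_zero] at h
  rw [← h, Finset.sum_range_id_mul_two, Nat.add_sub_cancel, mul_comm]

theorem localPrivatizer_isLDP {d m : ℕ} (hd : 0 < d) (hm : 0 < m) (L : ℝ) {ε₀ : ℝ}
    (hε : 0 < ε₀) : IsLDP (localPrivatizer d m L ε₀) (userData d L) ε₀ 0 := by
  intro u _ u' _ O _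
  have hp := flipProb_mem (d := d) (m := m) hε
  set p := flipProb d m ε₀ with hpdef
  set a := 2 * ε₀ / (m * d * (d + 3)) with ha
  have hpp : 0 < p := flipProb_pos d m ε₀
  have hratio : ∀ (y y' : ℝ) (q : Fin m) (b : Bool),
      (privateBit m p y q).real {b} ≤ Real.exp a * (privateBit m p y' q).real {b} := by
    intro y y' q b
    have h1 := (privateBit_real_bounds hp y q b).2
    have h2 := (privateBit_real_bounds hp y' q b).1
    -- The flipping probability is chosen to make this an equality.
    have h3 : 1 - p / 2 = Real.exp a * (p / 2) := by
      rw [hpdef, flipProb, ← ha]; field_simp; ring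
    rw [h3] at h1
    exact h1.trans (mul_le_mul_of_nonneg_left h2 (Real.exp_pos a).le)
  have hprod : ∀ {ι : Type} [Fintype ι] (y y' : ι → ℝ) (z : ι → Fin m → Bool),
      ∏ i, ∏ q, (privateBit m p (y i) q).real {z i q} ≤
        Real.exp a ^ (m * Fintype.card ι) * ∏ i, ∏ q, (privateBit m p (y' i) q).real {z i q} := by
    intro ι _ y y' z
    calc _ ≤ ∏ i, ∏ q, (Real.exp a * (privateBit m p (y' i) q).real {z i q}) :=
          Finset.prod_le_prod (fun i _ => Finset.prod_nonneg fun q _ => measureReal_nonneg)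
            fun i _ => Finset.prod_le_prod (fun q _ => measureReal_nonneg)
              fun q _ => hratio _ _ q _
      _ = _ := by
          simp only [Finset.prod_mul_distrib, Finset.prod_const, Finset.card_univ,
            Fintype.card_fin, ← pow_mul]
  have hpt : ∀ z : Report d m, (localPrivatizer d m L ε₀ u).real {z} ≤
      Real.exp ε₀ * (localPrivatizer d m L ε₀ u').real {z} := by
    intro z
    rw [localPrivatizer_real_singleton, localPrivatizer_real_singleton]
    -- There are `d + d (d + 1) / 2 = d (d + 3) / 2` encoded numbers with `m` bits each, and `a`
    -- times the number of bits is `ε₀`.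
    have he : Real.exp ε₀ = Real.exp a ^ (m * Fintype.card (Fin d)) *
        Real.exp a ^ (m * Fintype.card {ij : Fin d × Fin d // ij.2 ≤ ij.1}) := by
      rw [← pow_add, ← Real.exp_nat_mul]
      congr 1
      have hc : (2 : ℝ) * (Fintype.card {ij : Fin d × Fin d // ij.2 ≤ ij.1} : ℝ) =
          d * (d + 1) := by exact_mod_cast card_lower d
      have hm' : (0 : ℝ) < m := by exact_mod_cast hm
      have hd' : (0 : ℝ) < d := by exact_mod_cast hd
      have e : ((m * Fintype.card (Fin d) +
          m * Fintype.card {ij : Fin d × Fin d // ij.2 ≤ ij.1} : ℕ) : ℝ) =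
          m * d * (d + 3) / 2 := by
        push_cast
        rw [Fintype.card_fin]
        linear_combination (m : ℝ) / 2 * hc
      rw [e, ha]
      field_simp
    rw [he]
    refine (mul_le_mul (hprod _ (fun i => u'.2 * u'.1 i / (2 * L) + 1 / 2) z.1)
      (hprod _ (fun ij : {ij : Fin d × Fin d // ij.2 ≤ ij.1} =>
        u'.1 ij.1.1 * u'.1 ij.1.2 / (2 * L ^ 2) + 1 / 2) z.2) ?_ ?_).trans (le_of_eq ?_)
    · exact Finset.prod_nonneg fun i _ => Finset.prod_nonneg fun q _ => measureReal_nonneg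
    · exact mul_nonneg (by positivity)
        (Finset.prod_nonneg fun i _ => Finset.prod_nonneg fun q _ => measureReal_nonneg)
    · ring
  -- The space of reports is finite, so the bound on singletons sums to a bound on every event.
  have hfin : O.Finite := Set.toFinite O
  have hsum : ∀ ν : Measure (Report d m), ν O = ∑ z ∈ hfin.toFinset, ν {z} := by
    intro ν
    rw [sum_measure_singleton, Set.Finite.coe_toFinset]
  rw [ENNReal.ofReal_zero, add_zero, hsum, hsum, Finset.mul_sum]
  refine Finset.sum_le_sum fun z _ => ?_
  rw [← ofReal_measureReal, ← ofReal_measureReal, ← ENNReal.ofReal_mul (Real.exp_pos _).le]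
  exact ENNReal.ofReal_le_ofReal (hpt z)


/-! ### Debiased reports -/

/-- The debiased vector statistic of one report; its mean is `r x / (2 L)`. -/
noncomputable def debiasedVec {d m : ℕ} (p : ℝ) (z : Report d m) (i : Fin d) : ℝ :=
  (∑ q, ((z.b i q).toNat : ℝ)) / (m * (1 - p)) - 1 / (2 * (1 - p))

/-- The debiased matrix statistic of one report; its mean is `x xᵀ / (2 L ^ 2)`. -/
noncomputable def debiasedMat {d m : ℕ} (p : ℝ) (z : Report d m) (i j : Fin d) : ℝ :=
  (∑ q, ((z.w i j q).toNat : ℝ)) / (m * (1 - p)) - 1 / (2 * (1 - p))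

theorem Report.w_comm {d m : ℕ} (z : Report d m) (i j : Fin d) (q : Fin m) :
    z.w i j q = z.w j i q := by
  unfold Report.w
  rcases lt_trichotomy i j with h | h | h
  · rw [dif_neg (not_le.mpr h), dif_pos h.le]
  · subst h; rfl
  · rw [dif_pos h.le, dif_neg (not_le.mpr h)]

theorem debiasedMat_comm {d m : ℕ} (p : ℝ) (z : Report d m) (i j : Fin d) :
    debiasedMat p z i j = debiasedMat p z j i := by
  simp only [debiasedMat, z.w_comm i j]

theorem sum_toNat_bounds {m : ℕ} (b : Fin m → Bool) :
    0 ≤ ∑ q, ((b q).toNat : ℝ) ∧ ∑ q, ((b q).toNat : ℝ) ≤ m := by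
  refine ⟨Finset.sum_nonneg fun q _ => Nat.cast_nonneg _, ?_⟩
  calc ∑ q, ((b q).toNat : ℝ) ≤ ∑ _q : Fin m, (1 : ℝ) :=
        Finset.sum_le_sum fun q _ => by exact_mod_cast Bool.toNat_le (b q)
    _ = m := by simp

theorem abs_debiased_le {m : ℕ} {p : ℝ} (hm : 0 < m) (hp : p < 1) (b : Fin m → Bool) :
    |(∑ q, ((b q).toNat : ℝ)) / (m * (1 - p)) - 1 / (2 * (1 - p))| ≤ 1 / (2 * (1 - p)) := by
  obtain ⟨h1, h2⟩ := sum_toNat_bounds b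
  have hp' : 0 < 1 - p := by linarith
  have hm' : (0 : ℝ) < m := by exact_mod_cast hm
  have h3 : (∑ q, ((b q).toNat : ℝ)) / (m * (1 - p)) ≤ 1 / (1 - p) := by
    rw [div_le_div_iff₀ (by positivity) hp']
    nlinarith
  have h4 : 0 ≤ (∑ q, ((b q).toNat : ℝ)) / (m * (1 - p)) := by positivity
  have h5 : 1 / (1 - p) = 1 / (2 * (1 - p)) + 1 / (2 * (1 - p)) := by field_simp; norm_num
  rw [abs_le]
  constructor <;> linarith

theorem integral_exp_linear_le {d m : ℕ} {L ε₀ : ℝ} (hε : 0 < ε₀)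
    {u : EuclideanSpace ℝ (Fin d) × ℝ}
    (hb : ∀ i, u.2 * u.1 i / (2 * L) + 1 / 2 ∈ Set.Icc (0 : ℝ) 1)
    (hw : ∀ i j, u.1 i * u.1 j / (2 * L ^ 2) + 1 / 2 ∈ Set.Icc (0 : ℝ) 1)
    (cb : Fin d → ℝ) (cw : {ij : Fin d × Fin d // ij.2 ≤ ij.1} → ℝ) :
    ∫ z, Real.exp (∑ i, cb i * ∑ q, ((z.1 i q).toNat : ℝ) +
        ∑ ij, cw ij * ∑ q, ((z.2 ij q).toNat : ℝ)) ∂(localPrivatizer d m L ε₀ u) ≤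
      Real.exp (∑ i, (cb i * (m * ((1 - flipProb d m ε₀) * (u.2 * u.1 i / (2 * L) + 1 / 2) +
          flipProb d m ε₀ / 2)) + m * cb i ^ 2 / 8) +
        ∑ ij, (cw ij * (m * ((1 - flipProb d m ε₀) *
          (u.1 ij.1.1 * u.1 ij.1.2 / (2 * L ^ 2) + 1 / 2) + flipProb d m ε₀ / 2)) +
            m * cw ij ^ 2 / 8)) := by
  have hp := flipProb_mem (d := d) (m := m) hε
  have key : ∀ {ι : Type} [Fintype ι] (c : ι → ℝ) (y : ι → ℝ) (_ : ∀ i, y i ∈ Set.Icc (0 : ℝ) 1),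
      ∫ z : ι → Fin m → Bool, Real.exp (∑ i, c i * ∑ q, ((z i q).toNat : ℝ))
        ∂(Measure.pi fun i => Measure.pi fun q => privateBit m (flipProb d m ε₀) (y i) q) ≤
      Real.exp (∑ i, (c i * (m * ((1 - flipProb d m ε₀) * y i + flipProb d m ε₀ / 2)) +
        m * c i ^ 2 / 8)) := by
    intro ι _ c y hy
    simp only [Real.exp_sum, Finset.mul_sum]
    rw [integral_fintype_prod_eq_prod (μ := fun i => Measure.pi fun q =>
      privateBit m (flipProb d m ε₀) (y i) q)
      (f := fun i (b : Fin m → Bool) => ∏ q, Real.exp (c i * ((b q).toNat : ℝ)))]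
    refine Finset.prod_le_prod (fun i _ => integral_nonneg fun z =>
      Finset.prod_nonneg fun q _ => (Real.exp_pos _).le) fun i _ => ?_
    rw [integral_fintype_prod_eq_prod (μ := fun q => privateBit m (flipProb d m ε₀) (y i) q)
      (f := fun q (b : Bool) => Real.exp (c i * (b.toNat : ℝ)))]
    exact prod_integral_privateBit_le hp (hy i) (c i)
  simp only [Real.exp_add]
  rw [localPrivatizer, integral_prod_mul
    (f := fun z : Fin d → Fin m → Bool => Real.exp (∑ i, cb i * ∑ q, ((z i q).toNat : ℝ)))
    (g := fun z : {ij : Fin d × Fin d // ij.2 ≤ ij.1} → Fin m → Bool =>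
      Real.exp (∑ i, cw i * ∑ q, ((z i q).toNat : ℝ)))]
  exact mul_le_mul (key cb _ hb) (key cw (fun ij => u.1 ij.1.1 * u.1 ij.1.2 / (2 * L ^ 2) + 1 / 2)
    fun ij => hw _ _) (integral_nonneg fun z => (Real.exp_pos _).le) (Real.exp_pos _).le

theorem abs_coord_le {d : ℕ} {L : ℝ} {x : EuclideanSpace ℝ (Fin d)} (hx : ‖x‖ ≤ L) (i : Fin d) :
    |x i| ≤ L :=
  (by simpa using PiLp.norm_apply_le x i : |x i| ≤ ‖x‖).trans hx

theorem encoded_vec_mem {d : ℕ} {L : ℝ} (hL : 0 < L) {u : EuclideanSpace ℝ (Fin d) × ℝ}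
    (hu : u ∈ userData d L) (i : Fin d) :
    u.2 * u.1 i / (2 * L) + 1 / 2 ∈ Set.Icc (0 : ℝ) 1 := by
  obtain ⟨h1, h2⟩ := hu
  have hx := abs_le.mp (abs_coord_le (by simpa using h1) i)
  have h3 : -1 / 2 ≤ u.2 * u.1 i / (2 * L) ∧ u.2 * u.1 i / (2 * L) ≤ 1 / 2 := by
    rw [div_le_div_iff₀ (by norm_num) (by positivity),
      div_le_div_iff₀ (by positivity) (by norm_num)]
    have := h2.1; have := h2.2
    constructor <;> nlinarith
  constructor <;> linarith

theorem encoded_mat_mem {d : ℕ} {L : ℝ} (hL : 0 < L) {u : EuclideanSpace ℝ (Fin d) × ℝ}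
    (hu : u ∈ userData d L) (i j : Fin d) :
    u.1 i * u.1 j / (2 * L ^ 2) + 1 / 2 ∈ Set.Icc (0 : ℝ) 1 := by
  have hx := abs_coord_le (by simpa using hu.1) i
  have hy := abs_coord_le (by simpa using hu.1) j
  have h := abs_le.mp ((abs_mul (u.1 i) (u.1 j)).le.trans
    (mul_le_mul hx hy (abs_nonneg _) hL.le))
  have h3 : -1 / 2 ≤ u.1 i * u.1 j / (2 * L ^ 2) ∧ u.1 i * u.1 j / (2 * L ^ 2) ≤ 1 / 2 := by
    rw [div_le_div_iff₀ (by norm_num) (by positivity),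
      div_le_div_iff₀ (by positivity) (by norm_num)]
    constructor <;> nlinarith
  constructor <;> linarith

/-- Each of the `m` bits of coordinate `i` has weight `v i / (m (1 - p))` and costs one eighth of
its square. -/
theorem integral_exp_debiasedVec_le {d m : ℕ} (hd : 0 < d) (hm : 0 < m) {L ε₀ : ℝ} (hL : 0 < L)
    (hε : 0 < ε₀) {u : EuclideanSpace ℝ (Fin d) × ℝ} (hu : u ∈ userData d L) (v : Fin d → ℝ) :
    ∫ z, Real.exp (∑ i, v i * (debiasedVec (flipProb d m ε₀) z i - u.2 * u.1 i / (2 * L)))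
        ∂(localPrivatizer d m L ε₀ u) ≤
      Real.exp ((∑ i, v i ^ 2) / (8 * m * (1 - flipProb d m ε₀) ^ 2)) := by
  have hp := flipProb_lt_one hd hm hε
  set p := flipProb d m ε₀ with hpdef
  have hp' : 0 < 1 - p := by linarith
  have hm' : (0 : ℝ) < m := by exact_mod_cast hm
  have h := integral_exp_linear_le (m := m) hε (encoded_vec_mem hL hu) (encoded_mat_mem hL hu)
    (fun i => v i / (m * (1 - p))) (fun _ => 0)
  simp only [zero_mul, Finset.sum_const_zero, add_zero, ← hpdef, ne_eq, OfNat.ofNat_ne_zero,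
    not_false_eq_true, zero_pow, mul_zero, zero_div] at h
  set K : ℝ := ∑ i, v i * (1 / (2 * (1 - p)) + u.2 * u.1 i / (2 * L)) with hK
  have e1 : ∀ z : Report d m, Real.exp (∑ i, v i * (debiasedVec p z i - u.2 * u.1 i / (2 * L))) =
      Real.exp (∑ i, v i / (m * (1 - p)) * ∑ q, ((z.1 i q).toNat : ℝ)) * Real.exp (-K) := by
    intro z
    rw [← Real.exp_add, hK, ← Finset.sum_neg_distrib, ← Finset.sum_add_distrib]
    congr 1
    refine Finset.sum_congr rfl fun i _ => ?_
    simp only [debiasedVec, Report.b]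
    ring
  simp_rw [e1]
  rw [integral_mul_const]
  refine (mul_le_mul_of_nonneg_right h (Real.exp_pos _).le).trans (le_of_eq ?_)
  rw [← Real.exp_add, hK, ← Finset.sum_neg_distrib, ← Finset.sum_add_distrib, Finset.sum_div]
  congr 1
  refine Finset.sum_congr rfl fun i _ => ?_
  field_simp
  ring

theorem sum_symm_eq_sum_lower {d : ℕ} (f : Fin d → Fin d → ℝ) (hf : ∀ i j, f i j = f j i) :
    ∑ i, ∑ j, f i j = ∑ ij : {ij : Fin d × Fin d // ij.2 ≤ ij.1},
      (if ij.1.1 = ij.1.2 then 1 else 2) * f ij.1.1 ij.1.2 := by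
  have h1 : ∑ ij : {ij : Fin d × Fin d // ij.2 ≤ ij.1},
      (if ij.1.1 = ij.1.2 then 1 else 2) * f ij.1.1 ij.1.2 =
      ∑ i, ∑ j, if j ≤ i then (if i = j then 1 else 2) * f i j else 0 := by
    rw [← Fintype.sum_prod_type' (f := fun i j =>
      if j ≤ i then (if i = j then 1 else 2) * f i j else 0), ← Finset.sum_filter]
    exact (Finset.sum_subtype _ (by simp) (fun ij : Fin d × Fin d =>
      (if ij.1 = ij.2 then (1 : ℝ) else 2) * f ij.1 ij.2)).symm
  have h2 : ∑ i, ∑ j, f i j = ∑ i, ∑ j, ((if j ≤ i then f i j else 0) +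
      if i < j then f i j else 0) := by
    refine Finset.sum_congr rfl fun i _ => Finset.sum_congr rfl fun j _ => ?_
    by_cases h : j ≤ i
    · simp [h, not_lt.mpr h]
    · simp [h, not_le.mp h]
  have h3 : ∑ i, ∑ j, (if i < j then f i j else 0) = ∑ i, ∑ j, if j < i then f i j else 0 := by
    rw [Finset.sum_comm]
    exact Finset.sum_congr rfl fun i _ => Finset.sum_congr rfl fun j _ => by rw [hf]
  rw [h1, h2]
  simp only [Finset.sum_add_distrib]
  rw [h3, ← Finset.sum_add_distrib]
  refine Finset.sum_congr rfl fun i _ => ?_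
  rw [← Finset.sum_add_distrib]
  refine Finset.sum_congr rfl fun j _ => ?_
  rcases lt_trichotomy i j with h | h | h
  · simp [not_le.mpr h, not_lt.mpr h.le]
  · simp [h]
  · simp [h, h.le, h.ne']; ring

/-- The entries `(i, j)` and `(j, i)` share their bits, so an off-diagonal pair has weight `κ = 2`.
Using `κ ^ 2 ≤ 2 κ`, the sum of `κ (v i v j) ^ 2` over `j ≤ i` is completed to `(∑ v i ^ 2) ^ 2`;
this doubles the constant `1 / 8`. -/
theorem integral_exp_debiasedMat_le {d m : ℕ} (hd : 0 < d) (hm : 0 < m) {L ε₀ : ℝ} (hL : 0 < L)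
    (hε : 0 < ε₀) {u : EuclideanSpace ℝ (Fin d) × ℝ} (hu : u ∈ userData d L) (α : ℝ)
    (v : Fin d → ℝ) :
    ∫ z, Real.exp (α * ∑ i, ∑ j, v i * v j *
        (debiasedMat (flipProb d m ε₀) z i j - u.1 i * u.1 j / (2 * L ^ 2)))
        ∂(localPrivatizer d m L ε₀ u) ≤
      Real.exp (α ^ 2 * (∑ i, v i ^ 2) ^ 2 / (4 * m * (1 - flipProb d m ε₀) ^ 2)) := by
  have hp := flipProb_lt_one hd hm hε
  set p := flipProb d m ε₀ with hpdef
  have hp' : 0 < 1 - p := by linarith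
  have hm' : (0 : ℝ) < m := by exact_mod_cast hm
  set κ : {ij : Fin d × Fin d // ij.2 ≤ ij.1} → ℝ := fun ij =>
    if ij.1.1 = ij.1.2 then 1 else 2 with hκ
  have h := integral_exp_linear_le (m := m) hε (encoded_vec_mem hL hu) (encoded_mat_mem hL hu)
    (fun _ => 0) (fun ij => α * (κ ij * (v ij.1.1 * v ij.1.2)) / (m * (1 - p)))
  simp only [zero_mul, Finset.sum_const_zero, zero_add, ← hpdef, ne_eq, OfNat.ofNat_ne_zero,
    not_false_eq_true, zero_pow, mul_zero, zero_div] at h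
  set K : ℝ := ∑ ij : {ij : Fin d × Fin d // ij.2 ≤ ij.1}, α * (κ ij * (v ij.1.1 * v ij.1.2)) *
    (1 / (2 * (1 - p)) + u.1 ij.1.1 * u.1 ij.1.2 / (2 * L ^ 2)) with hK
  have e1 : ∀ z : Report d m, Real.exp (α * ∑ i, ∑ j, v i * v j *
        (debiasedMat p z i j - u.1 i * u.1 j / (2 * L ^ 2))) =
      Real.exp (∑ ij, α * (κ ij * (v ij.1.1 * v ij.1.2)) / (m * (1 - p)) *
        ∑ q, ((z.2 ij q).toNat : ℝ)) * Real.exp (-K) := by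
    intro z
    rw [← Real.exp_add, hK, ← Finset.sum_neg_distrib, ← Finset.sum_add_distrib,
      sum_symm_eq_sum_lower _ fun i j => by rw [debiasedMat_comm]; ring, Finset.mul_sum]
    congr 1
    refine Finset.sum_congr rfl fun ij _ => ?_
    have : ∀ q, z.w ij.1.1 ij.1.2 q = z.2 ij q := fun q => by
      simp [Report.w, ij.2]
    simp only [debiasedMat, this]
    ring
  simp_rw [e1]
  rw [integral_mul_const]
  refine (mul_le_mul_of_nonneg_right h (Real.exp_pos _).le).trans ?_
  rw [← Real.exp_add, hK, ← Finset.sum_neg_distrib, ← Finset.sum_add_distrib]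
  refine Real.exp_le_exp.mpr ?_
  have e2 : (∑ i, v i ^ 2) ^ 2 = ∑ ij, κ ij * (v ij.1.1 * v ij.1.2) ^ 2 := by
    rw [sq, Finset.sum_mul_sum, sum_symm_eq_sum_lower _ fun i j => by ring]
    exact Finset.sum_congr rfl fun ij _ => by ring
  rw [e2, Finset.mul_sum, Finset.sum_div]
  refine Finset.sum_le_sum fun ij _ => ?_
  have hk : κ ij ^ 2 ≤ 2 * κ ij := by simp only [hκ]; split_ifs <;> norm_num
  have e3 : α * (κ ij * (v ij.1.1 * v ij.1.2)) / (m * (1 - p)) *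
        (m * ((1 - p) * (u.1 ij.1.1 * u.1 ij.1.2 / (2 * L ^ 2) + 1 / 2) + p / 2)) +
      m * (α * (κ ij * (v ij.1.1 * v ij.1.2)) / (m * (1 - p))) ^ 2 / 8 +
      -(α * (κ ij * (v ij.1.1 * v ij.1.2)) *
        (1 / (2 * (1 - p)) + u.1 ij.1.1 * u.1 ij.1.2 / (2 * L ^ 2))) =
      κ ij ^ 2 * (α ^ 2 * (v ij.1.1 * v ij.1.2) ^ 2 / (8 * m * (1 - p) ^ 2)) := by
    field_simp
    ring
  rw [e3]
  refine (mul_le_mul_of_nonneg_right hk (by positivity)).trans (le_of_eq ?_)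
  field_simp
  ring


/-! ### Exponential supermartingales -/

section Supermartingale

variable {Ω : Type*} {m mΩ : MeasurableSpace Ω} {μ : Measure Ω}

/-- On the smaller σ-algebra the measure with density `g` lies below `μ`, and an integrand
measurable for that σ-algebra sees nothing else. -/
theorem lintegral_mul_le_of_setLIntegral_le (hm : m ≤ mΩ) {g Z : Ω → ℝ≥0∞} (hg : Measurable g)
    (h : ∀ A, MeasurableSet[m] A → ∫⁻ ω in A, g ω ∂μ ≤ μ A) (hZ : Measurable[m] Z) :
    ∫⁻ ω, Z ω * g ω ∂μ ≤ ∫⁻ ω, Z ω ∂μ := by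
  calc ∫⁻ ω, Z ω * g ω ∂μ = ∫⁻ ω, Z ω ∂(μ.withDensity g) := by
        rw [lintegral_withDensity_eq_lintegral_mul _ hg (hZ.mono hm le_rfl)]
        simp only [Pi.mul_apply, mul_comm]
    _ = ∫⁻ ω, Z ω ∂((μ.withDensity g).trim hm) := (lintegral_trim hm hZ).symm
    _ ≤ ∫⁻ ω, Z ω ∂(μ.trim hm) := by
        refine lintegral_mono' (Measure.le_iff.mpr fun A hA => ?_) le_rfl
        rw [trim_measurableSet_eq hm hA, trim_measurableSet_eq hm hA,
          withDensity_apply _ (hm A hA)]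
        exact h A hA
    _ = ∫⁻ ω, Z ω ∂μ := lintegral_trim hm hZ

theorem lintegral_mul_ofReal_eq_of_condExp [IsFiniteMeasure μ] (hm : m ≤ mΩ) {f g : Ω → ℝ}
    (hfm : Measurable f) (hf : Integrable f μ) (hf0 : 0 ≤ f) (hg : Measurable g)
    (hfg : μ[f | m] =ᵐ[μ] g) {Z : Ω → ℝ≥0∞} (hZ : Measurable[m] Z) :
    ∫⁻ ω, Z ω * ENNReal.ofReal (f ω) ∂μ = ∫⁻ ω, Z ω * ENNReal.ofReal (g ω) ∂μ := by
  have hg0 : 0 ≤ᵐ[μ] g := by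
    filter_upwards [condExp_nonneg (m := m) (Filter.Eventually.of_forall hf0), hfg] with ω h1 h2
    rwa [← h2]
  have hgi : Integrable g μ := integrable_condExp.congr hfg
  have key : ∀ {g : Ω → ℝ}, Measurable g → ∫⁻ ω, Z ω * ENNReal.ofReal (g ω) ∂μ =
      ∫⁻ ω, Z ω ∂((μ.withDensity fun ω => ENNReal.ofReal (g ω)).trim hm) := by
    intro g hg
    rw [lintegral_trim hm hZ, lintegral_withDensity_eq_lintegral_mul _ hg.ennreal_ofReal
      (hZ.mono hm le_rfl)]
    simp only [Pi.mul_apply, mul_comm]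
  rw [key hfm, key hg]
  congr 1
  refine @Measure.ext _ m _ _ fun A hA => ?_
  rw [trim_measurableSet_eq hm hA, trim_measurableSet_eq hm hA, withDensity_apply _ (hm A hA),
    withDensity_apply _ (hm A hA),
    ← ofReal_integral_eq_lintegral_ofReal hf.integrableOn (Filter.Eventually.of_forall hf0),
    ← ofReal_integral_eq_lintegral_ofReal hgi.integrableOn (ae_restrict_of_ae hg0),
    ← setIntegral_condExp hm hf hA]
  congr 1
  exact integral_congr_ae (ae_restrict_of_ae hfg)

/-- The exponentials of the partial sums form a supermartingale. Freezing it at the first passage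
above `x` keeps its integral at most 1, so a single Markov inequality at the final time covers all
`t ≤ n`. -/
theorem measure_exists_sum_ge_le [IsProbabilityMeasure μ] (ℱ : Filtration ℕ mΩ) (ζ : ℕ → Ω → ℝ)
    (n : ℕ) (hmeas : ∀ t < n, Measurable[ℱ (t + 1)] (ζ t))
    (hstep : ∀ t < n, ∀ A, MeasurableSet[ℱ t] A →
      ∫⁻ ω in A, ENNReal.ofReal (Real.exp (ζ t ω)) ∂μ ≤ μ A) (x : ℝ) :
    μ {ω | ∃ t ≤ n, x ≤ ∑ s ∈ Finset.range t, ζ s ω} ≤ ENNReal.ofReal (Real.exp (-x)) := by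
  classical
  set S : ℕ → Ω → ℝ := fun t ω => ∑ s ∈ Finset.range t, ζ s ω with hS
  set E : ℕ → Set Ω := fun t => {ω | ∃ t' ≤ t, x ≤ S t' ω} with hE
  have hSm : ∀ t ≤ n, Measurable[ℱ t] (S t) := by
    intro t ht
    refine Finset.measurable_sum _ fun s hs => ?_
    have hs' := Finset.mem_range.mp hs
    exact (hmeas s (by omega)).mono (ℱ.mono (by omega)) le_rfl
  have hEm : ∀ t ≤ n, MeasurableSet[ℱ t] (E t) := by
    intro t ht
    have : E t = ⋃ t' ∈ Finset.range (t + 1), {ω | x ≤ S t' ω} := by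
      ext ω; simp [hE]
    rw [this]
    refine Finset.measurableSet_biUnion _ fun t' ht' => ?_
    have ht'' := Finset.mem_range.mp ht'
    exact ℱ.mono (by omega : t' ≤ t) _ (hSm t' (by omega) measurableSet_Ici)
  -- The stopped product: it no longer changes once the level has been reached.
  let Y : ℕ → Ω → ℝ≥0∞ := fun t => Nat.rec (fun _ => 1)
    (fun t Yt ω => if ω ∈ E t then Yt ω else Yt ω * ENNReal.ofReal (Real.exp (ζ t ω))) t
  have hY0 : ∀ ω, Y 0 ω = 1 := fun _ => rfl
  have hYs : ∀ t ω, Y (t + 1) ω =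
      if ω ∈ E t then Y t ω else Y t ω * ENNReal.ofReal (Real.exp (ζ t ω)) := fun _ _ => rfl
  have hYm : ∀ t ≤ n, Measurable[ℱ t] (Y t) := by
    intro t
    induction t with
    | zero => intro _; exact @measurable_const _ _ _ (ℱ 0) _
    | succ t ih =>
      intro ht
      have h1 : Measurable[ℱ (t + 1)] (Y t) := (ih (by omega)).mono (ℱ.mono (by omega)) le_rfl
      refine Measurable.ite (ℱ.mono (Nat.le_succ t) _ (hEm t (by omega))) h1 ?_
      exact h1.mul (ENNReal.measurable_ofReal.comp
        (Real.measurable_exp.comp (hmeas t (by omega))))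
  have hYi : ∀ t ≤ n, ∫⁻ ω, Y t ω ∂μ ≤ 1 := by
    intro t
    induction t with
    | zero => intro _; simp [hY0]
    | succ t ih =>
      intro ht
      refine le_trans ?_ (ih (by omega))
      have hEt := hEm t (by omega)
      have hEt' := ℱ.le t _ hEt
      have hYt := (hYm t (by omega))
      have hgm : Measurable fun ω => ENNReal.ofReal (Real.exp (ζ t ω)) :=
        ENNReal.measurable_ofReal.comp (Real.measurable_exp.comp
          ((hmeas t (by omega)).mono (ℱ.le _) le_rfl))
      have h1 := lintegral_mul_le_of_setLIntegral_le (ℱ.le t) hgm (hstep t (by omega))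
        (Z := (E t)ᶜ.indicator (Y t)) (hYt.indicator hEt.compl)
      have hYt' : Measurable (Y t) := hYt.mono (ℱ.le _) le_rfl
      calc ∫⁻ ω, Y (t + 1) ω ∂μ
          = ∫⁻ ω, ((E t).indicator (Y t) ω + (E t)ᶜ.indicator (Y t) ω *
              ENNReal.ofReal (Real.exp (ζ t ω))) ∂μ := by
            refine lintegral_congr fun ω => ?_
            rw [hYs]
            by_cases h : ω ∈ E t <;> simp [h]
        _ = ∫⁻ ω, (E t).indicator (Y t) ω ∂μ + ∫⁻ ω, (E t)ᶜ.indicator (Y t) ω *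
              ENNReal.ofReal (Real.exp (ζ t ω)) ∂μ :=
            lintegral_add_left (hYt'.indicator hEt') _
        _ ≤ ∫⁻ ω, (E t).indicator (Y t) ω ∂μ + ∫⁻ ω, (E t)ᶜ.indicator (Y t) ω ∂μ := by
            gcongr
        _ = ∫⁻ ω, Y t ω ∂μ := by
            rw [← lintegral_add_left (hYt'.indicator hEt')]
            refine lintegral_congr fun ω => ?_
            by_cases h : ω ∈ E t <;> simp [h]
  have hYval : ∀ t ω, (ω ∈ E t → ENNReal.ofReal (Real.exp x) ≤ Y t ω) ∧
      (ω ∉ E t → Y t ω = ENNReal.ofReal (Real.exp (S t ω))) := by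
    intro t ω
    induction t with
    | zero =>
      refine ⟨fun h => ?_, fun _ => by simp [hY0, hS]⟩
      obtain ⟨t', ht', h⟩ := h
      obtain rfl : t' = 0 := by omega
      have : x ≤ 0 := by simpa [hS] using h
      rw [hY0, ← ENNReal.ofReal_one]
      exact ENNReal.ofReal_le_ofReal (Real.exp_le_one_iff.mpr this)
    | succ t ih =>
      by_cases h : ω ∈ E t
      · have h' : ω ∈ E (t + 1) := by
          obtain ⟨t', ht', h⟩ := h
          exact ⟨t', by omega, h⟩
        refine ⟨fun _ => ?_, fun h2 => absurd h' h2⟩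
        rw [hYs, if_pos h]
        exact ih.1 h
      · have hval : Y (t + 1) ω = ENNReal.ofReal (Real.exp (S (t + 1) ω)) := by
          rw [hYs, if_neg h, ih.2 h, ← ENNReal.ofReal_mul (Real.exp_pos _).le, ← Real.exp_add]
          simp only [hS, Finset.sum_range_succ]
        refine ⟨fun h2 => ?_, fun _ => hval⟩
        obtain ⟨t', ht', h2⟩ := h2
        have : t' = t + 1 := by
          by_contra h3
          exact h ⟨t', by omega, h2⟩
        subst this
        rw [hval]
        exact ENNReal.ofReal_le_ofReal (Real.exp_le_exp.mpr h2)
  have h1 := mul_meas_ge_le_lintegral₀ (μ := μ)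
    ((hYm n le_rfl).mono (ℱ.le _) le_rfl).aemeasurable (ENNReal.ofReal (Real.exp x))
  have h2 : μ (E n) ≤ μ {ω | ENNReal.ofReal (Real.exp x) ≤ Y n ω} :=
    measure_mono fun ω hω => (hYval n ω).1 hω
  have h3 : ENNReal.ofReal (Real.exp x) * μ (E n) ≤ 1 :=
    (mul_le_mul_right h2 _).trans (h1.trans (hYi n le_rfl))
  have h4 : ENNReal.ofReal (Real.exp (-x)) * ENNReal.ofReal (Real.exp x) = 1 := by
    rw [← ENNReal.ofReal_mul (Real.exp_pos _).le, ← Real.exp_add]; simp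
  calc μ (E n) = ENNReal.ofReal (Real.exp (-x)) * (ENNReal.ofReal (Real.exp x) * μ (E n)) := by
        rw [← mul_assoc, h4, one_mul]
    _ ≤ ENNReal.ofReal (Real.exp (-x)) * 1 := by gcongr
    _ = _ := mul_one _

/-- By convexity `exp (c r)` lies below its chord on `[0, 1]`, which is affine in `r`. Conditioning
replaces `r` by its conditional mean `M`, and what remains is a Bernoulli moment generating
function. The tilt `c` may be random as long as it is known beforehand. -/
theorem setLIntegral_exp_reward_le [IsProbabilityMeasure μ] (hm : m ≤ mΩ) {r M c : Ω → ℝ}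
    (hr : Measurable r) (hr01 : ∀ ω, r ω ∈ Set.Icc (0 : ℝ) 1) (hM : Measurable[m] M)
    (hMi : Integrable M μ)
    (hmean : μ[fun ω => r ω - M ω | m] =ᵐ[μ] 0) (hc : Measurable[m] c) (A : Set Ω)
    (hA : MeasurableSet[m] A) :
    ∫⁻ ω in A, ENNReal.ofReal (Real.exp (c ω * (r ω - M ω) - c ω ^ 2 / 8)) ∂μ ≤ μ A := by
  have hri : Integrable r μ := Integrable.of_mem_Icc 0 1 hr.aemeasurable
    (Filter.Eventually.of_forall hr01)
  have hcond : μ[r | m] =ᵐ[μ] M := by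
    have h1 := condExp_sub hri hMi m
    have h2 : μ[M | m] = M := condExp_of_stronglyMeasurable hm hM.stronglyMeasurable hMi
    have h3 : μ[fun ω => r ω - M ω | m] = μ[r - M | m] := rfl
    rw [h3] at hmean
    filter_upwards [h1, hmean] with ω h4 h5
    rw [h5, Pi.sub_apply, h2] at h4
    simpa using sub_eq_zero.mp h4.symm
  have hcond' : μ[fun ω => 1 - r ω | m] =ᵐ[μ] fun ω => 1 - M ω := by
    have h1 := condExp_sub (μ := μ) (integrable_const (1 : ℝ)) hri m
    have h3 : μ[fun ω => 1 - r ω | m] = μ[(fun _ => (1 : ℝ)) - r | m] := rfl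
    rw [h3]
    filter_upwards [h1, hcond] with ω h4 h5
    rw [h4, Pi.sub_apply, h5, condExp_const hm]
  have hM01 : ∀ᵐ ω ∂μ, M ω ∈ Set.Icc (0 : ℝ) 1 := by
    have h1 : 0 ≤ᵐ[μ] μ[r | m] := condExp_nonneg (Filter.Eventually.of_forall fun ω => (hr01 ω).1)
    have h2 : 0 ≤ᵐ[μ] μ[fun ω => 1 - r ω | m] :=
      condExp_nonneg (Filter.Eventually.of_forall fun ω => by
        have := (hr01 ω).2; simp only [Pi.zero_apply]; linarith)
    filter_upwards [h1, h2, hcond, hcond'] with ω h1 h2 h3 h4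
    rw [h3] at h1
    rw [h4] at h2
    exact ⟨h1, by simpa using h2⟩
  set Z : Ω → ℝ := fun ω => Real.exp (-(c ω * M ω) - c ω ^ 2 / 8) with hZ
  have hZm : Measurable[m] Z := by
    refine Real.measurable_exp.comp ?_
    exact (hc.mul hM).neg.sub ((hc.pow_const 2).div_const 8)
  set Z0 : Ω → ℝ≥0∞ := A.indicator fun ω => ENNReal.ofReal (Z ω) with hZ0
  set Z1 : Ω → ℝ≥0∞ := A.indicator fun ω => ENNReal.ofReal (Z ω * Real.exp (c ω)) with hZ1
  have hZ0m : Measurable[m] Z0 := (ENNReal.measurable_ofReal.comp hZm).indicator hA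
  have hZ1m : Measurable[m] Z1 := (ENNReal.measurable_ofReal.comp
    (hZm.mul (Real.measurable_exp.comp hc))).indicator hA
  have e0 := lintegral_mul_ofReal_eq_of_condExp hm (hr.const_sub 1)
    ((integrable_const (1 : ℝ)).sub hri)
    (fun ω => by have := (hr01 ω).2; simp only [Pi.zero_apply]; linarith)
    ((hM.mono hm le_rfl).const_sub 1) hcond' hZ0m
  have e1 := lintegral_mul_ofReal_eq_of_condExp hm hr hri (fun ω => (hr01 ω).1)
    (hM.mono hm le_rfl) hcond hZ1m
  have hA' := hm A hA
  have hrest : ∀ {q : Ω → ℝ}, Measurable q →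
      ∫⁻ ω, Z0 ω * ENNReal.ofReal (1 - q ω) ∂μ + ∫⁻ ω, Z1 ω * ENNReal.ofReal (q ω) ∂μ =
      ∫⁻ ω in A, (ENNReal.ofReal (Z ω) * ENNReal.ofReal (1 - q ω) +
        ENNReal.ofReal (Z ω * Real.exp (c ω)) * ENNReal.ofReal (q ω)) ∂μ := by
    intro q hq
    rw [← lintegral_indicator hA', ← lintegral_add_left]
    · refine lintegral_congr fun ω => ?_
      by_cases h : ω ∈ A <;> simp [hZ0, hZ1, h]
    · exact (hZ0m.mono hm le_rfl).mul (hq.const_sub 1).ennreal_ofReal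
  have hZpos : ∀ ω, 0 ≤ Z ω := fun ω => (Real.exp_pos _).le
  have hcomb : ∀ (ω : Ω) {q : ℝ}, q ∈ Set.Icc (0 : ℝ) 1 →
      ENNReal.ofReal (Z ω) * ENNReal.ofReal (1 - q) +
        ENNReal.ofReal (Z ω * Real.exp (c ω)) * ENNReal.ofReal q =
      ENNReal.ofReal (Z ω * (1 - q + q * Real.exp (c ω))) := by
    intro ω q hq
    have h1 : 0 ≤ 1 - q := by linarith [hq.2]
    have h2 : 0 ≤ Z ω * Real.exp (c ω) := mul_nonneg (hZpos ω) (Real.exp_pos _).le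
    rw [← ENNReal.ofReal_mul (hZpos ω), ← ENNReal.ofReal_mul h2,
      ← ENNReal.ofReal_add (mul_nonneg (hZpos ω) h1) (mul_nonneg h2 hq.1)]
    congr 1; ring
  calc ∫⁻ ω in A, ENNReal.ofReal (Real.exp (c ω * (r ω - M ω) - c ω ^ 2 / 8)) ∂μ
      ≤ ∫⁻ ω in A, (ENNReal.ofReal (Z ω) * ENNReal.ofReal (1 - r ω) +
        ENNReal.ofReal (Z ω * Real.exp (c ω)) * ENNReal.ofReal (r ω)) ∂μ := by
        refine lintegral_mono fun ω => ?_
        rw [hcomb ω (hr01 ω)]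
        refine ENNReal.ofReal_le_ofReal ?_
        have h1 : Real.exp (c ω * r ω) ≤ 1 - r ω + r ω * Real.exp (c ω) := by
          have := convexOn_exp.2 (Set.mem_univ 0) (Set.mem_univ (c ω))
            (by linarith [(hr01 ω).2] : 0 ≤ 1 - r ω) (hr01 ω).1 (by ring)
          simp only [smul_eq_mul, mul_zero, zero_add, Real.exp_zero, mul_one] at this
          rwa [mul_comm (r ω) (c ω)] at this
        calc Real.exp (c ω * (r ω - M ω) - c ω ^ 2 / 8) = Z ω * Real.exp (c ω * r ω) := by
              rw [hZ, ← Real.exp_add]; congr 1; ring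
          _ ≤ _ := mul_le_mul_of_nonneg_left h1 (hZpos ω)
    _ = ∫⁻ ω in A, (ENNReal.ofReal (Z ω) * ENNReal.ofReal (1 - M ω) +
        ENNReal.ofReal (Z ω * Real.exp (c ω)) * ENNReal.ofReal (M ω)) ∂μ := by
        rw [← hrest hr, e0, e1, hrest (hM.mono hm le_rfl)]
    _ ≤ ∫⁻ ω in A, 1 ∂μ := by
        refine lintegral_mono_ae (ae_restrict_of_ae ?_)
        filter_upwards [hM01] with ω hω
        rw [hcomb ω hω, ← ENNReal.ofReal_one]
        refine ENNReal.ofReal_le_ofReal ?_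
        calc Z ω * (1 - M ω + M ω * Real.exp (c ω))
            ≤ Z ω * Real.exp (c ω * M ω + c ω ^ 2 / 8) :=
              mul_le_mul_of_nonneg_left (bernoulli_mgf_le hω _) (hZpos ω)
          _ = 1 := by rw [hZ, ← Real.exp_add]; ring_nf; simp
    _ = μ A := by simp

/-- As `X` has finitely many values, its conditional law `κ` can be inserted one value at a time. -/
theorem setLIntegral_exp_finite_le [IsProbabilityMeasure μ] (hm : m ≤ mΩ) {β : Type*} [Fintype β]
    [MeasurableSpace β] [MeasurableSingletonClass β] {X : Ω → β} (hX : Measurable X)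
    {κ : Ω → Measure β} [∀ ω, IsProbabilityMeasure (κ ω)]
    (hκm : ∀ z, Measurable fun ω => (κ ω).real {z})
    (hκ : ∀ z, μ[(X ⁻¹' {z}).indicator (fun _ => (1 : ℝ)) | m] =ᵐ[μ] fun ω => (κ ω).real {z})
    {φ : β → Ω → ℝ} (hφ : ∀ z, Measurable[m] (φ z))
    (hle : ∀ ω, ∫ z, Real.exp (φ z ω) ∂(κ ω) ≤ 1) (A : Set Ω) (hA : MeasurableSet[m] A) :
    ∫⁻ ω in A, ENNReal.ofReal (Real.exp (φ (X ω) ω)) ∂μ ≤ μ A := by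
  classical
  have hA' := hm A hA
  set Z : β → Ω → ℝ≥0∞ := fun z => A.indicator fun ω => ENNReal.ofReal (Real.exp (φ z ω)) with hZ
  have hZm : ∀ z, Measurable[m] (Z z) := fun z =>
    (ENNReal.measurable_ofReal.comp (Real.measurable_exp.comp (hφ z))).indicator hA
  have hXz : ∀ z, MeasurableSet (X ⁻¹' {z}) := fun z => hX (measurableSet_singleton z)
  have e : ∀ z, ∫⁻ ω, Z z ω * ENNReal.ofReal ((X ⁻¹' {z}).indicator (fun _ => (1 : ℝ)) ω) ∂μ =
      ∫⁻ ω, Z z ω * ENNReal.ofReal ((κ ω).real {z}) ∂μ := fun z =>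
    lintegral_mul_ofReal_eq_of_condExp hm (measurable_const.indicator (hXz z))
      ((integrable_const (1 : ℝ)).indicator (hXz z))
      (fun ω => Set.indicator_nonneg (fun _ _ => zero_le_one) ω) (hκm z) (hκ z) (hZm z)
  calc ∫⁻ ω in A, ENNReal.ofReal (Real.exp (φ (X ω) ω)) ∂μ
      = ∫⁻ ω, ∑ z, Z z ω * ENNReal.ofReal ((X ⁻¹' {z}).indicator (fun _ => (1 : ℝ)) ω) ∂μ := by
        rw [← lintegral_indicator hA']
        refine lintegral_congr fun ω => ?_
        rw [Finset.sum_eq_single (X ω)]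
        · by_cases h : ω ∈ A <;> simp [hZ, h]
        · intro z _ hz
          simp [Set.indicator, Ne.symm hz]
        · simp
    _ = ∑ z, ∫⁻ ω, Z z ω * ENNReal.ofReal ((κ ω).real {z}) ∂μ := by
        rw [lintegral_finsetSum]
        · exact Finset.sum_congr rfl fun z _ => e z
        · exact fun z _ => ((hZm z).mono hm le_rfl).mul
            (measurable_const.indicator (hXz z)).ennreal_ofReal
    _ = ∫⁻ ω in A, ENNReal.ofReal (∫ z, Real.exp (φ z ω) ∂(κ ω)) ∂μ := by
        rw [← lintegral_finsetSum, ← lintegral_indicator hA']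
        · refine lintegral_congr fun ω => ?_
          by_cases h : ω ∈ A
          · simp only [hZ, Set.indicator_of_mem h]
            rw [integral_fintype .of_finite, ENNReal.ofReal_sum_of_nonneg
              (fun z _ => smul_nonneg measureReal_nonneg (Real.exp_pos _).le)]
            refine Finset.sum_congr rfl fun z _ => ?_
            rw [← ENNReal.ofReal_mul (Real.exp_pos _).le, smul_eq_mul, mul_comm]
          · simp [hZ, h]
        · exact fun z _ => ((hZm z).mono hm le_rfl).mul (hκm z).ennreal_ofReal
    _ ≤ ∫⁻ ω in A, 1 ∂μ := by
        refine lintegral_mono fun ω => ?_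
        rw [← ENNReal.ofReal_one]
        exact ENNReal.ofReal_le_ofReal (hle ω)
    _ = μ A := by simp

end Supermartingale


/-! ### Deviation processes -/

section Processes

variable {d m : ℕ}

/-- The rescaled design matrix `∑_{s < t} x_s x_sᵀ / (2 L ^ 2)`. -/
noncomputable def gram (L : ℝ) (x : ℕ → Fin d → ℝ) (t : ℕ) : Matrix (Fin d) (Fin d) ℝ :=
  ∑ s ∈ Finset.range t, (1 / (2 * L ^ 2)) • vecMulVec (x s) (x s)

/-- The accumulated error of the debiased vector statistics. -/
noncomputable def noiseVec (p L : ℝ) (x : ℕ → Fin d → ℝ) (r : ℕ → ℝ) (z : ℕ → Report d m) (t : ℕ) :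
    Fin d → ℝ :=
  fun i => ∑ s ∈ Finset.range t, (debiasedVec p (z s) i - r s * x s i / (2 * L))

/-- The accumulated error of the debiased matrix statistics. -/
noncomputable def noiseMat (p L : ℝ) (x : ℕ → Fin d → ℝ) (z : ℕ → Report d m) (t : ℕ) :
    Matrix (Fin d) (Fin d) ℝ :=
  Matrix.of fun i j => ∑ s ∈ Finset.range t,
    (debiasedMat p (z s) i j - x s i * x s j / (2 * L ^ 2))

/-- The accumulated reward noise. -/
noncomputable def rewardNoise (L : ℝ) (θ : Fin d → ℝ) (x : ℕ → Fin d → ℝ) (r : ℕ → ℝ) (t : ℕ) :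
    Fin d → ℝ :=
  fun i => ∑ s ∈ Finset.range t, (r s - x s ⬝ᵥ θ) * x s i / (2 * L)

theorem quad_gram (L : ℝ) (x : ℕ → Fin d → ℝ) (t : ℕ) (u : Fin d → ℝ) :
    u ⬝ᵥ (gram L x t *ᵥ u) = ∑ s ∈ Finset.range t, (u ⬝ᵥ x s) ^ 2 / (2 * L ^ 2) := by
  rw [gram, sum_mulVec, dotProduct_sum]
  refine Finset.sum_congr rfl fun s _ => ?_
  rw [smul_mulVec, dotProduct_smul, quad_vecMulVec, smul_eq_mul]
  ring

theorem dotProduct_noiseVec (p L : ℝ) (x : ℕ → Fin d → ℝ) (r : ℕ → ℝ) (z : ℕ → Report d m) (t : ℕ)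
    (v : Fin d → ℝ) : v ⬝ᵥ noiseVec p L x r z t =
      ∑ s ∈ Finset.range t, ∑ i, v i * (debiasedVec p (z s) i - r s * x s i / (2 * L)) := by
  simp only [dotProduct, noiseVec, Finset.mul_sum]
  exact Finset.sum_comm

theorem quad_noiseMat (p L : ℝ) (x : ℕ → Fin d → ℝ) (z : ℕ → Report d m) (t : ℕ)
    (v : Fin d → ℝ) : v ⬝ᵥ (noiseMat p L x z t *ᵥ v) =
      ∑ s ∈ Finset.range t, ∑ i, ∑ j, v i * v j *
        (debiasedMat p (z s) i j - x s i * x s j / (2 * L ^ 2)) := by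
  simp only [dotProduct, mulVec, noiseMat, Matrix.of_apply, Finset.mul_sum, Finset.sum_mul]
  symm
  rw [Finset.sum_comm]
  refine Finset.sum_congr rfl fun i _ => ?_
  rw [Finset.sum_comm]
  exact Finset.sum_congr rfl fun j _ => Finset.sum_congr rfl fun s _ => by ring

theorem dotProduct_rewardNoise (L : ℝ) (θ : Fin d → ℝ) (x : ℕ → Fin d → ℝ) (r : ℕ → ℝ) (t : ℕ)
    (v : Fin d → ℝ) : v ⬝ᵥ rewardNoise L θ x r t =
      ∑ s ∈ Finset.range t, (v ⬝ᵥ x s) / (2 * L) * (r s - x s ⬝ᵥ θ) := by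
  simp only [dotProduct, rewardNoise, Finset.mul_sum]
  rw [Finset.sum_comm]
  refine Finset.sum_congr rfl fun s _ => ?_
  rw [Finset.sum_div, Finset.sum_mul]
  exact Finset.sum_congr rfl fun i _ => by ring

end Processes

/-! ### Measurability of the privatizer and of the played features -/

section Measurability

theorem measurable_encoder_real (m : ℕ) (q : Fin m) :
    Measurable fun y : ℝ => (encoder m y q).real {true} := by
  have h : ∀ y, (encoder m y q).real {true} = if (q : ℤ) + 1 < ⌈y * m⌉ then (1 : ℝ)
      else if (q : ℤ) + 1 = ⌈y * m⌉ then
        (Set.projIcc (0 : ℝ) 1 zero_le_one (m * y - ⌈y * m⌉ + 1) : ℝ) else 0 := by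
    intro y
    unfold encoder
    split_ifs
    · simp [measureReal_def]
    · rw [ber, bernoulliMeasure_real_apply_of_mem_of_notMem _ (by measurability) (by simp)
        (by simp)]
    · simp [measureReal_def]
  simp_rw [h]
  have hc : Measurable fun y : ℝ => ⌈y * m⌉ := (measurable_id.mul_const _).ceil
  refine Measurable.ite (measurableSet_lt measurable_const hc) measurable_const
    (Measurable.ite (measurableSet_eq_fun measurable_const hc) ?_ measurable_const)
  refine measurable_subtype_coe.comp (continuous_projIcc.measurable.comp ?_)
  exact ((measurable_id.const_mul _).sub ((measurable_of_countable _).comp hc)).add_const _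

theorem measurable_privateBit_real {m : ℕ} {p : ℝ} (hp : p ∈ Set.Icc (0 : ℝ) 1) (q : Fin m)
    (b : Bool) : Measurable fun y : ℝ => (privateBit m p y q).real {b} := by
  have h : Measurable fun y : ℝ => (privateBit m p y q).real {true} := by
    simp_rw [privateBit_real_true hp]
    exact ((measurable_encoder_real m q).const_mul _).add_const _
  cases b
  · simp_rw [real_false_eq]
    exact h.const_sub 1
  · exact h

theorem measurable_localPrivatizer_real {d m : ℕ} (L : ℝ) {ε₀ : ℝ} (hε : 0 < ε₀)
    (z : Report d m) :
    Measurable fun u : EuclideanSpace ℝ (Fin d) × ℝ => (localPrivatizer d m L ε₀ u).real {z} := by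
  have hp := flipProb_mem (d := d) (m := m) hε
  simp_rw [localPrivatizer_real_singleton]
  have hx : ∀ i, Measurable fun u : EuclideanSpace ℝ (Fin d) × ℝ => u.1 i := fun i => by fun_prop
  have h1 : ∀ i, Measurable fun u : EuclideanSpace ℝ (Fin d) × ℝ =>
      u.2 * u.1 i / (2 * L) + 1 / 2 := fun i =>
    ((measurable_snd.mul (hx i)).div_const _).add_const _
  have h2 : ∀ i j, Measurable fun u : EuclideanSpace ℝ (Fin d) × ℝ =>
      u.1 i * u.1 j / (2 * L ^ 2) + 1 / 2 := fun i j =>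
    (((hx i).mul (hx j)).div_const _).add_const _
  exact (Finset.measurable_prod _ fun i _ => Finset.measurable_prod _ fun q _ =>
    (measurable_privateBit_real hp q _).comp (h1 i)).mul (Finset.measurable_prod _ fun ij _ =>
      Finset.measurable_prod _ fun q _ => (measurable_privateBit_real hp q _).comp (h2 _ _))

theorem measurable_eval_fintype {Ω ι E : Type*} {m : MeasurableSpace Ω} [Countable ι]
    [MeasurableSpace ι] [MeasurableSingletonClass ι] [MeasurableSpace E] {f : Ω → ι → E}
    {a : Ω → ι} (hf : ∀ i, Measurable fun ω => f ω i) (ha : Measurable a) :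
    Measurable fun ω => f ω (a ω) := by
  intro B hB
  have : (fun ω => f ω (a ω)) ⁻¹' B = ⋃ i, a ⁻¹' {i} ∩ (fun ω => f ω i) ⁻¹' B := by
    ext ω; simp
  rw [this]
  exact MeasurableSet.iUnion fun i => (ha (measurableSet_singleton i)).inter (hf i hB)

end Measurability

/-! ### Exponential deviation bounds along a run, one direction at a time -/

section RunDeviation

variable {Ω : Type*} [mΩ : MeasurableSpace Ω] {μ : Measure Ω} [IsProbabilityMeasure μ] {d m : ℕ}
  {P : Params d m} {K : ℕ} {θstar : EuclideanSpace ℝ (Fin d)}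

/-- The features of the played arms. -/
def Run.feature (R : Run μ P K θstar) (ω : Ω) (t : ℕ) : Fin d → ℝ :=
  (R.context t ω (R.action t ω)).ofLp

/-- The information available in round `t` including the reward. -/
abbrev Run.postReward (R : Run μ P K θstar) (t : ℕ) : MeasurableSpace Ω :=
  (R.ℱ t : MeasurableSpace Ω) ⊔ MeasurableSpace.comap (R.reward t) inferInstance

theorem Run.postReward_le (R : Run μ P K θstar) {t : ℕ} (ht : t < P.T) : R.postReward t ≤ mΩ :=
  sup_le (R.ℱ.le t) (((R.measurable_reward t ht).mono (R.ℱ.le _) le_rfl).comap_le)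

theorem Run.measurable_playedContext (R : Run μ P K θstar) {t : ℕ} (ht : t < P.T) :
    Measurable[R.ℱ t] fun ω => R.context t ω (R.action t ω) :=
  @measurable_eval_fintype _ _ _ (R.ℱ t) _ _ _ _ _ _ (R.measurable_context t ht)
    (R.measurable_action t ht)

theorem Run.measurable_feature (R : Run μ P K θstar) {t : ℕ} (ht : t < P.T) (i : Fin d) :
    Measurable[R.ℱ t] fun ω => R.feature ω t i :=
  (by fun_prop : Measurable fun x : EuclideanSpace ℝ (Fin d) => x i).comp
    (R.measurable_playedContext ht)

theorem Run.userData_mem (R : Run μ P K θstar) {t : ℕ} (ht : t < P.T) (ω : Ω) :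
    (R.context t ω (R.action t ω), R.reward t ω) ∈ userData d P.L :=
  ⟨by simpa using R.norm_context_le t ht ω _, R.reward_mem t ht ω⟩

theorem Run.feature_dot_self_le (R : Run μ P K θstar) {t : ℕ} (ht : t < P.T) (ω : Ω) :
    R.feature ω t ⬝ᵥ R.feature ω t ≤ P.L ^ 2 := by
  have h := R.norm_context_le t ht ω (R.action t ω)
  have h2 := EuclideanSpace.real_norm_sq_eq (R.context t ω (R.action t ω))
  have h3 : R.feature ω t ⬝ᵥ R.feature ω t = ‖R.context t ω (R.action t ω)‖ ^ 2 := by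
    rw [h2]; simp [Run.feature, dotProduct, sq]
  rw [h3]
  exact pow_le_pow_left₀ (norm_nonneg _) h 2

/-- The law of the report is prescribed given the past together with the reward. The one-step
inequality therefore holds on the events of `postReward`, and the events of `ℱ t` are among them. -/
theorem Run.measure_report_deviation_le (R : Run μ P K θstar) (hε : 0 < P.epsLocal)
    (f : Report d m → (Fin d → ℝ) → ℝ → ℝ) (hf : ∀ z, Measurable fun u : (Fin d → ℝ) × ℝ =>
      f z u.1 u.2)
    (hle : ∀ u ∈ userData d P.L,
      ∫ z, Real.exp (f z u.1.ofLp u.2) ∂(localPrivatizer d m P.L P.epsLocal u) ≤ 1) (y : ℝ) :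
    μ {ω | ∃ t ≤ P.T, y ≤ ∑ s ∈ Finset.range t, f (R.report s ω) (R.feature ω s) (R.reward s ω)} ≤
      ENNReal.ofReal (Real.exp (-y)) := by
  have hfeat : ∀ t < P.T, Measurable[R.ℱ t] fun ω => R.feature ω t := fun t ht =>
    @measurable_pi_lambda _ _ _ (R.ℱ t) _ _ fun i => R.measurable_feature ht i
  refine measure_exists_sum_ge_le R.ℱ
    (fun s ω => f (R.report s ω) (R.feature ω s) (R.reward s ω)) P.T ?_ ?_ y
  · intro t ht
    have h1 : Measurable[R.ℱ (t + 1)] fun ω => (R.feature ω t, R.reward t ω) :=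
      ((hfeat t ht).mono (R.ℱ.mono (Nat.le_succ t)) le_rfl).prodMk (R.measurable_reward t ht)
    exact @measurable_eval_fintype _ _ _ (R.ℱ (t + 1)) _ _ _ _
      (fun ω z => f z (R.feature ω t) (R.reward t ω)) _ (fun z => (hf z).comp h1)
      (R.measurable_report t ht)
  · intro t ht A hA
    have hu : Measurable fun ω => (R.context t ω (R.action t ω), R.reward t ω) :=
      ((R.measurable_playedContext ht).mono (R.ℱ.le t) le_rfl).prodMk
        ((R.measurable_reward t ht).mono (R.ℱ.le _) le_rfl)
    have hg : Measurable[R.postReward t] fun ω => (R.feature ω t, R.reward t ω) :=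
      ((hfeat t ht).mono le_sup_left le_rfl).prodMk
        ((comap_measurable (R.reward t)).mono le_sup_right le_rfl)
    exact setLIntegral_exp_finite_le (R.postReward_le ht)
      ((R.measurable_report t ht).mono (R.ℱ.le _) le_rfl)
      (κ := fun ω => localPrivatizer d m P.L P.epsLocal
        (R.context t ω (R.action t ω), R.reward t ω))
      (fun z => (measurable_localPrivatizer_real P.L hε z).comp hu) (R.report_law t ht)
      (φ := fun z ω => f z (R.feature ω t) (R.reward t ω)) (fun z => (hf z).comp hg)
      (fun ω => hle _ (R.userData_mem ht ω)) A ((le_sup_left : _ ≤ R.postReward t) A hA)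

theorem Run.measure_noiseVec_le (R : Run μ P K θstar) (hd : 0 < d) (hm : 0 < m) (hL : 0 < P.L)
    (hε : 0 < P.epsLocal) (v : Fin d → ℝ) (y : ℝ) :
    μ {ω | ∃ t ≤ P.T, y ≤ v ⬝ᵥ noiseVec P.p P.L (R.feature ω) (fun s => R.reward s ω)
        (fun s => R.report s ω) t - t * ((v ⬝ᵥ v) / (8 * m * (1 - P.p) ^ 2))} ≤
      ENNReal.ofReal (Real.exp (-y)) := by
  have h := R.measure_report_deviation_le hε
    (fun z x r => ∑ i, v i * (debiasedVec P.p z i - r * x i / (2 * P.L)) -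
      (v ⬝ᵥ v) / (8 * m * (1 - P.p) ^ 2)) (fun z => by fun_prop) (fun u hu => by
        simp only [Real.exp_sub]
        rw [integral_div, div_le_one (Real.exp_pos _)]
        refine (integral_exp_debiasedVec_le hd hm hL hε hu v).trans (le_of_eq ?_)
        simp [dotProduct, sq, Params.p]) y
  simpa only [dotProduct_noiseVec, Finset.sum_sub_distrib, Finset.sum_const, Finset.card_range,
    nsmul_eq_mul] using h

theorem Run.measure_noiseMat_le (R : Run μ P K θstar) (hd : 0 < d) (hm : 0 < m) (hL : 0 < P.L)
    (hε : 0 < P.epsLocal) (α : ℝ) (v : Fin d → ℝ) (y : ℝ) :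
    μ {ω | ∃ t ≤ P.T, y ≤ α * (v ⬝ᵥ (noiseMat P.p P.L (R.feature ω)
        (fun s => R.report s ω) t *ᵥ v)) -
          t * (α ^ 2 * (v ⬝ᵥ v) ^ 2 / (4 * m * (1 - P.p) ^ 2))} ≤
      ENNReal.ofReal (Real.exp (-y)) := by
  have h := R.measure_report_deviation_le hε
    (fun z x _ => α * ∑ i, ∑ j, v i * v j * (debiasedMat P.p z i j - x i * x j / (2 * P.L ^ 2)) -
      α ^ 2 * (v ⬝ᵥ v) ^ 2 / (4 * m * (1 - P.p) ^ 2)) (fun z => by fun_prop) (fun u hu => by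
        simp only [Real.exp_sub]
        rw [integral_div, div_le_one (Real.exp_pos _)]
        refine (integral_exp_debiasedMat_le hd hm hL hε hu α v).trans (le_of_eq ?_)
        simp [dotProduct, sq, Params.p]) y
  simpa only [quad_noiseMat, Finset.sum_sub_distrib, Finset.sum_const, Finset.card_range,
    nsmul_eq_mul, ← Finset.mul_sum] using h

/-- The tilt `(v·x_s) / (2 L)` is known before the reward of round `s`. One eighth of its square is
one sixteenth of the corresponding summand of `gram`. -/
theorem Run.measure_rewardNoise_le (R : Run μ P K θstar) (hL : 0 < P.L) (v : Fin d → ℝ) (y : ℝ) :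
    μ {ω | ∃ t ≤ P.T, y ≤ v ⬝ᵥ rewardNoise P.L θstar.ofLp (R.feature ω) (fun s => R.reward s ω) t -
        (v ⬝ᵥ (gram P.L (R.feature ω) t *ᵥ v)) / 16} ≤
      ENNReal.ofReal (Real.exp (-y)) := by
  have hin : ∀ t ω, R.feature ω t ⬝ᵥ θstar.ofLp =
      inner ℝ (R.context t ω (R.action t ω)) θstar := by
    intro t ω
    simp [Run.feature, PiLp.inner_apply, dotProduct, mul_comm]
  have hM : ∀ t < P.T, Measurable[R.ℱ t] fun ω => R.feature ω t ⬝ᵥ θstar.ofLp := fun t ht =>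
    Finset.measurable_sum _ fun i _ => (R.measurable_feature ht i).mul_const _
  have hc : ∀ t < P.T, Measurable[R.ℱ t] fun ω => (v ⬝ᵥ R.feature ω t) / (2 * P.L) := fun t ht =>
    (Finset.measurable_sum _ fun i _ => (R.measurable_feature ht i).const_mul _).div_const _
  have h := measure_exists_sum_ge_le (μ := μ) R.ℱ
    (fun s ω => (v ⬝ᵥ R.feature ω s) / (2 * P.L) *
      (R.reward s ω - R.feature ω s ⬝ᵥ θstar.ofLp) -
      ((v ⬝ᵥ R.feature ω s) / (2 * P.L)) ^ 2 / 8) P.T (fun t ht => by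
        have h1 := (hM t ht).mono (R.ℱ.mono (Nat.le_succ t)) le_rfl
        have h2 := (hc t ht).mono (R.ℱ.mono (Nat.le_succ t)) le_rfl
        exact (h2.mul ((R.measurable_reward t ht).sub h1)).sub ((h2.pow_const 2).div_const 8))
      (fun t ht A hA => by
        refine setLIntegral_exp_reward_le (R.ℱ.le t)
          ((R.measurable_reward t ht).mono (R.ℱ.le _) le_rfl) (R.reward_mem t ht) (hM t ht) ?_ ?_
          (hc t ht) A hA
        · refine Integrable.of_bound (((hM t ht).mono (R.ℱ.le _) le_rfl).aestronglyMeasurable)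
            (P.L * ‖θstar‖) (Filter.Eventually.of_forall fun ω => ?_)
          rw [hin]
          exact (norm_inner_le_norm _ _).trans
            (mul_le_mul_of_nonneg_right (R.norm_context_le t ht ω _) (norm_nonneg _))
        · simp_rw [hin]
          exact R.noise_mean t ht) y
  have e : ∀ ω t, v ⬝ᵥ rewardNoise P.L θstar.ofLp (R.feature ω) (fun s => R.reward s ω) t -
        (v ⬝ᵥ (gram P.L (R.feature ω) t *ᵥ v)) / 16 =
      ∑ s ∈ Finset.range t, ((v ⬝ᵥ R.feature ω s) / (2 * P.L) *
      (R.reward s ω - R.feature ω s ⬝ᵥ θstar.ofLp) -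
      ((v ⬝ᵥ R.feature ω s) / (2 * P.L)) ^ 2 / 8) := by
    intro ω t
    rw [dotProduct_rewardNoise, quad_gram, Finset.sum_div, ← Finset.sum_sub_distrib]
    refine Finset.sum_congr rfl fun s _ => ?_
    field_simp
    ring
  simp_rw [e]
  exact h

end RunDeviation


/-! ### Nets of the unit ball -/

section Nets

variable {d : ℕ}

theorem dotProduct_self_nonneg_real (u : Fin d → ℝ) : 0 ≤ u ⬝ᵥ u :=
  Finset.sum_nonneg fun i _ => mul_self_nonneg (u i)

theorem abs_dotProduct_le (u v : Fin d → ℝ) : |u ⬝ᵥ v| ≤ √(u ⬝ᵥ u) * √(v ⬝ᵥ v) := by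
  rw [← Real.sqrt_mul (dotProduct_self_nonneg_real u)]
  refine Real.abs_le_sqrt ?_
  have := Finset.sum_mul_sq_le_sq_mul_sq Finset.univ u v
  simpa only [dotProduct, ← sq] using this

theorem dotProduct_sq_le (u v : Fin d → ℝ) : (u ⬝ᵥ v) ^ 2 ≤ (u ⬝ᵥ u) * (v ⬝ᵥ v) := by
  have := Finset.sum_mul_sq_le_sq_mul_sq Finset.univ u v
  simpa only [dotProduct, ← sq] using this

theorem sq_coord_le (u : Fin d → ℝ) (i : Fin d) : u i ^ 2 ≤ u ⬝ᵥ u := by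
  rw [sq]
  exact Finset.single_le_sum (f := fun i => u i * u i) (fun i _ => mul_self_nonneg (u i))
    (Finset.mem_univ i)

/-- The net is a grid of spacing `1 / (d n)`. Rounding coordinates towards zero keeps a point in the
ball, and the squared error is at most `d / (d n) ^ 2`. -/
theorem exists_net (hd : 0 < d) {n : ℕ} (hn : 0 < n) :
    ∃ F : Finset (Fin d → ℝ), F.card ≤ (2 * d * n + 1) ^ d ∧ (∀ v ∈ F, v ⬝ᵥ v ≤ 1) ∧
      ∀ u : Fin d → ℝ, u ⬝ᵥ u ≤ 1 → ∃ v ∈ F, (u - v) ⬝ᵥ (u - v) ≤ 1 / (n : ℝ) ^ 2 := by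
  classical
  set M : ℕ := d * n with hM
  have hM0 : (0 : ℝ) < M := by exact_mod_cast Nat.mul_pos hd hn
  let G : Finset (Fin d → ℤ) := Fintype.piFinset fun _ => Finset.Icc (-(M : ℤ)) M
  refine ⟨(G.image fun k i => (k i : ℝ) / M).filter fun v => v ⬝ᵥ v ≤ 1, ?_, ?_, ?_⟩
  · refine (Finset.card_filter_le _ _).trans (Finset.card_image_le.trans (le_of_eq ?_))
    simp only [G, Fintype.card_piFinset_const, Int.card_Icc]
    congr 1
    rw [hM, mul_assoc]
    omega
  · intro v hv
    exact (Finset.mem_filter.mp hv).2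
  · intro u hu
    have hround : ∀ a : ℝ, ∃ k : ℤ, (k : ℝ) ^ 2 ≤ a ^ 2 ∧ (a - k) ^ 2 ≤ 1 := by
      intro a
      rcases le_total 0 a with h | h
      · have h1 : (0 : ℝ) ≤ ⌊a⌋ := by exact_mod_cast Int.floor_nonneg.mpr h
        have h2 := Int.floor_le a
        have h3 := Int.lt_floor_add_one a
        exact ⟨⌊a⌋, by nlinarith, by nlinarith⟩
      · have h1 : (⌈a⌉ : ℝ) ≤ 0 := by exact_mod_cast Int.ceil_le.mpr (by simpa using h)
        have h2 := Int.le_ceil a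
        have h3 := Int.ceil_lt_add_one a
        exact ⟨⌈a⌉, by nlinarith, by nlinarith⟩
    choose k hk using fun i => hround (u i * M)
    have hu1 : ∀ i, u i ^ 2 ≤ 1 := fun i => (sq_coord_le u i).trans hu
    have hv1 : ∀ i, ((k i : ℝ) / M) * ((k i : ℝ) / M) ≤ u i * u i := fun i => by
      have := (hk i).1
      rw [div_mul_div_comm, div_le_iff₀ (by positivity)]
      nlinarith
    have hv2 : ∀ i, (u i - (k i : ℝ) / M) * (u i - (k i : ℝ) / M) ≤ 1 / (M : ℝ) ^ 2 := fun i => by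
      have := (hk i).2
      rw [le_div_iff₀ (by positivity)]
      calc _ = (u i * M - k i) ^ 2 := by field_simp
        _ ≤ 1 := this
    refine ⟨fun i => (k i : ℝ) / M, Finset.mem_filter.mpr ⟨Finset.mem_image.mpr ⟨k, ?_, rfl⟩, ?_⟩, ?_⟩
    · simp only [G, Fintype.mem_piFinset, Finset.mem_Icc]
      intro i
      have h1 : (k i : ℝ) ^ 2 ≤ (M : ℝ) ^ 2 := by
        have := (hk i).1
        have h2 := hu1 i
        nlinarith [sq_nonneg (M : ℝ)]
      have h3 := abs_le_of_sq_le_sq' h1 hM0.le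
      exact ⟨by exact_mod_cast h3.1, by exact_mod_cast h3.2⟩
    · exact (Finset.sum_le_sum fun i _ => hv1 i).trans hu
    · have hd' : (1 : ℝ) ≤ d := by exact_mod_cast hd
      have hn' : (0 : ℝ) < n := by exact_mod_cast hn
      calc _ ≤ ∑ _i : Fin d, 1 / (M : ℝ) ^ 2 := Finset.sum_le_sum fun i _ => hv2 i
        _ = d / (M : ℝ) ^ 2 := by simp; ring
        _ ≤ 1 / (n : ℝ) ^ 2 := by
            rw [hM, div_le_div_iff₀ (by positivity) (by positivity)]
            push_cast
            nlinarith [sq_nonneg (n : ℝ), mul_nonneg (sq_nonneg (n : ℝ)) (by linarith : 0 ≤ (d : ℝ))]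

/-- A net point within `1 / 4` of the direction of `E` sees at least three quarters of its length.
-/
theorem dotProduct_self_le_of_net {F : Finset (Fin d → ℝ)}
    (hF : ∀ u : Fin d → ℝ, u ⬝ᵥ u ≤ 1 → ∃ v ∈ F, (u - v) ⬝ᵥ (u - v) ≤ 1 / 16) {E : Fin d → ℝ}
    {e : ℝ} (hE : ∀ v ∈ F, |v ⬝ᵥ E| ≤ e) : √(E ⬝ᵥ E) ≤ 4 / 3 * e := by
  set q := √(E ⬝ᵥ E) with hq
  have hqq : q * q = E ⬝ᵥ E := Real.mul_self_sqrt (dotProduct_self_nonneg_real E)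
  rcases (Real.sqrt_nonneg (E ⬝ᵥ E)).eq_or_lt with h0 | h0
  · obtain ⟨v, hv, -⟩ := hF 0 (by simp)
    have := (abs_nonneg _).trans (hE v hv)
    rw [hq, ← h0]; linarith
  · rw [← hq] at h0
    obtain ⟨v, hv, hv2⟩ := hF (q⁻¹ • E) (by
      rw [smul_dotProduct, dotProduct_smul, ← hqq]
      simp only [smul_eq_mul]
      apply le_of_eq; field_simp)
    have h1 : (q⁻¹ • E) ⬝ᵥ E = q := by
      rw [smul_dotProduct, ← hqq, smul_eq_mul]; field_simp
    have h2 := abs_dotProduct_le (q⁻¹ • E - v) E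
    rw [sub_dotProduct, h1] at h2
    have h3 : √((q⁻¹ • E - v) ⬝ᵥ (q⁻¹ • E - v)) ≤ 1 / 4 :=
      Real.sqrt_le_iff.mpr ⟨by norm_num, hv2.trans (by norm_num)⟩
    have h4 := mul_le_mul_of_nonneg_right h3 h0.le
    have h5 := (abs_le.mp h2).2
    have h6 := (abs_le.mp (hE v hv)).2
    linarith

/-- Polarization of `c a ± b`. The free weight `c` allows a short vector to be balanced against a
long one. -/
theorem abs_bilin_le_of_quad {N : Matrix (Fin d) (Fin d) ℝ} (hN : Nᵀ = N) {q : ℝ}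
    (h : ∀ u, |u ⬝ᵥ (N *ᵥ u)| ≤ q * (u ⬝ᵥ u)) (a b : Fin d → ℝ) {c : ℝ} (hc : 0 < c) :
    |a ⬝ᵥ (N *ᵥ b)| ≤ q / 2 * (c * (a ⬝ᵥ a) + (b ⬝ᵥ b) / c) := by
  have h1 := h (c • a + b)
  have h2 := h (c • a - b)
  have hs := dotProduct_mulVec_symm hN b a
  simp only [mulVec_add, mulVec_sub, mulVec_smul, dotProduct_add, dotProduct_sub, add_dotProduct,
    sub_dotProduct, smul_dotProduct, dotProduct_smul, smul_eq_mul, hs, dotProduct_comm b a] at h1 h2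
  have e : a ⬝ᵥ (N *ᵥ b) * (4 * c) ≤ q / 2 * (c * (a ⬝ᵥ a) + (b ⬝ᵥ b) / c) * (4 * c) ∧
      -(q / 2 * (c * (a ⬝ᵥ a) + (b ⬝ᵥ b) / c) * (4 * c)) ≤ a ⬝ᵥ (N *ᵥ b) * (4 * c) := by
    have e1 : q / 2 * (c * (a ⬝ᵥ a) + (b ⬝ᵥ b) / c) * (4 * c) =
        q * (2 * c ^ 2 * (a ⬝ᵥ a) + 2 * (b ⬝ᵥ b)) := by
      field_simp
      ring
    rw [e1]
    have h3 := abs_le.mp h1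
    have h4 := abs_le.mp h2
    constructor <;> nlinarith
  rw [abs_le]
  have h4c : 0 < 4 * c := by linarith
  constructor
  · refine le_of_mul_le_mul_right ?_ h4c
    rw [neg_mul]; exact e.2
  · exact le_of_mul_le_mul_right e.1 h4c

/-- If `q` is an admissible constant, the identity `u·Nu - v·Nv = (u - v)·N(u + v)` with `v` in the
net shows that `e + q / 2` is one too. Iteration converges to the fixed point `2 e`, starting from
the crude bound by the sum of the entries. -/
theorem abs_quad_le_of_net {F : Finset (Fin d → ℝ)} (hF1 : ∀ v ∈ F, v ⬝ᵥ v ≤ 1)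
    (hF : ∀ u : Fin d → ℝ, u ⬝ᵥ u ≤ 1 → ∃ v ∈ F, (u - v) ⬝ᵥ (u - v) ≤ 1 / 16)
    {N : Matrix (Fin d) (Fin d) ℝ} (hN : Nᵀ = N) {e : ℝ}
    (he : ∀ v ∈ F, |v ⬝ᵥ (N *ᵥ v)| ≤ e) (u : Fin d → ℝ) :
    |u ⬝ᵥ (N *ᵥ u)| ≤ 2 * e * (u ⬝ᵥ u) := by
  have hscale : ∀ {q : ℝ}, (∀ u : Fin d → ℝ, u ⬝ᵥ u = 1 → |u ⬝ᵥ (N *ᵥ u)| ≤ q) →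
      ∀ u, |u ⬝ᵥ (N *ᵥ u)| ≤ q * (u ⬝ᵥ u) := by
    intro q hq u
    rcases (dotProduct_self_nonneg_real u).eq_or_lt with h0 | h0
    · have : u = 0 := dotProduct_self_eq_zero.mp h0.symm
      simp [this]
    · set k := √(u ⬝ᵥ u) with hk
      have hk0 : 0 < k := Real.sqrt_pos.mpr h0
      have hkk : k * k = u ⬝ᵥ u := Real.mul_self_sqrt h0.le
      have := hq (k⁻¹ • u) (by
        rw [smul_dotProduct, dotProduct_smul, ← hkk]
        simp only [smul_eq_mul]; field_simp)
      rw [mulVec_smul, smul_dotProduct, dotProduct_smul] at this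
      simp only [smul_eq_mul, abs_mul, abs_inv, abs_of_pos hk0] at this
      rw [← hkk]
      calc |u ⬝ᵥ (N *ᵥ u)| = k⁻¹ * (k⁻¹ * |u ⬝ᵥ (N *ᵥ u)|) * (k * k) := by field_simp
        _ ≤ q * (k * k) := mul_le_mul_of_nonneg_right this (by positivity)
  have hstep : ∀ {q : ℝ}, (∀ u, |u ⬝ᵥ (N *ᵥ u)| ≤ q * (u ⬝ᵥ u)) →
      ∀ u, |u ⬝ᵥ (N *ᵥ u)| ≤ (e + q / 2) * (u ⬝ᵥ u) := by
    intro q hq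
    refine hscale fun u hu => ?_
    obtain ⟨v, hv, huv⟩ := hF u hu.le
    have h1 := he v hv
    have hq0 : 0 ≤ q := by
      have := (abs_nonneg _).trans (hq u)
      rwa [hu, mul_one] at this
    -- The squared lengths are at most `1 / 16` and `4`; with weight 8 both terms are at most `1 /
    -- 2`.
    have h2 := abs_bilin_le_of_quad hN hq (u - v) (u + v) (c := 8) (by norm_num)
    have h3 : (u + v) ⬝ᵥ (u + v) ≤ 4 := by
      have h4 : 0 ≤ (u - v) ⬝ᵥ (u - v) := dotProduct_self_nonneg_real _
      have h5 := hF1 v hv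
      simp only [sub_dotProduct, dotProduct_sub, add_dotProduct, dotProduct_add,
        dotProduct_comm v u] at h4 ⊢
      linarith
    have h4 : (u - v) ⬝ᵥ (N *ᵥ (u + v)) = u ⬝ᵥ (N *ᵥ u) - v ⬝ᵥ (N *ᵥ v) := by
      simp only [mulVec_add, dotProduct_add, sub_dotProduct, dotProduct_mulVec_symm hN v u]
      ring
    rw [h4] at h2
    have h5 : q / 2 * (8 * ((u - v) ⬝ᵥ (u - v)) + (u + v) ⬝ᵥ (u + v) / 8) ≤ q / 2 * 1 :=
      mul_le_mul_of_nonneg_left (by linarith) (by linarith)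
    have h6 := abs_sub_abs_le_abs_sub (u ⬝ᵥ (N *ᵥ u)) (v ⬝ᵥ (N *ᵥ v))
    linarith
  have hbase : ∃ q, ∀ u, |u ⬝ᵥ (N *ᵥ u)| ≤ q * (u ⬝ᵥ u) := by
    refine ⟨∑ i, ∑ j, |N i j|, hscale fun u hu => ?_⟩
    have hu1 : ∀ i, |u i| ≤ 1 := fun i => by
      rw [← abs_one, ← sq_le_sq, one_pow, ← hu]
      exact sq_coord_le u i
    simp only [dotProduct, mulVec, Finset.mul_sum]
    refine (Finset.abs_sum_le_sum_abs _ _).trans (Finset.sum_le_sum fun i _ => ?_)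
    refine (Finset.abs_sum_le_sum_abs _ _).trans (Finset.sum_le_sum fun j _ => ?_)
    rw [abs_mul, abs_mul]
    have := mul_le_mul_of_nonneg_left (hu1 j) (abs_nonneg (N i j))
    calc |u i| * (|N i j| * |u j|) ≤ 1 * (|N i j| * 1) :=
          mul_le_mul (hu1 i) this (by positivity) zero_le_one
      _ = |N i j| := by ring
  obtain ⟨q, hq⟩ := hbase
  have hall : ∀ k : ℕ, ∀ u, |u ⬝ᵥ (N *ᵥ u)| ≤ (2 * e + (q - 2 * e) * (1 / 2) ^ k) * (u ⬝ᵥ u) := by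
    intro k
    induction k with
    | zero => simpa using hq
    | succ k ih =>
      have := hstep ih
      intro u
      refine (this u).trans (le_of_eq ?_)
      rw [pow_succ]; ring
  have hlim : Filter.Tendsto (fun k : ℕ => (2 * e + (q - 2 * e) * (1 / 2) ^ k) * (u ⬝ᵥ u))
      Filter.atTop (nhds ((2 * e + (q - 2 * e) * 0) * (u ⬝ᵥ u))) :=
    ((tendsto_const_nhds.mul (tendsto_pow_atTop_nhds_zero_of_lt_one (by norm_num)
      (by norm_num))).const_add _).mul_const _
  rw [mul_zero, add_zero] at hlim
  exact ge_of_tendsto' hlim fun k => hall k u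

end Nets


/-! ### Uniform deviation bounds on one dyadic scale -/

/-- The tilt is optimal at time `τ`. Using it at time `t` costs the factor `(τ + t) / (2 √(τ t))`,
which is at most `3 √2 / 4` on the block `[τ, 2 τ]`. -/
theorem le_of_tuned_le {s Q ℒ τ t y : ℝ} (hs : 0 < s) (hQ : 0 < Q) (hℒ : 0 < ℒ) (hτ : 0 < τ)
    (h1 : τ ≤ t) (h2 : t ≤ 2 * τ)
    (h : 2 * s * Q * √ℒ / √τ * y ≤ s ^ 2 * ℒ + t * (s ^ 2 * ℒ / τ)) :
    y ≤ 3 * √2 / 4 * s * (√(t * ℒ) / Q) := by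
  have ht : 0 < t := hτ.trans_le h1
  set a := √τ with ha
  set b := √t with hb
  set l := √ℒ with hl
  have ha0 : 0 < a := Real.sqrt_pos.mpr hτ
  have hb0 : 0 < b := Real.sqrt_pos.mpr ht
  have hl0 : 0 < l := Real.sqrt_pos.mpr hℒ
  have haa : τ = a ^ 2 := (Real.sq_sqrt hτ.le).symm
  have hbb : t = b ^ 2 := (Real.sq_sqrt ht.le).symm
  have hll : ℒ = l ^ 2 := (Real.sq_sqrt hℒ.le).symm
  have hab : a ≤ b := Real.sqrt_le_sqrt h1
  have h22 : √2 ^ 2 = 2 := Real.sq_sqrt (by norm_num)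
  have h20 : 0 < √2 := by positivity
  have hba : b ≤ √2 * a := by
    rw [ha, hb, ← Real.sqrt_mul (by norm_num)]
    exact Real.sqrt_le_sqrt h2
  have hkey : a ^ 2 + b ^ 2 ≤ 3 * √2 / 2 * (a * b) := by
    have h3 : a ≤ √2 * b := by nlinarith only [hab, h22, h20, ha0, hb0]
    have h4 : 0 ≤ (√2 * a - b) * (√2 * b - a) :=
      mul_nonneg (by linarith) (by linarith)
    have h5 : (√2 * a - b) * (√2 * b - a) = √2 ^ 2 * (a * b) - √2 * (a ^ 2 + b ^ 2) + a * b := by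
      ring
    rw [h5, h22] at h4
    have h6 : √2 * (a ^ 2 + b ^ 2) ≤ √2 * (3 * √2 / 2 * (a * b)) := by
      have : √2 * (3 * √2 / 2 * (a * b)) = √2 ^ 2 * (3 / 2) * (a * b) := by ring
      rw [this, h22]; linarith
    exact le_of_mul_le_mul_left h6 h20
  rw [Real.sqrt_mul ht.le, ← hb, ← hl]
  rw [haa, hbb, hll] at h
  have h7 : 2 * s * Q * l / a * y ≤ 2 * s * Q * l / a * (3 * √2 / 4 * s * (b * l / Q)) := by
    refine h.trans ?_
    have e1 : s ^ 2 * l ^ 2 + b ^ 2 * (s ^ 2 * l ^ 2 / a ^ 2) =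
        s ^ 2 * l ^ 2 / a ^ 2 * (a ^ 2 + b ^ 2) := by field_simp
    have e2 : 2 * s * Q * l / a * (3 * √2 / 4 * s * (b * l / Q)) =
        s ^ 2 * l ^ 2 / a ^ 2 * (3 * √2 / 2 * (a * b)) := by field_simp; ring
    rw [e1, e2]
    exact mul_le_mul_of_nonneg_left hkey (by positivity)
  exact le_of_mul_le_mul_left h7 (by positivity)

theorem measure_biUnion_le_card_mul {Ω ι : Type*} {mΩ : MeasurableSpace Ω} (μ : Measure Ω)
    (F : Finset ι) (E : ι → Set Ω) {e : ℝ}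
    (h : ∀ i ∈ F, μ (E i) ≤ ENNReal.ofReal e) :
    μ (⋃ i ∈ F, E i) ≤ ENNReal.ofReal (F.card * e) := by
  calc μ (⋃ i ∈ F, E i) ≤ ∑ i ∈ F, μ (E i) := measure_biUnion_finset_le F E
    _ ≤ ∑ _i ∈ F, ENNReal.ofReal e := Finset.sum_le_sum h
    _ = ENNReal.ofReal (F.card * e) := by
        rw [Finset.sum_const, nsmul_eq_mul, ENNReal.ofReal_mul (Nat.cast_nonneg _),
          ENNReal.ofReal_natCast]

/-- The compensator of the reward noise depends on the direction through `gram`; this transfers it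
from a net point to the direction that the point approximates. -/
theorem gram_quad_le_of_close {d : ℕ} {L : ℝ} (hL : 0 < L) {x : ℕ → Fin d → ℝ} {t : ℕ}
    (hx : ∀ s < t, x s ⬝ᵥ x s ≤ L ^ 2) {u v : Fin d → ℝ} {ρ : ℝ}
    (h : (u - v) ⬝ᵥ (u - v) ≤ ρ) :
    v ⬝ᵥ (gram L x t *ᵥ v) ≤ 2 * (u ⬝ᵥ (gram L x t *ᵥ u)) + t * ρ := by
  rw [quad_gram, quad_gram, Finset.mul_sum]
  have : (t : ℝ) * ρ = ∑ _s ∈ Finset.range t, ρ := by simp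
  rw [this, ← Finset.sum_add_distrib]
  refine Finset.sum_le_sum fun s hs => ?_
  have h1 := hx s (Finset.mem_range.mp hs)
  have h2 := dotProduct_sq_le (u - v) (x s)
  have h3 : ((u - v) ⬝ᵥ x s) ^ 2 ≤ ρ * L ^ 2 := by
    refine h2.trans ?_
    exact mul_le_mul h h1 (dotProduct_self_nonneg_real _)
      ((dotProduct_self_nonneg_real _).trans h)
  rw [sub_dotProduct] at h3
  have h4 : (v ⬝ᵥ x s) ^ 2 ≤ 2 * (u ⬝ᵥ x s) ^ 2 + 2 * (ρ * L ^ 2) := by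
    nlinarith only [h3, sq_nonneg (2 * (u ⬝ᵥ x s) - (v ⬝ᵥ x s))]
  calc (v ⬝ᵥ x s) ^ 2 / (2 * L ^ 2) ≤ (2 * (u ⬝ᵥ x s) ^ 2 + 2 * (ρ * L ^ 2)) / (2 * L ^ 2) := by
        gcongr
    _ = _ := by field_simp

theorem abs_dotProduct_rewardNoise_le {d : ℕ} {L S : ℝ} (hL : 0 < L) {θ : Fin d → ℝ}
    (hS : 0 ≤ S) (hθ : θ ⬝ᵥ θ ≤ S ^ 2) {x : ℕ → Fin d → ℝ} {r : ℕ → ℝ} {t : ℕ}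
    (hx : ∀ s < t, x s ⬝ᵥ x s ≤ L ^ 2) (hr : ∀ s < t, r s ∈ Set.Icc (0 : ℝ) 1)
    (a : Fin d → ℝ) :
    |a ⬝ᵥ rewardNoise L θ x r t| ≤ √(a ⬝ᵥ a) * (t * ((1 + L * S) / 2)) := by
  rw [dotProduct_rewardNoise]
  refine (Finset.abs_sum_le_sum_abs _ _).trans ?_
  have : √(a ⬝ᵥ a) * (t * ((1 + L * S) / 2)) =
      ∑ _s ∈ Finset.range t, √(a ⬝ᵥ a) * ((1 + L * S) / 2) := by simp; ring
  rw [this]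
  refine Finset.sum_le_sum fun s hs => ?_
  have hs' := Finset.mem_range.mp hs
  have hxs : √(x s ⬝ᵥ x s) ≤ L := Real.sqrt_le_iff.mpr ⟨hL.le, hx s hs'⟩
  have h1 : |a ⬝ᵥ x s| ≤ √(a ⬝ᵥ a) * L :=
    (abs_dotProduct_le _ _).trans (mul_le_mul_of_nonneg_left hxs (Real.sqrt_nonneg _))
  have h2 : |x s ⬝ᵥ θ| ≤ L * S :=
    (abs_dotProduct_le _ _).trans (mul_le_mul hxs (Real.sqrt_le_iff.mpr ⟨hS, hθ⟩)
      (Real.sqrt_nonneg _) hL.le)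
  have h3 : |r s - x s ⬝ᵥ θ| ≤ 1 + L * S := by
    have := hr s hs'
    have h4 := abs_le.mp h2
    rw [abs_le]
    constructor <;> linarith [this.1, this.2]
  rw [abs_mul, abs_div, abs_of_pos (by positivity : 0 < 2 * L)]
  calc |a ⬝ᵥ x s| / (2 * L) * |r s - x s ⬝ᵥ θ|
      ≤ √(a ⬝ᵥ a) * L / (2 * L) * (1 + L * S) := by gcongr
    _ = _ := by field_simp

theorem noiseMat_transpose {d m : ℕ} (p L : ℝ) (x : ℕ → Fin d → ℝ) (z : ℕ → Report d m) (t : ℕ) :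
    (noiseMat p L x z t)ᵀ = noiseMat p L x z t := by
  ext i j
  simp only [noiseMat, transpose_apply, Matrix.of_apply]
  exact Finset.sum_congr rfl fun s _ => by rw [debiasedMat_comm, mul_comm (x s j)]

section ScaleEvent

variable {Ω : Type*} [mΩ : MeasurableSpace Ω] {μ : Measure Ω} [IsProbabilityMeasure μ] {d m : ℕ}
  {P : Params d m} {K : ℕ} {θstar : EuclideanSpace ℝ (Fin d)}

set_option maxHeartbeats 1000000 in
-- For the privacy noises a net of mesh `1 / 4` suffices. Its size does not depend on `τ`, and each
-- direction fails with probability at most `(δ / (2 τ)) ^ (s ^ 2)`. The reward bound is not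
-- homogeneous in the direction and uses a net of mesh `1 / τ`, so its directions are controlled at
-- level `(d + 1) ℒ`: `d` factors `δ / (2 τ)` absorb the size of the net, and the last one is at
-- most `(δ / (2 τ)) ^ (s ^ 2)` because `s ≤ 1`. The reward tilt has order `τ ^ (-1 / 4)`, which
-- balances its two error terms against a regularizer of order `√τ`.
theorem Run.exists_scale_event (R : Run μ P K θstar) (hd : 0 < d) (hm : 0 < m) (hL : 0 < P.L)
    (hε : 0 < P.epsLocal) {S δ s g : ℝ} (hθ : ‖θstar‖ ≤ S) (hδ : 0 < δ) (hδ1 : δ < 1)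
    (hs : 0 < s) (hs1 : s ≤ 1) (hg : 0 < g) {τ : ℕ} (hτ : 1 ≤ τ) :
    ∃ Bad : Set Ω,
      μ Bad ≤ ENNReal.ofReal ((4 * (8 * d + 1) ^ d + 2 * (d + 1) ^ d) *
        (δ / (2 * τ)) ^ (s ^ 2)) ∧
      ∀ ω ∉ Bad, ∀ t : ℕ, τ ≤ t → t ≤ 2 * τ → t ≤ P.T →
        (∀ u, |u ⬝ᵥ (noiseMat P.p P.L (R.feature ω) (fun s => R.report s ω) t *ᵥ u)| ≤
          3 * √2 / 2 * s * (√(t * Real.log (2 * τ / δ)) / ((1 - P.p) * √m)) * (u ⬝ᵥ u)) ∧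
        (∀ u, |u ⬝ᵥ noiseVec P.p P.L (R.feature ω) (fun s => R.reward s ω)
            (fun s => R.report s ω) t| ≤
          s * (√(t * Real.log (2 * τ / δ)) / ((1 - P.p) * √m)) * √(u ⬝ᵥ u)) ∧
        (∀ u, u ⬝ᵥ u = 1 →
          |u ⬝ᵥ rewardNoise P.L θstar.ofLp (R.feature ω) (fun s => R.reward s ω) t| ≤
            g / √√τ * (u ⬝ᵥ (gram P.L (R.feature ω) t *ᵥ u) + 1) / 8 +
              (d + 1) * Real.log (2 * τ / δ) * √√τ / g + (1 + P.L * S)) := by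
  have hτ1 : (1 : ℝ) ≤ τ := by exact_mod_cast hτ
  have hτ0 : (0 : ℝ) < τ := by linarith
  have hp : P.p < 1 := flipProb_lt_one hd hm hε
  have hp' : 0 < 1 - P.p := by linarith
  have hm' : (0 : ℝ) < m := by exact_mod_cast hm
  have hS : 0 ≤ S := (norm_nonneg _).trans hθ
  set ℒ := Real.log (2 * τ / δ) with hℒdef
  have hℒ : 0 < ℒ := Real.log_pos (by rw [lt_div_iff₀ hδ]; linarith)
  have hρ0 : 0 < δ / (2 * τ) := by positivity
  have hρ1 : δ / (2 * τ) ≤ 1 := by rw [div_le_one (by positivity)]; linarith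
  have hρ2 : δ / (2 * τ) ≤ 1 / (2 * τ) := by gcongr
  have hlogρ : Real.log (δ / (2 * τ)) = -ℒ := by
    rw [hℒdef, ← Real.log_inv, inv_div]
  have hexp : Real.exp (-(s ^ 2 * ℒ)) = (δ / (2 * τ)) ^ (s ^ 2) := by
    rw [Real.rpow_def_of_pos hρ0, hlogρ]; ring_nf
  have hexp1 : Real.exp (-((d + 1) * ℒ)) = (δ / (2 * τ)) ^ (d + 1) := by
    have : -((d + 1) * ℒ) = ((d + 1 : ℕ) : ℝ) * Real.log (δ / (2 * τ)) := by
      rw [hlogρ]; push_cast; ring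
    rw [this, Real.exp_nat_mul, Real.exp_log hρ0]
  set Q := (1 - P.p) * √m with hQdef
  have hQ : 0 < Q := by positivity
  have hQ2 : (m : ℝ) * (1 - P.p) ^ 2 = Q ^ 2 := by
    rw [hQdef, mul_pow, Real.sq_sqrt hm'.le]; ring
  set a := 2 * s * Q * √ℒ / √τ with hadef
  have ha0 : 0 < a := by positivity
  have ha2 : a ^ 2 = 4 * (s ^ 2 * Q ^ 2 * ℒ / τ) := by
    rw [hadef, div_pow, mul_pow, Real.sq_sqrt hℒ.le, Real.sq_sqrt hτ0.le]; ring
  set α := g / √√τ with hαdef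
  have hα0 : 0 < α := by positivity
  obtain ⟨F, hFc, hF1, hF2⟩ := exists_net hd (n := 4) (by norm_num)
  have hF2' : ∀ u : Fin d → ℝ, u ⬝ᵥ u ≤ 1 → ∃ v ∈ F, (u - v) ⬝ᵥ (u - v) ≤ 1 / 16 := by
    intro u hu
    obtain ⟨v, hv, h⟩ := hF2 u hu
    exact ⟨v, hv, h.trans (by norm_num)⟩
  obtain ⟨G, hGc, hG1, hG2⟩ := exists_net hd (n := τ) hτ
  let N : Ω → ℕ → Matrix (Fin d) (Fin d) ℝ := fun ω t =>
    noiseMat P.p P.L (R.feature ω) (fun s => R.report s ω) t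
  let E : Ω → ℕ → Fin d → ℝ := fun ω t => noiseVec P.p P.L (R.feature ω) (fun s => R.reward s ω)
    (fun s => R.report s ω) t
  let W : Ω → ℕ → Fin d → ℝ := fun ω t =>
    rewardNoise P.L θstar.ofLp (R.feature ω) (fun s => R.reward s ω) t
  let X : Ω → ℕ → Matrix (Fin d) (Fin d) ℝ := fun ω t => gram P.L (R.feature ω) t
  let EM : ℝ → (Fin d → ℝ) → Set Ω := fun σ v => {ω | ∃ t ≤ P.T, s ^ 2 * ℒ ≤
    (σ * a) * (v ⬝ᵥ (N ω t *ᵥ v)) - t * ((σ * a) ^ 2 * (v ⬝ᵥ v) ^ 2 / (4 * m * (1 - P.p) ^ 2))}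
  -- The variance constant of the vector statistic is half that of the matrix statistic, hence the
  -- tilt is larger by `√2`. The loss `3 / 4` that remains is cancelled by the factor `4 / 3` of the
  -- net.
  let EV : ℝ → (Fin d → ℝ) → Set Ω := fun σ v => {ω | ∃ t ≤ P.T, s ^ 2 * ℒ ≤
    ((σ * (√2 * a)) • v) ⬝ᵥ E ω t - t * ((((σ * (√2 * a)) • v) ⬝ᵥ ((σ * (√2 * a)) • v)) /
      (8 * m * (1 - P.p) ^ 2))}
  let ES : ℝ → (Fin d → ℝ) → Set Ω := fun σ v => {ω | ∃ t ≤ P.T, (d + 1) * ℒ ≤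
    ((σ * α) • v) ⬝ᵥ W ω t - (((σ * α) • v) ⬝ᵥ (X ω t *ᵥ ((σ * α) • v))) / 16}
  have hEM : ∀ σ v, μ (EM σ v) ≤ ENNReal.ofReal ((δ / (2 * τ)) ^ (s ^ 2)) := fun σ v => by
    rw [← hexp]; exact R.measure_noiseMat_le hd hm hL hε (σ * a) v _
  have hEV : ∀ σ v, μ (EV σ v) ≤ ENNReal.ofReal ((δ / (2 * τ)) ^ (s ^ 2)) := fun σ v => by
    rw [← hexp]; exact R.measure_noiseVec_le hd hm hL hε ((σ * (√2 * a)) • v) _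
  have hES : ∀ σ v, μ (ES σ v) ≤ ENNReal.ofReal ((δ / (2 * τ)) ^ (d + 1)) := fun σ v => by
    rw [← hexp1]; exact R.measure_rewardNoise_le hL ((σ * α) • v) _
  have hr0 : 0 ≤ (δ / (2 * τ)) ^ (s ^ 2) := by positivity
  have hr1 : 0 ≤ (δ / (2 * τ)) ^ (d + 1) := by positivity
  refine ⟨((⋃ v ∈ F, EM 1 v) ∪ (⋃ v ∈ F, EM (-1) v)) ∪ (((⋃ v ∈ F, EV 1 v) ∪
    (⋃ v ∈ F, EV (-1) v)) ∪ ((⋃ v ∈ G, ES 1 v) ∪ (⋃ v ∈ G, ES (-1) v))), ?_, ?_⟩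
  · refine (measure_union_le _ _).trans ((add_le_add (measure_union_le _ _)
      ((measure_union_le _ _).trans (add_le_add (measure_union_le _ _)
        (measure_union_le _ _)))).trans ?_)
    refine (add_le_add (add_le_add (measure_biUnion_le_card_mul μ F _ fun v _ => hEM _ v)
      (measure_biUnion_le_card_mul μ F _ fun v _ => hEM _ v)) (add_le_add (add_le_add
      (measure_biUnion_le_card_mul μ F _ fun v _ => hEV _ v)
      (measure_biUnion_le_card_mul μ F _ fun v _ => hEV _ v)) (add_le_add
      (measure_biUnion_le_card_mul μ G _ fun v _ => hES _ v)
      (measure_biUnion_le_card_mul μ G _ fun v _ => hES _ v)))).trans ?_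
    rw [← ENNReal.ofReal_add (by positivity) (by positivity),
      ← ENNReal.ofReal_add (by positivity) (by positivity),
      ← ENNReal.ofReal_add (by positivity) (by positivity),
      ← ENNReal.ofReal_add (by positivity) (by positivity)]
    refine ENNReal.ofReal_le_ofReal ?_
    have hFc' : (F.card : ℝ) ≤ (8 * d + 1) ^ d := by
      have : ((F.card : ℕ) : ℝ) ≤ (((2 * d * 4 + 1) ^ d : ℕ) : ℝ) := by exact_mod_cast hFc
      push_cast at this
      calc _ ≤ _ := this
        _ = _ := by congr 1; ring
    have hGc' : (G.card : ℝ) ≤ (2 * d * τ + 1) ^ d := by exact_mod_cast hGc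
    have h1 : (G.card : ℝ) * (δ / (2 * τ)) ^ (d + 1) ≤ (d + 1) ^ d * (δ / (2 * τ)) ^ (s ^ 2) := by
      have h2 : (δ / (2 * τ)) ≤ (δ / (2 * τ)) ^ (s ^ 2) := by
        conv_lhs => rw [← Real.rpow_one (δ / (2 * τ))]
        exact Real.rpow_le_rpow_of_exponent_ge hρ0 hρ1 (by nlinarith only [hs, hs1])
      have h3 : (2 * d * τ + 1) * (δ / (2 * τ)) ≤ (d + 1 : ℝ) := by
        calc (2 * d * τ + 1) * (δ / (2 * τ)) ≤ (2 * d * τ + 1) * (1 / (2 * τ)) := by gcongr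
          _ = d + 1 / (2 * τ) := by field_simp
          _ ≤ d + 1 := by
            gcongr
            rw [div_le_one (by positivity)]; linarith
      calc (G.card : ℝ) * (δ / (2 * τ)) ^ (d + 1)
          ≤ (2 * d * τ + 1) ^ d * (δ / (2 * τ)) ^ (d + 1) := by gcongr
        _ = ((2 * d * τ + 1) * (δ / (2 * τ))) ^ d * (δ / (2 * τ)) := by
            rw [pow_succ, mul_pow, ← mul_assoc]
        _ ≤ (d + 1) ^ d * (δ / (2 * τ)) ^ (s ^ 2) := by gcongr
    have h4 := mul_le_mul_of_nonneg_right hFc' hr0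
    linarith
  · intro ω hω t ht1 ht2 htT
    simp only [Set.mem_union, Set.mem_iUnion, not_or, not_exists] at hω
    obtain ⟨⟨hM1, hM2⟩, ⟨hV1, hV2⟩, hS1, hS2⟩ := hω
    have ht1' : (τ : ℝ) ≤ t := by exact_mod_cast ht1
    have ht2' : (t : ℝ) ≤ 2 * τ := by exact_mod_cast ht2
    have ht0 : (0 : ℝ) ≤ t := Nat.cast_nonneg t
    have hxL : ∀ s < t, R.feature ω s ⬝ᵥ R.feature ω s ≤ P.L ^ 2 := fun s hs' =>
      R.feature_dot_self_le (by omega) ω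
    refine ⟨?_, ?_, ?_⟩
    · have hv : ∀ v ∈ F, |v ⬝ᵥ (N ω t *ᵥ v)| ≤ 3 * √2 / 4 * s * (√(t * ℒ) / Q) := by
        intro v hvF
        have hvv := hF1 v hvF
        have hvv0 := dotProduct_self_nonneg_real v
        have hcoef : t * (a ^ 2 * (v ⬝ᵥ v) ^ 2 / (4 * m * (1 - P.p) ^ 2)) ≤
            t * (s ^ 2 * ℒ / τ) := by
          refine mul_le_mul_of_nonneg_left ?_ ht0
          rw [mul_assoc 4, hQ2, ha2]
          have e1 : 4 * (s ^ 2 * Q ^ 2 * ℒ / τ) * (v ⬝ᵥ v) ^ 2 / (4 * Q ^ 2) =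
            s ^ 2 * ℒ / τ * (v ⬝ᵥ v) ^ 2 := by field_simp
          rw [e1]
          exact mul_le_of_le_one_right (by positivity) (pow_le_one₀ hvv0 hvv)
        have h1 : ¬ s ^ 2 * ℒ ≤ (1 * a) * (v ⬝ᵥ (N ω t *ᵥ v)) -
            t * ((1 * a) ^ 2 * (v ⬝ᵥ v) ^ 2 / (4 * m * (1 - P.p) ^ 2)) :=
          fun h => hM1 v hvF ⟨t, htT, h⟩
        have h2 : ¬ s ^ 2 * ℒ ≤ (-1 * a) * (v ⬝ᵥ (N ω t *ᵥ v)) -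
            t * ((-1 * a) ^ 2 * (v ⬝ᵥ v) ^ 2 / (4 * m * (1 - P.p) ^ 2)) :=
          fun h => hM2 v hvF ⟨t, htT, h⟩
        rw [one_mul, not_le] at h1
        rw [neg_one_mul, neg_sq, not_le] at h2
        rw [abs_le']
        constructor
        · exact le_of_tuned_le hs hQ hℒ hτ0 ht1' ht2' (by rw [← hadef]; linarith)
        · exact le_of_tuned_le hs hQ hℒ hτ0 ht1' ht2' (by rw [← hadef]; linarith)
      intro u
      refine (abs_quad_le_of_net hF1 hF2' (noiseMat_transpose _ _ _ _ _) hv u).trans (le_of_eq ?_)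
      ring
    · have h22 : √2 ^ 2 = 2 := Real.sq_sqrt (by norm_num)
      have h20 : 0 < √2 := by positivity
      have hv : ∀ v ∈ F, |v ⬝ᵥ E ω t| ≤ 3 / 4 * s * (√(t * ℒ) / Q) := by
        intro v hvF
        have hvv := hF1 v hvF
        have hvv0 := dotProduct_self_nonneg_real v
        have hcoef : t * ((√2 * a) * ((√2 * a) * (v ⬝ᵥ v)) / (8 * m * (1 - P.p) ^ 2)) ≤
            t * (s ^ 2 * ℒ / τ) := by
          refine mul_le_mul_of_nonneg_left ?_ ht0
          have e0 : (√2 * a) * ((√2 * a) * (v ⬝ᵥ v)) = √2 ^ 2 * a ^ 2 * (v ⬝ᵥ v) := by ring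
          rw [mul_assoc 8, hQ2, e0, h22, ha2]
          have e1 : 2 * (4 * (s ^ 2 * Q ^ 2 * ℒ / τ)) * (v ⬝ᵥ v) / (8 * Q ^ 2) =
            s ^ 2 * ℒ / τ * (v ⬝ᵥ v) := by field_simp; ring
          rw [e1]
          exact mul_le_of_le_one_right (by positivity) hvv
        have h1 : ¬ s ^ 2 * ℒ ≤ ((1 * (√2 * a)) • v) ⬝ᵥ E ω t - t *
            ((((1 * (√2 * a)) • v) ⬝ᵥ ((1 * (√2 * a)) • v)) / (8 * m * (1 - P.p) ^ 2)) :=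
          fun h => hV1 v hvF ⟨t, htT, h⟩
        have h2 : ¬ s ^ 2 * ℒ ≤ ((-1 * (√2 * a)) • v) ⬝ᵥ E ω t - t *
            ((((-1 * (√2 * a)) • v) ⬝ᵥ ((-1 * (√2 * a)) • v)) / (8 * m * (1 - P.p) ^ 2)) :=
          fun h => hV2 v hvF ⟨t, htT, h⟩
        simp only [smul_dotProduct, dotProduct_smul, smul_eq_mul, one_mul, neg_mul,
          mul_neg, neg_neg, not_le] at h1 h2
        have hfin : ∀ y, a * (√2 * y) ≤ s ^ 2 * ℒ + t * (s ^ 2 * ℒ / τ) →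
            y ≤ 3 / 4 * s * (√(t * ℒ) / Q) := by
          intro y hy
          have h3 := le_of_tuned_le hs hQ hℒ hτ0 ht1' ht2' (by rw [← hadef]; exact hy)
          refine le_of_mul_le_mul_left (h3.trans (le_of_eq ?_)) h20
          ring
        rw [abs_le']
        constructor
        · exact hfin _ (by linarith)
        · exact hfin _ (by linarith)
      have hE := dotProduct_self_le_of_net hF2' hv
      intro u
      refine (abs_dotProduct_le _ _).trans ?_
      rw [mul_comm]
      refine mul_le_mul_of_nonneg_right (hE.trans (le_of_eq ?_)) (Real.sqrt_nonneg _)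
      ring
    · intro u hu
      obtain ⟨v, hvG, huv⟩ := hG2 u hu.le
      have hX := gram_quad_le_of_close hL hxL huv
      have hX2 : (t : ℝ) * (1 / (τ : ℝ) ^ 2) ≤ 2 := by
        rw [mul_one_div, div_le_iff₀ (by positivity)]
        nlinarith only [ht2', hτ1]
      have hθ2 : θstar.ofLp ⬝ᵥ θstar.ofLp ≤ S ^ 2 := by
        have h2 := EuclideanSpace.real_norm_sq_eq θstar
        have h3 : θstar.ofLp ⬝ᵥ θstar.ofLp = ‖θstar‖ ^ 2 := by
          rw [h2]; simp [dotProduct, sq]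
        rw [h3]
        exact pow_le_pow_left₀ (norm_nonneg _) hθ 2
      have hdiff := abs_dotProduct_rewardNoise_le hL hS hθ2 hxL
        (fun s hs' => R.reward_mem s (by omega) ω) (u - v)
      have hdiff2 : √((u - v) ⬝ᵥ (u - v)) * (t * ((1 + P.L * S) / 2)) ≤ 1 + P.L * S := by
        have h1 : √((u - v) ⬝ᵥ (u - v)) ≤ 1 / τ := by
          refine Real.sqrt_le_iff.mpr ⟨by positivity, ?_⟩
          rw [div_pow, one_pow]; exact huv
        calc √((u - v) ⬝ᵥ (u - v)) * (t * ((1 + P.L * S) / 2))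
            ≤ 1 / τ * ((2 * τ) * ((1 + P.L * S) / 2)) := by gcongr
          _ = 1 + P.L * S := by field_simp
      have h1 : ¬ (d + 1) * ℒ ≤ ((1 * α) • v) ⬝ᵥ W ω t -
          (((1 * α) • v) ⬝ᵥ (X ω t *ᵥ ((1 * α) • v))) / 16 := fun h => hS1 v hvG ⟨t, htT, h⟩
      have h2 : ¬ (d + 1) * ℒ ≤ ((-1 * α) • v) ⬝ᵥ W ω t -
          (((-1 * α) • v) ⬝ᵥ (X ω t *ᵥ ((-1 * α) • v))) / 16 := fun h => hS2 v hvG ⟨t, htT, h⟩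
      simp only [smul_dotProduct, dotProduct_smul, mulVec_smul, smul_eq_mul, one_mul,
        neg_mul, mul_neg, neg_neg, not_le] at h1 h2
      have hfin : ∀ y, α * y < α * (α * (v ⬝ᵥ (X ω t *ᵥ v))) / 16 + (d + 1) * ℒ →
          y ≤ α * (u ⬝ᵥ (X ω t *ᵥ u) + 1) / 8 + (d + 1) * ℒ / α := by
        intro y hy
        refine le_of_mul_le_mul_left ?_ hα0
        have e1 : α * (α * (u ⬝ᵥ (X ω t *ᵥ u) + 1) / 8 + (d + 1) * ℒ / α) =
            α * (α * (2 * (u ⬝ᵥ (X ω t *ᵥ u)) + 2)) / 16 + (d + 1) * ℒ := by field_simp; ring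
        rw [e1]
        have h3 : v ⬝ᵥ (X ω t *ᵥ v) ≤ 2 * (u ⬝ᵥ (X ω t *ᵥ u)) + 2 := by
          calc _ ≤ _ := hX
            _ ≤ _ := by linarith
        have h4 := mul_le_mul_of_nonneg_left (mul_le_mul_of_nonneg_left h3 hα0.le) hα0.le
        linarith
      have h3 := hfin _ (by linarith : α * (v ⬝ᵥ W ω t) < _)
      have h4 := hfin (-(v ⬝ᵥ W ω t)) (by linarith)
      have e2 : (d + 1) * ℒ * √√τ / g = (d + 1) * ℒ / α := by rw [hαdef]; field_simp
      rw [e2]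
      have h5 := abs_le.mp (hdiff.trans hdiff2)
      rw [sub_dotProduct] at h5
      have h6 : |v ⬝ᵥ W ω t| ≤ α * (u ⬝ᵥ (X ω t *ᵥ u) + 1) / 8 + (d + 1) * ℒ / α := by
        rw [abs_le']; exact ⟨h3, h4⟩
      have h7 := abs_le.mp h6
      rw [abs_le]
      constructor
      · linarith [h5.1, h5.2, h7.1, h7.2]
      · linarith [h5.1, h5.2, h7.1, h7.2]

end ScaleEvent


/-! ### Validity of the statistics -/

section Validity

variable {d m : ℕ}

/-- The design matrix that the algorithm computes from the first `t` reports. -/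
noncomputable def estMat (P : Params d m) (z : ℕ → Report d m) (t : ℕ) : Matrix (Fin d) (Fin d) ℝ :=
  (Matrix.of fun i j => ∑ s ∈ Finset.range t, debiasedMat P.p (z s) i j) +
    (2 * P.reg t - P.lam) • (1 : Matrix (Fin d) (Fin d) ℝ)

/-- The vector statistic that the algorithm computes from the first `t` reports. -/
noncomputable def estVec (P : Params d m) (z : ℕ → Report d m) (t : ℕ) : Fin d → ℝ :=
  fun i => ∑ s ∈ Finset.range t, debiasedVec P.p (z s) i

/-- The statistics after `t` rounds are accurate: the design matrix is comparable with its
noiseless version and the confidence bound holds. -/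
structure ValidAt (P : Params d m) (S : ℝ) (θ : Fin d → ℝ) (x : ℕ → Fin d → ℝ)
    (z : ℕ → Report d m) (t : ℕ) : Prop where
  one_le_reg : 1 ≤ P.reg t
  lower : ∀ u, u ⬝ᵥ (gram P.L x t *ᵥ u) + 8 / 5 * P.reg t * (u ⬝ᵥ u) ≤ u ⬝ᵥ (estMat P z t *ᵥ u)
  upper : ∀ u, u ⬝ᵥ (estMat P z t *ᵥ u) ≤ u ⬝ᵥ (gram P.L x t *ᵥ u) + 19 / 8 * P.reg t * (u ⬝ᵥ u)
  conf : ∀ u, |u ⬝ᵥ ((1 / P.L) • estVec P z t - estMat P z t *ᵥ θ)| ≤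
    S * √(3 * P.reg t) * √(u ⬝ᵥ (estMat P z t *ᵥ u))

theorem gram_transpose (L : ℝ) (x : ℕ → Fin d → ℝ) (t : ℕ) : (gram L x t)ᵀ = gram L x t := by
  rw [gram, transpose_sum]
  refine Finset.sum_congr rfl fun s _ => ?_
  rw [transpose_smul, transpose_vecMulVec]

theorem gram_quad_nonneg (L : ℝ) (x : ℕ → Fin d → ℝ) (t : ℕ) (u : Fin d → ℝ) :
    0 ≤ u ⬝ᵥ (gram L x t *ᵥ u) := by
  rw [quad_gram]
  exact Finset.sum_nonneg fun s _ => by positivity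

theorem gram_quad_le {L : ℝ} (hL : 0 < L) {x : ℕ → Fin d → ℝ} {t : ℕ}
    (hx : ∀ s < t, x s ⬝ᵥ x s ≤ L ^ 2) (u : Fin d → ℝ) :
    u ⬝ᵥ (gram L x t *ᵥ u) ≤ t / 2 * (u ⬝ᵥ u) := by
  rw [quad_gram]
  have : (t : ℝ) / 2 * (u ⬝ᵥ u) = ∑ _s ∈ Finset.range t, (u ⬝ᵥ u) / 2 := by simp; ring
  rw [this]
  refine Finset.sum_le_sum fun s hs => ?_
  have h1 := (dotProduct_sq_le u (x s)).trans
    (mul_le_mul_of_nonneg_left (hx s (Finset.mem_range.mp hs)) (dotProduct_self_nonneg_real u))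
  rw [div_le_div_iff₀ (by positivity) (by norm_num)]
  linarith

theorem estMat_transpose (P : Params d m) (z : ℕ → Report d m) (t : ℕ) :
    (estMat P z t)ᵀ = estMat P z t := by
  rw [estMat, transpose_add, transpose_smul, transpose_one]
  congr 1
  ext i j
  simp only [transpose_apply, Matrix.of_apply]
  exact Finset.sum_congr rfl fun s _ => debiasedMat_comm _ _ _ _

theorem estMat_eq (P : Params d m) (x : ℕ → Fin d → ℝ) (z : ℕ → Report d m) (t : ℕ) :
    estMat P z t = gram P.L x t + (noiseMat P.p P.L x z t +
      (2 * P.reg t - P.lam) • (1 : Matrix (Fin d) (Fin d) ℝ)) := by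
  rw [estMat, ← add_assoc]
  congr 1
  ext i j
  simp only [gram, noiseMat, Matrix.add_apply, Matrix.sum_apply, Matrix.of_apply,
    Matrix.smul_apply, vecMulVec_apply, smul_eq_mul]
  rw [← Finset.sum_add_distrib]
  exact Finset.sum_congr rfl fun s _ => by ring

theorem estVec_eq (P : Params d m) (hL : P.L ≠ 0) (θ : Fin d → ℝ) (x : ℕ → Fin d → ℝ) (r : ℕ → ℝ)
    (z : ℕ → Report d m) (t : ℕ) :
    (1 / P.L) • estVec P z t = gram P.L x t *ᵥ θ +
      (1 / P.L) • (rewardNoise P.L θ x r t + noiseVec P.p P.L x r z t) := by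
  ext i
  have h1 : (gram P.L x t *ᵥ θ) i =
      ∑ s ∈ Finset.range t, (x s ⬝ᵥ θ) * x s i / (2 * P.L ^ 2) := by
    rw [gram, sum_mulVec, Finset.sum_apply]
    refine Finset.sum_congr rfl fun s _ => ?_
    rw [smul_mulVec, vecMulVec_mulVec]
    simp only [Pi.smul_apply, smul_eq_mul, MulOpposite.smul_eq_mul_unop, MulOpposite.unop_op]
    ring
  simp only [Pi.add_apply, Pi.smul_apply, smul_eq_mul, h1, estVec, rewardNoise, noiseVec]
  rw [← Finset.sum_add_distrib, Finset.mul_sum, Finset.mul_sum, ← Finset.sum_add_distrib]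
  refine Finset.sum_congr rfl fun s _ => ?_
  field_simp
  ring

theorem abs_bilin_le_sqrt {n : Type*} [Fintype n] [DecidableEq n]
    {M : Matrix n n ℝ} (hM : Mᵀ = M)
    (h : ∀ u : n → ℝ, 0 ≤ u ⬝ᵥ (M *ᵥ u)) (a b : n → ℝ) :
    |a ⬝ᵥ (M *ᵥ b)| ≤ √(a ⬝ᵥ (M *ᵥ a)) * √(b ⬝ᵥ (M *ᵥ b)) := by
  rw [← Real.sqrt_mul (h a)]
  refine Real.abs_le_sqrt ?_
  have hs := dotProduct_mulVec_symm hM b a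
  have key : ∀ t : ℝ, 0 ≤ (a ⬝ᵥ (M *ᵥ a)) * (t * t) + 2 * (a ⬝ᵥ (M *ᵥ b)) * t +
      b ⬝ᵥ (M *ᵥ b) := by
    intro t
    have := h (t • a + b)
    simp only [mulVec_add, mulVec_smul, dotProduct_add, add_dotProduct, smul_dotProduct,
      dotProduct_smul, smul_eq_mul, hs] at this
    linarith
  have := discrim_le_zero key
  rw [discrim] at this
  nlinarith

/-- Only the second summand of `λ(t)` and the constant `λ` are kept; that summand is `4 √2` times
the scale of the privacy noise. -/
theorem reg_ge {P : Params d m} (hp : P.p < 1) {δ : ℝ} (hPδ : P.delta = δ) (hδ : 0 < δ)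
    {τ t : ℕ} (hτ : 1 ≤ τ) (ht : τ ≤ t) :
    4 * √2 * (√(t * Real.log (2 * τ / δ)) / ((1 - P.p) * √m)) + P.lam ≤ P.reg t := by
  have hp' : 0 < 1 - P.p := by linarith
  have hτ' : (0 : ℝ) < τ := by exact_mod_cast hτ
  have hle : √(t * Real.log (2 * τ / δ)) ≤ √(t * Real.log (2 * t / δ)) := by
    refine Real.sqrt_le_sqrt (mul_le_mul_of_nonneg_left ?_ (Nat.cast_nonneg t))
    refine Real.log_le_log (by positivity) ?_
    have : (τ : ℝ) ≤ t := by exact_mod_cast ht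
    gcongr
  have h8 : √(8 * t * Real.log (2 * t / δ)) = 2 * √2 * √(t * Real.log (2 * t / δ)) := by
    rw [mul_assoc, Real.sqrt_mul (by norm_num), show (8 : ℝ) = 2 ^ 2 * 2 by norm_num,
      Real.sqrt_mul (by norm_num), Real.sqrt_sq (by norm_num)]
  rw [Params.reg, hPδ, h8]
  have h1 : 0 ≤ 2 * √2 * √(t * Real.log (2 * t / δ)) / m := by positivity
  have h2 : 4 * √2 * (√(t * Real.log (2 * τ / δ)) / ((1 - P.p) * √m)) ≤
      2 * (2 * √2 * √(t * Real.log (2 * t / δ))) / ((1 - P.p) * √m) := by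
    calc _ ≤ 4 * √2 * (√(t * Real.log (2 * t / δ)) / ((1 - P.p) * √m)) := by gcongr
      _ = _ := by ring
  linarith

/-- The matrix noise is at most `3 / 8 Λ`, so `M` lies between `(2 - 1 / 40 - 3 / 8) Λ = 8 / 5 Λ`
and `19 / 8 Λ`. In units of `S √Λ` times the norm of `u` in `Ṽ`, the errors from `M θ`, from the
vector noise and from the reward noise are at most 1.542, 0.141 and 0.025; their sum is below 1.732,
hence below `√3`. The condition `s ≤ L S` is what allows the vector noise, divided by `L`, to be
measured in units of `S`. -/
theorem validAt_of_deviation {P : Params d m} (hL : 0 < P.L) {S s Λ : ℝ} (hS : 0 < S)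
    (hs : s ≤ P.L * S) (hs1 : s ≤ 1) {θ : Fin d → ℝ} (hθ : θ ⬝ᵥ θ ≤ S ^ 2)
    {x : ℕ → Fin d → ℝ} {r : ℕ → ℝ} {z : ℕ → Report d m} {t : ℕ} (hΛ : Λ = P.reg t)
    (hΛ1 : 1 ≤ Λ) (hlam0 : 0 < P.lam) (hlam : 40 * P.lam ≤ Λ) {w : ℝ} (hw0 : 0 ≤ w)
    (hw : 4 * √2 * w ≤ Λ)
    (hN : ∀ u, |u ⬝ᵥ (noiseMat P.p P.L x z t *ᵥ u)| ≤ 3 * √2 / 2 * s * w * (u ⬝ᵥ u))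
    (hE : ∀ u, |u ⬝ᵥ noiseVec P.p P.L x r z t| ≤ s * w * √(u ⬝ᵥ u))
    (hW : ∀ u, u ⬝ᵥ u = 1 → |u ⬝ᵥ rewardNoise P.L θ x r t| ≤
      P.L * S / 40 * (√Λ * √(u ⬝ᵥ (gram P.L x t *ᵥ u) + Λ))) :
    ValidAt P S θ x z t := by
  have h20 : 0 < √2 := by positivity
  have h22 : √2 * √2 = 2 := Real.mul_self_sqrt (by norm_num)
  have hΛ0 : 0 < Λ := by linarith
  set M := noiseMat P.p P.L x z t + (2 * P.reg t - P.lam) • (1 : Matrix (Fin d) (Fin d) ℝ) with hM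
  have hMt : Mᵀ = M := by
    rw [hM, transpose_add, transpose_smul, transpose_one, noiseMat_transpose]
  have hMq : ∀ u, u ⬝ᵥ (M *ᵥ u) = u ⬝ᵥ (noiseMat P.p P.L x z t *ᵥ u) +
      (2 * Λ - P.lam) * (u ⬝ᵥ u) := by
    intro u
    rw [hM, add_mulVec, smul_mulVec, one_mulVec, dotProduct_add, dotProduct_smul, smul_eq_mul, hΛ]
  have hN' : ∀ u, |u ⬝ᵥ (noiseMat P.p P.L x z t *ᵥ u)| ≤ 3 / 8 * Λ * (u ⬝ᵥ u) := by
    intro u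
    refine (hN u).trans (mul_le_mul_of_nonneg_right ?_ (dotProduct_self_nonneg_real u))
    have : 3 * √2 / 2 * s * w ≤ 3 * √2 / 2 * 1 * w := by gcongr
    linarith
  have hMlow : ∀ u, 8 / 5 * Λ * (u ⬝ᵥ u) ≤ u ⬝ᵥ (M *ᵥ u) := by
    intro u
    have h1 := (abs_le.mp (hN' u)).1
    have h2 := mul_le_mul_of_nonneg_right hlam (dotProduct_self_nonneg_real u)
    rw [hMq]
    linarith
  have hMup : ∀ u, u ⬝ᵥ (M *ᵥ u) ≤ 19 / 8 * Λ * (u ⬝ᵥ u) := by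
    intro u
    have h1 := (abs_le.mp (hN' u)).2
    have h2 := mul_nonneg hlam0.le (dotProduct_self_nonneg_real u)
    rw [hMq]
    linarith
  have hVq : ∀ u, u ⬝ᵥ (estMat P z t *ᵥ u) = u ⬝ᵥ (gram P.L x t *ᵥ u) + u ⬝ᵥ (M *ᵥ u) := by
    intro u
    rw [estMat_eq P x, add_mulVec, dotProduct_add]
  have hMnn : ∀ u, 0 ≤ u ⬝ᵥ (M *ᵥ u) := fun u =>
    (mul_nonneg (by positivity) (dotProduct_self_nonneg_real u)).trans (hMlow u)
  have hvec : (1 / P.L) • estVec P z t - estMat P z t *ᵥ θ =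
      (1 / P.L) • (rewardNoise P.L θ x r t + noiseVec P.p P.L x r z t) - M *ᵥ θ := by
    rw [estVec_eq P hL.ne' θ x r, estMat_eq P x, add_mulVec]
    abel
  have hunit : ∀ u, u ⬝ᵥ u = 1 → |u ⬝ᵥ ((1 / P.L) • estVec P z t - estMat P z t *ᵥ θ)| ≤
    S * √(3 * P.reg t) * √(u ⬝ᵥ (estMat P z t *ᵥ u)) := by
    intro u hu
    have h1 := hMlow u
    rw [hu, mul_one] at h1
    have hX := gram_quad_nonneg P.L x t u
    set X := u ⬝ᵥ (gram P.L x t *ᵥ u) with hXdef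
    set v := √(u ⬝ᵥ (estMat P z t *ᵥ u)) with hv
    set l := √Λ with hl
    have hl0 : 0 ≤ l := Real.sqrt_nonneg _
    have hll : l * l = Λ := Real.mul_self_sqrt hΛ0.le
    have hlv : √(8 / 5) * l ≤ v := by
      rw [hl, ← Real.sqrt_mul (by norm_num), hv, hVq]
      exact Real.sqrt_le_sqrt (by linarith)
    have hv0 : 0 ≤ v := Real.sqrt_nonneg _
    have hMθ : |u ⬝ᵥ (M *ᵥ θ)| ≤ √(19 / 8) * (S * l) * v := by
      refine (abs_bilin_le_sqrt hMt hMnn u θ).trans ?_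
      rw [mul_comm]
      refine mul_le_mul ?_ ?_ (Real.sqrt_nonneg _) (by positivity)
      · have : θ ⬝ᵥ (M *ᵥ θ) ≤ 19 / 8 * (S ^ 2 * Λ) := by
          refine (hMup θ).trans ?_
          have := mul_le_mul_of_nonneg_left hθ hΛ0.le
          linarith
        refine (Real.sqrt_le_sqrt this).trans (le_of_eq ?_)
        rw [Real.sqrt_mul (by norm_num), Real.sqrt_mul (by positivity), Real.sqrt_sq hS.le]
      · rw [hv, hVq]
        exact Real.sqrt_le_sqrt (by linarith)
    have hEu : |u ⬝ᵥ noiseVec P.p P.L x r z t| ≤ P.L * S * (√2 / 8) * (l * l) := by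
      have h2 := hE u
      rw [hu, Real.sqrt_one, mul_one] at h2
      refine h2.trans ?_
      rw [hll]
      have h3 : w ≤ √2 / 8 * Λ := by
        have : √2 / 8 * (4 * √2 * w) ≤ √2 / 8 * Λ := mul_le_mul_of_nonneg_left hw (by positivity)
        have e : √2 / 8 * (4 * √2 * w) = (√2 * √2) / 2 * w := by ring
        rw [e, h22] at this
        linarith
      calc s * w ≤ P.L * S * (√2 / 8 * Λ) := mul_le_mul hs h3 hw0 (by positivity)
        _ = _ := by ring
    have hWu : |u ⬝ᵥ rewardNoise P.L θ x r t| ≤ P.L * S / 40 * (l * v) := by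
      refine (hW u hu).trans ?_
      have : √(X + Λ) ≤ v := by
        rw [hv, hVq]
        exact Real.sqrt_le_sqrt (by linarith)
      gcongr
    have h4 : u ⬝ᵥ ((1 / P.L) • estVec P z t - estMat P z t *ᵥ θ) =
        (u ⬝ᵥ rewardNoise P.L θ x r t) / P.L + (u ⬝ᵥ noiseVec P.p P.L x r z t) / P.L -
          u ⬝ᵥ (M *ᵥ θ) := by
      rw [hvec, dotProduct_sub, dotProduct_smul, dotProduct_add, smul_eq_mul]
      ring
    have h5 : |(u ⬝ᵥ rewardNoise P.L θ x r t) / P.L| ≤ S / 40 * (l * v) := by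
      rw [abs_div, abs_of_pos hL, div_le_iff₀ hL]
      refine hWu.trans (le_of_eq ?_); ring
    have h6 : |(u ⬝ᵥ noiseVec P.p P.L x r z t) / P.L| ≤ S * (√2 / 8) * (l * l) := by
      rw [abs_div, abs_of_pos hL, div_le_iff₀ hL]
      refine hEu.trans (le_of_eq ?_); ring
    have h7 : √2 / 8 * (l * l) ≤ 141 / 1000 * (l * v) := by
      have h8 : √2 ≤ 1415 / 1000 := Real.sqrt_le_iff.mpr ⟨by norm_num, by norm_num⟩
      have h9 : 1264 / 1000 ≤ √(8 / 5) := Real.le_sqrt_of_sq_le (by norm_num)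
      have h10 : 1264 / 1000 * l ≤ v := (mul_le_mul_of_nonneg_right h9 hl0).trans hlv
      have h11 := mul_le_mul_of_nonneg_left h10 hl0
      have h12 := mul_le_mul_of_nonneg_right h8 (mul_nonneg hl0 hl0)
      linarith [mul_nonneg hl0 hl0]
    have h13 : √(19 / 8) ≤ 1542 / 1000 := Real.sqrt_le_iff.mpr ⟨by norm_num, by norm_num⟩
    have h14 : 1732 / 1000 ≤ √3 := Real.le_sqrt_of_sq_le (by norm_num)
    have hlv0 : 0 ≤ S * (l * v) := by positivity
    rw [h4]
    calc |(u ⬝ᵥ rewardNoise P.L θ x r t) / P.L + (u ⬝ᵥ noiseVec P.p P.L x r z t) / P.L -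
          u ⬝ᵥ (M *ᵥ θ)| ≤ S / 40 * (l * v) + S * (√2 / 8) * (l * l) + √(19 / 8) * (S * l) * v := by
          refine (abs_sub _ _).trans (add_le_add ((abs_add_le _ _).trans (add_le_add h5 h6)) hMθ)
      _ ≤ √3 * (S * (l * v)) := by
          have h15 := mul_le_mul_of_nonneg_left h7 hS.le
          have h16 := mul_le_mul_of_nonneg_right h13 hlv0
          have h17 := mul_le_mul_of_nonneg_right h14 hlv0
          linarith
      _ = _ := by
          rw [← hΛ, Real.sqrt_mul (by norm_num)]; ring
  refine ⟨hΛ ▸ hΛ1, fun u => ?_, fun u => ?_, fun u => ?_⟩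
  · rw [hVq, ← hΛ]
    have := hMlow u
    linarith
  · rw [hVq, ← hΛ]
    have := hMup u
    linarith
  · rcases (dotProduct_self_nonneg_real u).eq_or_lt with h0 | h0
    · have : u = 0 := dotProduct_self_eq_zero.mp h0.symm
      simp [this]
    · set k := √(u ⬝ᵥ u) with hk
      have hk0 : 0 < k := Real.sqrt_pos.mpr h0
      have hkk : k * k = u ⬝ᵥ u := Real.mul_self_sqrt h0.le
      have h1 := hunit (k⁻¹ • u) (by
        rw [smul_dotProduct, dotProduct_smul, ← hkk]
        simp only [smul_eq_mul]; field_simp)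
      rw [mulVec_smul, smul_dotProduct, smul_dotProduct, dotProduct_smul] at h1
      simp only [smul_eq_mul] at h1
      have e : √(k⁻¹ * (k⁻¹ * (u ⬝ᵥ (estMat P z t *ᵥ u)))) =
          k⁻¹ * √(u ⬝ᵥ (estMat P z t *ᵥ u)) := by
        rw [← mul_assoc, Real.sqrt_mul (by positivity), Real.sqrt_mul_self (by positivity)]
      rw [abs_mul, abs_of_pos (inv_pos.mpr hk0), e] at h1
      refine le_of_mul_le_mul_left ?_ (inv_pos.mpr hk0)
      refine h1.trans (le_of_eq ?_)
      ring

end Validity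


/-! ### The good event -/

section GoodEvent

/-- The series is geometric with ratio `2 ^ (-c)`, hence controlled by its first term. The
hypothesis is `D / (1 - 2 ^ (-c)) * (δ / 2 ^ k₀) ^ c ≤ δ` solved for `2 ^ k₀`; an exponent `c < 1`
costs a negative power of `δ`. -/
theorem sum_dyadic_le {δ c D : ℝ} (hδ : 0 < δ) (hc : 0 < c) (hD : 0 ≤ D) {k₀ n : ℕ}
    (h : (D / (1 - (2 : ℝ) ^ (-c))) ^ (1 / c) * δ ^ (-(1 / c - 1)) ≤ 2 ^ k₀) :
    ∑ k ∈ Finset.Ico k₀ n, D * (δ / (2 * (2 : ℝ) ^ k)) ^ c ≤ δ := by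
  set ρ : ℝ := (2 : ℝ) ^ (-c) with hρ
  have hρ0 : 0 < ρ := by positivity
  have hρ1 : ρ < 1 := Real.rpow_lt_one_of_one_lt_of_neg (by norm_num) (by linarith)
  set B := D / (1 - ρ) with hB
  have hB0 : 0 ≤ B := div_nonneg hD (by linarith)
  have hterm : ∀ k : ℕ, D * (δ / (2 * (2 : ℝ) ^ k)) ^ c = D * (δ / 2) ^ c * ρ ^ k := by
    intro k
    have e1 : δ / (2 * (2 : ℝ) ^ k) = δ / 2 * ((2 : ℝ) ^ k)⁻¹ := by field_simp
    rw [e1, Real.mul_rpow (by positivity) (by positivity), mul_assoc]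
    congr 2
    rw [Real.inv_rpow (by positivity), ← Real.rpow_natCast, ← Real.rpow_mul (by norm_num),
      hρ, ← Real.rpow_natCast, ← Real.rpow_mul (by norm_num), ← Real.rpow_neg (by norm_num)]
    congr 1; ring
  simp_rw [hterm]
  rw [← Finset.mul_sum]
  have hg := geom_sum_Ico_le_of_lt_one (m := k₀) (n := n) hρ0.le hρ1
  have h1 : D * (δ / 2) ^ c * ∑ i ∈ Finset.Ico k₀ n, ρ ^ i ≤ D * (δ / 2) ^ c * (ρ ^ k₀ / (1 - ρ)) :=
    mul_le_mul_of_nonneg_left hg (by positivity)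
  refine h1.trans ?_
  have h2 : B * (δ / 2 ^ k₀) ^ c ≤ δ := by
    have hpow : (B ^ (1 / c) * δ ^ (-(1 / c - 1))) ^ c ≤ ((2 : ℝ) ^ k₀) ^ c :=
      Real.rpow_le_rpow (by positivity) h hc.le
    rw [Real.mul_rpow (by positivity) (by positivity), ← Real.rpow_mul hB0,
      ← Real.rpow_mul hδ.le, one_div_mul_cancel hc.ne', Real.rpow_one] at hpow
    have e2 : -(1 / c - 1) * c = c - 1 := by field_simp; ring
    rw [e2, Real.rpow_sub hδ, Real.rpow_one] at hpow
    have hpc : 0 < ((2 : ℝ) ^ k₀) ^ c := by positivity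
    rw [Real.div_rpow hδ.le (by positivity), ← mul_div_assoc, div_le_iff₀ hpc]
    have h3 := mul_le_mul_of_nonneg_left hpow hδ.le
    calc B * δ ^ c = δ * (B * (δ ^ c / δ)) := by field_simp
      _ ≤ _ := h3
  refine le_trans (le_of_eq_of_le ?_ (mul_le_mul_of_nonneg_left
    (Real.rpow_le_rpow (by positivity) (by linarith : δ / 2 ≤ δ) hc.le)
    (by positivity : 0 ≤ D * (ρ ^ k₀ / (1 - ρ))))) (le_trans (le_of_eq ?_) h2)
  · ring
  · rw [Real.div_rpow hδ.le (by positivity), hB]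
    have : ρ ^ k₀ = (((2 : ℝ) ^ k₀) ^ c)⁻¹ := by
      rw [← Real.rpow_natCast, ← Real.rpow_natCast, hρ, ← Real.rpow_mul (by norm_num),
        ← Real.rpow_mul (by norm_num), ← Real.rpow_neg (by norm_num)]
      congr 1; ring
    rw [this]
    ring

variable {Ω : Type*} [mΩ : MeasurableSpace Ω] {μ : Measure Ω} [IsProbabilityMeasure μ] {d m : ℕ}
  {P : Params d m} {K : ℕ} {θstar : EuclideanSpace ℝ (Fin d)}

/-- The number of net points times the number of deviation events. -/
noncomputable def netConst (d : ℕ) : ℝ := 4 * (8 * d + 1) ^ d + 2 * (d + 1) ^ d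

/-- The multiple of `log (2 T / δ)` that the fourth root of the time has to exceed for the
statistics to be accurate. -/
noncomputable def rootConst (d m : ℕ) (γ lam : ℝ) : ℝ :=
  2 * m / γ * (γ / (4 * m) + (d + 1) * m / γ + 80 * γ + 2) + 2 * (40 * m * lam + m)

theorem half_le_log {T : ℕ} {δ : ℝ} (hδ : 0 < δ) (hδ1 : δ < 1) (hT : 1 ≤ T) :
    1 / 2 ≤ Real.log (2 * T / δ) := by
  have hT' : (1 : ℝ) ≤ T := by exact_mod_cast hT
  have h1 : (2 : ℝ) ≤ 2 * T / δ := by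
    rw [le_div_iff₀ hδ]; nlinarith only [hT', hδ1]
  have h2 := Real.log_le_log (by norm_num) h1
  have h3 := Real.log_two_gt_d9
  linarith

set_option maxHeartbeats 1000000 in
-- The part of the reward bound proportional to `X` is handled by `X ≤ τ`: then `τ ^ (-1 / 4) X ≤ τ
-- ^ (1 / 4) √X`, which `√Λ √(X + Λ)` dominates since `Λ ≥ √τ / m`. The rest is at most `τ ^ (1 /
-- 4)` times a multiple of the logarithm, and `hroot` makes this small compared with `√τ / m`. Only
-- lower bounds for `Λ` that are free of `p` enter, so the threshold does not depend on `ε₀`.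
theorem Run.validAt_of_scale (R : Run μ P K θstar) (hm : 0 < m) (hL : 0 < P.L)
    (hp : P.p < 1) {S δ s : ℝ} (hS : 0 < S) (hθ : ‖θstar‖ ≤ S) (hPδ : P.delta = δ) (hδ : 0 < δ)
    (hδ1 : δ < 1) (hp0 : 0 ≤ P.p)
    (hs1 : s ≤ 1) (hsL : s ≤ P.L * S) (hlam : 0 < P.lam) {ω : Ω} {τ t : ℕ}
    (hτ : 1 ≤ τ) (hτt : τ ≤ t) (htτ : t ≤ 2 * τ) (htT : t ≤ P.T)
    (hroot : rootConst d m (P.L * S / 40) P.lam * Real.log (2 * P.T / δ) ≤ √√τ)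
    (hN : ∀ u, |u ⬝ᵥ (noiseMat P.p P.L (R.feature ω) (fun s => R.report s ω) t *ᵥ u)| ≤
          3 * √2 / 2 * s * (√(t * Real.log (2 * τ / δ)) / ((1 - P.p) * √m)) * (u ⬝ᵥ u))
    (hE : ∀ u, |u ⬝ᵥ noiseVec P.p P.L (R.feature ω) (fun s => R.reward s ω)
            (fun s => R.report s ω) t| ≤
          s * (√(t * Real.log (2 * τ / δ)) / ((1 - P.p) * √m)) * √(u ⬝ᵥ u))
    (hW : ∀ u, u ⬝ᵥ u = 1 →
          |u ⬝ᵥ rewardNoise P.L θstar.ofLp (R.feature ω) (fun s => R.reward s ω) t| ≤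
            P.L * S / 40 / m / √√τ * (u ⬝ᵥ (gram P.L (R.feature ω) t *ᵥ u) + 1) / 8 +
              (d + 1) * Real.log (2 * τ / δ) * √√τ / (P.L * S / 40 / m) + (1 + P.L * S)) :
    ValidAt P S θstar.ofLp (R.feature ω) (fun s => R.report s ω) t := by
  have hτ1 : (1 : ℝ) ≤ τ := by exact_mod_cast hτ
  have hτ0 : (0 : ℝ) < τ := by linarith
  have hτt' : (τ : ℝ) ≤ t := by exact_mod_cast hτt
  have htτ' : (t : ℝ) ≤ 2 * τ := by exact_mod_cast htτ
  have hT : (t : ℝ) ≤ P.T := by exact_mod_cast htT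
  have hm1 : (1 : ℝ) ≤ m := by exact_mod_cast hm
  have hm0 : (0 : ℝ) < m := by linarith
  have hp' : 0 < 1 - P.p := by linarith
  set γ := P.L * S / 40 with hγ
  have hγ0 : 0 < γ := by positivity
  set ℓ := Real.log (2 * P.T / δ) with hℓ
  have hℓh : 1 / 2 ≤ ℓ := half_le_log hδ hδ1 (by omega)
  set ℒ := Real.log (2 * τ / δ) with hℒ
  have hℒh : 1 / 2 ≤ ℒ := half_le_log hδ hδ1 hτ
  have hℒℓ : ℒ ≤ ℓ := by
    refine Real.log_le_log (by positivity) ?_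
    have : (τ : ℝ) ≤ P.T := by linarith
    gcongr
  set q := √√τ with hq
  have hqq : q * q = √τ := Real.mul_self_sqrt (Real.sqrt_nonneg _)
  have hq4 : q * q * (q * q) = τ := by rw [hqq]; exact Real.mul_self_sqrt hτ0.le
  have hq0 : 0 < q := by positivity
  set Λ := P.reg t with hΛ
  set w := √(t * ℒ) / ((1 - P.p) * √m) with hw
  have hw0 : 0 ≤ w := by positivity
  have hreg := reg_ge (m := m) hp hPδ hδ hτ hτt
  rw [← hℒ, ← hw, ← hΛ] at hreg
  have hwq : q * q / m ≤ 4 * √2 * w := by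
    have h1 : √τ * (1 / 2) ≤ √(t * ℒ) := by
      refine Real.le_sqrt_of_sq_le ?_
      rw [mul_pow, Real.sq_sqrt hτ0.le]
      have := mul_le_mul hτt' hℒh (by norm_num) (by linarith : (0 : ℝ) ≤ t)
      linarith
    have h2 : (1 - P.p) * √m ≤ m := by
      have h3 : √(m : ℝ) ≤ m := by
        rw [Real.sqrt_le_left hm0.le]; nlinarith only [hm1]
      nlinarith only [h3, hp0, Real.sqrt_nonneg (m : ℝ)]
    have h4 : √τ * (1 / 2) / m ≤ w := by
      rw [hw]
      exact div_le_div₀ (Real.sqrt_nonneg _) h1 (by positivity) h2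
    have h5 : 1 ≤ √2 := Real.one_le_sqrt.mpr (by norm_num)
    rw [hqq]
    have h6 : 4 * 1 * (√τ * (1 / 2) / m) ≤ 4 * √2 * w := by gcongr
    have h7 : 0 ≤ √τ / m := by positivity
    have h8 : 4 * 1 * (√τ * (1 / 2) / m) = 2 * (√τ / m) := by ring
    linarith
  have hqΛ : q * q / m ≤ Λ := by linarith
  have hrootsplit : rootConst d m γ P.lam * ℓ =
      2 * m / γ * (γ / (4 * m) * ℓ + (d + 1) * m / γ * ℓ + (80 * γ + 2) * ℓ) +
        2 * ℓ * (40 * m * P.lam) + 2 * ℓ * m := by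
    rw [rootConst]; ring
  have hℓ1 : 1 ≤ 2 * ℓ := by linarith
  have hA0 : 0 ≤ 2 * m / γ * (γ / (4 * m) * ℓ + (d + 1) * m / γ * ℓ + (80 * γ + 2) * ℓ) := by
    positivity
  have hB0 : 40 * m * P.lam ≤ 2 * ℓ * (40 * m * P.lam) :=
    le_mul_of_one_le_left (by positivity) hℓ1
  have hC0 : (m : ℝ) ≤ 2 * ℓ * m := le_mul_of_one_le_left hm0.le hℓ1
  rw [hrootsplit] at hroot
  have hqm : (m : ℝ) ≤ q := by
    have : 0 ≤ 2 * ℓ * (40 * m * P.lam) := by positivity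
    linarith
  have hq1 : 1 ≤ q := hm1.trans hqm
  have hqlam : 40 * m * P.lam ≤ q := by linarith
  have hqA : 2 * m / γ * (γ / (4 * m) * ℓ + (d + 1) * m / γ * ℓ + (80 * γ + 2) * ℓ) ≤ q := by
    have : 0 ≤ 2 * ℓ * (40 * m * P.lam) := by positivity
    linarith
  have hΛ1 : 1 ≤ Λ := by
    refine le_trans ?_ hqΛ
    rw [le_div_iff₀ hm0]; nlinarith only [hqm, hq1, hm1]
  have hlamΛ : 40 * P.lam ≤ Λ := by
    refine le_trans ?_ hqΛ
    rw [le_div_iff₀ hm0]; nlinarith only [hqlam, hq1]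
  have hxL : ∀ s < t, R.feature ω s ⬝ᵥ R.feature ω s ≤ P.L ^ 2 := fun s hs' =>
    R.feature_dot_self_le (by omega) ω
  have hθ2 : θstar.ofLp ⬝ᵥ θstar.ofLp ≤ S ^ 2 := by
    have h2 := EuclideanSpace.real_norm_sq_eq θstar
    have h3 : θstar.ofLp ⬝ᵥ θstar.ofLp = ‖θstar‖ ^ 2 := by
      rw [h2]; simp [dotProduct, sq]
    rw [h3]
    exact pow_le_pow_left₀ (norm_nonneg _) hθ 2
  refine validAt_of_deviation hL hS hsL hs1 hθ2 hΛ hΛ1 hlam hlamΛ hw0 (by linarith) hN hE ?_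
  intro u hu
  refine (hW u hu).trans ?_
  have hX := gram_quad_nonneg P.L (R.feature ω) t u
  have hX2 := gram_quad_le hL hxL u
  rw [hu, mul_one] at hX2
  set X := u ⬝ᵥ (gram P.L (R.feature ω) t *ᵥ u) with hXdef
  set l := √Λ with hl
  have hl0 : 0 ≤ l := Real.sqrt_nonneg _
  have hll : l * l = Λ := Real.mul_self_sqrt (by linarith)
  set v := √(X + Λ) with hv
  have hlv : l ≤ v := Real.sqrt_le_sqrt (by linarith)
  have hXv : √X ≤ v := Real.sqrt_le_sqrt (by linarith)
  have hv0 : 0 ≤ v := Real.sqrt_nonneg _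
  have hterm1 : γ / m / q * X / 8 ≤ γ / 2 * (l * v) := by
    have h1 : √X ≤ q * q := by
      rw [hqq]; exact Real.sqrt_le_sqrt (by linarith)
    have h2 : X ≤ (q * q) * v := by
      calc X = √X * √X := (Real.mul_self_sqrt hX).symm
        _ ≤ (q * q) * v := mul_le_mul h1 hXv (Real.sqrt_nonneg _) (by positivity)
    have h3 : q / m ≤ l := by
      refine Real.le_sqrt_of_sq_le (le_trans ?_ hqΛ)
      rw [div_pow, div_le_div_iff₀ (by positivity) hm0]
      nlinarith only [mul_nonneg (mul_pos hq0 hq0).le (mul_nonneg hm0.le (sub_nonneg.mpr hm1))]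
    calc γ / m / q * X / 8 ≤ γ / m / q * ((q * q) * v) / 8 := by gcongr
      _ = γ / 8 * (q / m * v) := by field_simp
      _ ≤ γ / 8 * (l * v) := by gcongr
      _ ≤ γ / 2 * (l * v) := by
          have : 0 ≤ γ * (l * v) := by positivity
          linarith
  have hrest : γ / m / q / 8 + (d + 1) * ℒ * q / (γ / m) + (1 + P.L * S) ≤ γ / 2 * (l * v) := by
    have h1 : γ / m / q / 8 ≤ q * (γ / (4 * m) * ℓ) := by
      calc γ / m / q / 8 = γ / (4 * m) * (1 / q) * (1 / 2) := by field_simp; norm_num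
        _ ≤ γ / (4 * m) * q * ℓ := by
            have : 1 / q ≤ q := by rw [div_le_iff₀ hq0]; nlinarith only [hq1]
            gcongr
        _ = _ := by ring
    have h2 : (d + 1) * ℒ * q / (γ / m) ≤ q * ((d + 1) * m / γ * ℓ) := by
      calc (d + 1) * ℒ * q / (γ / m) = q * ((d + 1) * m / γ * ℒ) := by field_simp
        _ ≤ _ := by gcongr
    have h3 : 1 + P.L * S ≤ q * ((80 * γ + 2) * ℓ) := by
      have e : 1 + P.L * S = 1 * ((80 * γ + 2) * (1 / 2)) := by rw [hγ]; ring
      rw [e]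
      gcongr
    have h4 : q * (γ / (4 * m) * ℓ + (d + 1) * m / γ * ℓ + (80 * γ + 2) * ℓ) ≤
        γ / 2 * (q * q / m) := by
      have := mul_le_mul_of_nonneg_left hqA (by positivity : 0 ≤ γ / (2 * m) * q)
      calc _ = γ / (2 * m) * q * (2 * m / γ *
            (γ / (4 * m) * ℓ + (d + 1) * m / γ * ℓ + (80 * γ + 2) * ℓ)) := by field_simp
        _ ≤ _ := this
        _ = _ := by field_simp
    have h5 : γ / 2 * (q * q / m) ≤ γ / 2 * (l * v) := by
      refine mul_le_mul_of_nonneg_left (hqΛ.trans ?_) (by positivity)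
      rw [← hll]
      exact mul_le_mul_of_nonneg_left hlv hl0
    linarith
  have e : γ / m / q * (X + 1) / 8 = γ / m / q * X / 8 + γ / m / q / 8 := by ring
  rw [e, ← hγ]
  have e2 : γ * (l * v) = γ / 2 * (l * v) + γ / 2 * (l * v) := by ring
  rw [e2]
  linarith only [hterm1, hrest]

theorem Run.exists_good_event (R : Run μ P K θstar) (hd : 0 < d) (hm : 0 < m) (hL : 0 < P.L)
    (hε : 0 < P.epsLocal) {S δ s : ℝ} (hS : 0 < S) (hθ : ‖θstar‖ ≤ S) (hPδ : P.delta = δ)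
    (hδ : 0 < δ) (hδ1 : δ < 1) (hs : 0 < s) (hs1 : s ≤ 1) (hsL : s ≤ P.L * S)
    (hlam : 0 < P.lam) {k₀ : ℕ}
    (hk₀ : (netConst d / (1 - (2 : ℝ) ^ (-s ^ 2))) ^ (1 / s ^ 2) * δ ^ (-(1 / s ^ 2 - 1)) ≤ 2 ^ k₀)
    (hroot : rootConst d m (P.L * S / 40) P.lam * Real.log (2 * P.T / δ) ≤ √√(2 ^ k₀)) :
    ∃ Bad : Set Ω, μ Bad ≤ ENNReal.ofReal δ ∧ ∀ ω ∉ Bad, ∀ t, 2 ^ k₀ ≤ t → t ≤ P.T →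
      ValidAt P S θstar.ofLp (R.feature ω) (fun s => R.report s ω) t := by
  have hm0 : (0 : ℝ) < m := by exact_mod_cast hm
  choose Bad hBad hgood using fun k : ℕ => R.exists_scale_event hd hm hL hε hθ hδ hδ1 hs hs1
    (by positivity : 0 < P.L * S / 40 / m) (Nat.one_le_two_pow : 1 ≤ 2 ^ k)
  refine ⟨⋃ k ∈ Finset.Ico k₀ (P.T + 1), Bad k, ?_, ?_⟩
  · have hD : 0 ≤ netConst d := by unfold netConst; positivity
    have hnn : ∀ k ∈ Finset.Ico k₀ (P.T + 1),
        0 ≤ netConst d * (δ / (2 * (2 : ℝ) ^ k)) ^ (s ^ 2) := fun k _ => by positivity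
    calc μ (⋃ k ∈ Finset.Ico k₀ (P.T + 1), Bad k)
        ≤ ∑ k ∈ Finset.Ico k₀ (P.T + 1), μ (Bad k) := measure_biUnion_finset_le _ _
      _ ≤ ∑ k ∈ Finset.Ico k₀ (P.T + 1),
          ENNReal.ofReal (netConst d * (δ / (2 * (2 : ℝ) ^ k)) ^ (s ^ 2)) := by
          refine Finset.sum_le_sum fun k _ => ?_
          have := hBad k
          push_cast at this
          exact this
      _ = ENNReal.ofReal (∑ k ∈ Finset.Ico k₀ (P.T + 1),
          netConst d * (δ / (2 * (2 : ℝ) ^ k)) ^ (s ^ 2)) :=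
          (ENNReal.ofReal_sum_of_nonneg hnn).symm
      _ ≤ ENNReal.ofReal δ := ENNReal.ofReal_le_ofReal (sum_dyadic_le hδ (by positivity) hD hk₀)
  · intro ω hω t ht htT
    have ht0 : t ≠ 0 := by have := Nat.one_le_two_pow (n := k₀); omega
    set k := Nat.log 2 t with hk
    have h1 : 2 ^ k ≤ t := Nat.pow_log_le_self 2 ht0
    have h2 : t < 2 ^ (k + 1) := Nat.lt_pow_succ_log_self (by norm_num) t
    have hk0 : k₀ ≤ k := Nat.le_log_of_pow_le (by norm_num) ht
    have hkT : k < P.T + 1 := by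
      have : k < 2 ^ k := Nat.lt_two_pow_self
      omega
    have hω' : ω ∉ Bad k := fun h => hω (Set.mem_biUnion (by simp [hk0, hkT] : k ∈ _) h)
    obtain ⟨h3, h4, h5⟩ := hgood k ω hω' t h1 (by rw [pow_succ] at h2; omega) htT
    refine R.validAt_of_scale hm hL (flipProb_lt_one hd hm hε) hS hθ hPδ hδ hδ1
      (flipProb_pos _ _ _).le hs1 hsL hlam
      (Nat.one_le_two_pow : 1 ≤ 2 ^ k) h1 (by rw [pow_succ] at h2; omega) htT ?_ h3 h4 h5
    refine hroot.trans (Real.sqrt_le_sqrt (Real.sqrt_le_sqrt ?_))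
    push_cast
    exact pow_le_pow_right₀ (by norm_num) hk0

end GoodEvent


/-! ### The state of the algorithm -/

section StateInvariants

variable {d m : ℕ}

theorem Params.reg_zero (P : Params d m) : P.reg 0 = P.lam := by
  simp [Params.reg]

/-- The permutation of the shuffler disappears in the sum, so the statistics depend only on which
reports have arrived. -/
theorem sum_perm_batch {d m : ℕ} (ρ : ℕ → Report d m) (l k : ℕ) (π : Equiv.Perm (Fin l))
    (g : Report d m → ℝ) (a b : ℝ) :
    (∑ n : Fin l, g (ρ (k * l + (π n : ℕ)))) / a - l / b =
      ∑ s ∈ Finset.Ico (k * l) ((k + 1) * l), (g (ρ s) / a - 1 / b) := by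
  rw [Equiv.sum_comp π fun n : Fin l => g (ρ (k * l + (n : ℕ))), Finset.sum_Ico_eq_sum_range,
    show (k + 1) * l - k * l = l by rw [add_one_mul]; omega, Finset.sum_sub_distrib,
    ← Finset.sum_div, Finset.sum_range fun n => g (ρ (k * l + n))]
  simp [div_eq_mul_inv]

/-- The model of the state `s`, which is reached after `k` shuffler batches, is the one formed after
`j` of them, and the later batches did not trigger an update. -/
structure StateInvariant (P : Params d m) (z : ℕ → Report d m) (k : ℕ) (s : State d) : Prop where
  t_le : s.t ≤ k * P.batchLength
  V_eq : s.V = estMat P z s.t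
  B_eq : s.B = estVec P z s.t
  θ_eq : s.θ = WithLp.toLp 2 ((1 / P.L) • (s.V⁻¹ *ᵥ s.B))
  dV_eq : ∀ i j, s.dV i j = ∑ r ∈ Finset.Ico s.t (k * P.batchLength), debiasedMat P.p (z r) i j
  dB_eq : ∀ i, s.dB i = ∑ r ∈ Finset.Ico s.t (k * P.batchLength), debiasedVec P.p (z r) i
  det_lt : s.t = k * P.batchLength ∨
    (estMat P z (k * P.batchLength)).det < (1 + P.eta) * s.V.det

/-- The increments `2 (λ(t) - λ(t_j))` telescope. As `Ṽ_0 = λ I` and `λ(0) = λ`, the total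
regularization at any update time is `2 λ(t) - λ`, whatever the earlier updates were. -/
theorem stateInvariant_stateAfter (P : Params d m) (z : ℕ → Report d m)
    (π : ℕ → Equiv.Perm (Fin P.batchLength)) (k : ℕ) :
    StateInvariant P z k (stateAfter P z π k) := by
  induction k with
  | zero =>
    refine ⟨by simp [stateAfter, State.init], ?_, ?_, ?_, ?_, ?_, ?_⟩
    · ext i j
      simp [stateAfter, State.init, estMat, Params.reg_zero, two_mul]
    · ext i
      simp [stateAfter, State.init, estVec]
    · simp [stateAfter, State.init]
    · simp [stateAfter, State.init]
    · simp [stateAfter, State.init]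
    · left; simp [stateAfter, State.init]
  | succ k ih =>
    set s := stateAfter P z π k with hs
    have hle : k * P.batchLength ≤ (k + 1) * P.batchLength := Nat.mul_le_mul_right _ (by omega)
    have hdV : ∀ i j, s.dV i j + aggU P z π k i j / (m * (1 - P.p)) -
        P.batchLength / (2 * (1 - P.p)) =
        ∑ r ∈ Finset.Ico s.t ((k + 1) * P.batchLength), debiasedMat P.p (z r) i j := by
      intro i j
      rw [ih.dV_eq, add_sub_assoc, aggU, sum_perm_batch z P.batchLength k (π k)
        (fun ρ => ∑ q, ((ρ.w i j q).toNat : ℝ)), ← Finset.sum_Ico_consecutive _ ih.t_le hle]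
      rfl
    have hdB : ∀ i, s.dB i + aggZ P z π k i / (m * (1 - P.p)) -
        P.batchLength / (2 * (1 - P.p)) =
        ∑ r ∈ Finset.Ico s.t ((k + 1) * P.batchLength), debiasedVec P.p (z r) i := by
      intro i
      rw [ih.dB_eq, add_sub_assoc, aggZ, sum_perm_batch z P.batchLength k (π k)
        (fun ρ => ∑ q, ((ρ.b i q).toNat : ℝ)), ← Finset.sum_Ico_consecutive _ ih.t_le hle]
      rfl
    have hV : s.V + Matrix.of (fun i j => s.dV i j + aggU P z π k i j / (m * (1 - P.p)) -
        P.batchLength / (2 * (1 - P.p))) +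
        (2 * (P.reg ((k + 1) * P.batchLength) - P.reg s.t)) • (1 : Matrix (Fin d) (Fin d) ℝ) =
        estMat P z ((k + 1) * P.batchLength) := by
      ext i j
      rw [ih.V_eq]
      simp only [estMat, Matrix.add_apply, Matrix.of_apply, hdV, Matrix.smul_apply, smul_eq_mul,
        ← Finset.sum_range_add_sum_Ico _ (ih.t_le.trans hle)]
      ring
    have hB : (s.B + fun i => s.dB i + aggZ P z π k i / (m * (1 - P.p)) -
        P.batchLength / (2 * (1 - P.p))) = estVec P z ((k + 1) * P.batchLength) := by
      ext i
      rw [ih.B_eq]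
      simp only [estVec, Pi.add_apply, hdB, ← Finset.sum_range_add_sum_Ico _ (ih.t_le.trans hle)]
    rw [stateAfter, ← hs, State.step]
    simp only [hV, hB]
    split_ifs with h
    · exact ⟨le_rfl, rfl, rfl, rfl, by simp, by simp, Or.inl rfl⟩
    · exact ⟨ih.t_le.trans hle, ih.V_eq, ih.B_eq, ih.θ_eq, fun i j => by simp [hdV],
        fun i => by simp [hdB], Or.inr (not_le.mp h)⟩

end StateInvariants

/-! ### Growth of the design matrices -/

section Growth

variable {d m : ℕ}

theorem quad_one (c : ℝ) (u : Fin d → ℝ) :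
    u ⬝ᵥ ((c • (1 : Matrix (Fin d) (Fin d) ℝ)) *ᵥ u) = c * (u ⬝ᵥ u) := by
  rw [smul_mulVec, one_mulVec, dotProduct_smul, smul_eq_mul]

theorem posDef_smul_one {c : ℝ} (hc : 0 < c) : (c • (1 : Matrix (Fin d) (Fin d) ℝ)).PosDef :=
  posDef_of_quad_ge (by rw [transpose_smul, transpose_one]) hc fun u => (quad_one c u).ge

theorem gram_quad_mono (L : ℝ) (x : ℕ → Fin d → ℝ) {s t : ℕ} (hst : s ≤ t) (u : Fin d → ℝ) :
    u ⬝ᵥ (gram L x s *ᵥ u) ≤ u ⬝ᵥ (gram L x t *ᵥ u) := by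
  rw [quad_gram, quad_gram]
  exact Finset.sum_le_sum_of_subset_of_nonneg (by simpa using hst) fun i _ _ => by positivity

theorem Params.reg_mono {P : Params d m} (hp : P.p < 1) (hδ : 0 < P.delta) (hδ1 : P.delta < 1)
    {s t : ℕ} (hs : 1 ≤ s) (hst : s ≤ t) : P.reg s ≤ P.reg t := by
  have hs' : (1 : ℝ) ≤ s := by exact_mod_cast hs
  have hst' : (s : ℝ) ≤ t := by exact_mod_cast hst
  have h0 := half_le_log hδ hδ1 hs
  have hlog : Real.log (2 * s / P.delta) ≤ Real.log (2 * t / P.delta) :=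
    Real.log_le_log (by positivity) (by gcongr)
  have h : √(8 * s * Real.log (2 * s / P.delta)) ≤ √(8 * t * Real.log (2 * t / P.delta)) := by
    refine Real.sqrt_le_sqrt ?_
    have : 0 ≤ Real.log (2 * s / P.delta) := by linarith
    gcongr
  have hp' : 0 < 1 - P.p := by linarith
  unfold Params.reg
  gcongr

theorem ValidAt.posDef {P : Params d m} {S : ℝ} {θ : Fin d → ℝ} {x : ℕ → Fin d → ℝ}
    {z : ℕ → Report d m} {t : ℕ} (h : ValidAt P S θ x z t) : (estMat P z t).PosDef := by
  refine posDef_of_quad_ge (estMat_transpose P z t) (c := 1) one_pos fun u => ?_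
  have h1 := h.lower u
  have h2 := gram_quad_nonneg P.L x t u
  have h3 := mul_le_mul_of_nonneg_right h.one_le_reg (dotProduct_self_nonneg_real u)
  nlinarith only [h1, h2, h3, dotProduct_self_nonneg_real u]

theorem posDef_one_add_gram (L : ℝ) (x : ℕ → Fin d → ℝ) (t : ℕ) : (1 + gram L x t).PosDef := by
  refine posDef_of_quad_ge (by rw [transpose_add, transpose_one, gram_transpose]) one_pos fun u => ?_
  rw [add_mulVec, one_mulVec, dotProduct_add, one_mul]
  linarith [gram_quad_nonneg L x t u]

theorem quad_one_add_gram (L : ℝ) (x : ℕ → Fin d → ℝ) (t : ℕ) (u : Fin d → ℝ) :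
    u ⬝ᵥ ((1 + gram L x t) *ᵥ u) = u ⬝ᵥ u + u ⬝ᵥ (gram L x t *ᵥ u) := by
  rw [add_mulVec, one_mulVec, dotProduct_add]

/-- While the determinant has not grown by the factor `1 + η`, the old design matrix can replace the
new one. -/
theorem ValidAt.quad_inv_le {P : Params d m} (hp : P.p < 1) (hδ : 0 < P.delta)
    (hδ1 : P.delta < 1) {S : ℝ} {θ : Fin d → ℝ} {x : ℕ → Fin d → ℝ} {z : ℕ → Report d m} {s t : ℕ}
    (hs : ValidAt P S θ x z s) (ht : ValidAt P S θ x z t) (hs1 : 1 ≤ s) (hst : s ≤ t)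
    (hη : 0 < P.eta) (hdet : (estMat P z t).det ≤ (1 + P.eta) * (estMat P z s).det)
    (y : Fin d → ℝ) :
    y ⬝ᵥ ((estMat P z s)⁻¹ *ᵥ y) ≤
      (3 / 2) ^ d * (1 + P.eta) * (y ⬝ᵥ ((1 + gram P.L x t)⁻¹ *ᵥ y)) := by
  have hreg := Params.reg_mono hp hδ hδ1 hs1 hst
  have hq : ∀ u : Fin d → ℝ, u ⬝ᵥ (((3 / 2 : ℝ) • estMat P z t) *ᵥ u) =
      3 / 2 * (u ⬝ᵥ (estMat P z t *ᵥ u)) := fun u => by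
    rw [smul_mulVec, dotProduct_smul, smul_eq_mul]
  have hB : ((3 / 2 : ℝ) • estMat P z t).PosDef := ht.posDef.smul (by norm_num)
  -- Because of the noise the design matrices need not increase with time. The factor `3 / 2`
  -- repairs this, since `19 / 8 ≤ 3 / 2 * (8 / 5)` and `λ` is monotone.
  have hle : ∀ u : Fin d → ℝ, u ⬝ᵥ (estMat P z s *ᵥ u) ≤
      u ⬝ᵥ (((3 / 2 : ℝ) • estMat P z t) *ᵥ u) := by
    intro u
    rw [hq]
    have h1 := hs.upper u
    have h2 := ht.lower u
    have h3 := gram_quad_mono P.L x hst u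
    have h4 := gram_quad_nonneg P.L x t u
    have h5 := mul_le_mul_of_nonneg_right hreg (dotProduct_self_nonneg_real u)
    have h6 : 0 ≤ P.reg t * (u ⬝ᵥ u) :=
      mul_nonneg (zero_le_one.trans ht.one_le_reg) (dotProduct_self_nonneg_real u)
    linarith
  have hW : ∀ u : Fin d → ℝ, u ⬝ᵥ ((1 + gram P.L x t) *ᵥ u) ≤
      u ⬝ᵥ (((3 / 2 : ℝ) • estMat P z t) *ᵥ u) := by
    intro u
    rw [hq, quad_one_add_gram]
    have h2 := ht.lower u
    have h4 := gram_quad_nonneg P.L x t u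
    have h5 := mul_le_mul_of_nonneg_right ht.one_le_reg (dotProduct_self_nonneg_real u)
    have h6 := dotProduct_self_nonneg_real u
    linarith
  refine ((det_le_det_and_quad_inv_le hs.posDef hB hle).2 y).trans ?_
  have hds := hs.posDef.det_pos
  have hW1 := quad_inv_le_of_le (posDef_one_add_gram P.L x t) hB hW y
  have hW0 := posDef_quad_nonneg hB.inv y
  refine mul_le_mul ?_ hW1 hW0 (by positivity)
  rw [det_smul, Fintype.card_fin, div_le_iff₀ hds, mul_assoc]
  gcongr

theorem abs_estMat_apply_le {P : Params d m} (hm : 0 < m) (hp : P.p < 1) (hlam : 0 < P.lam)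
    (z : ℕ → Report d m) (t : ℕ) (i j : Fin d) :
    |estMat P z t i j| ≤ t / (2 * (1 - P.p)) + 2 * P.reg t := by
  have hp' : 0 < 1 - P.p := by linarith
  have hreg : P.lam ≤ P.reg t := by
    unfold Params.reg
    have : 0 ≤ √(8 * t * Real.log (2 * t / P.delta)) / m := by positivity
    have : 0 ≤ 2 * √(8 * t * Real.log (2 * t / P.delta)) / ((1 - P.p) * √m) := by positivity
    linarith
  rw [estMat, Matrix.add_apply, Matrix.of_apply, Matrix.smul_apply]
  refine (abs_add_le _ _).trans (add_le_add ?_ ?_)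
  · refine (Finset.abs_sum_le_sum_abs _ _).trans
      ((Finset.sum_le_sum fun s _ => abs_debiased_le hm hp ((z s).w i j)).trans_eq ?_)
    rw [Finset.sum_const, Finset.card_range, nsmul_eq_mul]
    ring
  · rw [Matrix.one_apply]
    split_ifs
    · rw [smul_eq_mul, mul_one, abs_le]; constructor <;> linarith
    · simp; linarith

set_option maxHeartbeats 600000 in
/-- A model that was formed before round `τ` is replaced once the regularizer is large compared with
`τ`. -/
theorem le_of_det_lt {P : Params d m} (hd : 0 < d) (hm : 0 < m) (hp0 : 0 ≤ P.p) (hp : P.p < 1)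
    (hδ : 0 < P.delta) (hδ1 : P.delta < 1) (hlam : 0 < P.lam) (hη : 0 < P.eta)
    {S : ℝ} {θ : Fin d → ℝ} {x : ℕ → Fin d → ℝ} {z : ℕ → Report d m} {s t τ : ℕ}
    (ht : ValidAt P S θ x z t) (hτ : 1 ≤ τ) (hτT : τ ≤ P.T) (ht1 : 1 ≤ t)
    (hlarge : m * ((1 + P.eta) * d.factorial *
      ((37 + 4 * P.lam) * (τ * Real.log (2 * P.T / P.delta)))) ^ 2 ≤ t)
    (hdet : (estMat P z t).det < (1 + P.eta) * (estMat P z s).det) : τ ≤ s := by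
  -- The early matrix may fail to be positive definite, so its determinant is bounded only through
  -- its entries, which have order `τ log / (1 - p)`. The later determinant is at least `(8 / 5
  -- λ(t)) ^ d`, and `λ(t)` is at least `√t / ((1 - p) √m)`. The powers of `1 - p` cancel, which
  -- leaves the condition `hlarge`.
  by_contra! hs
  have hp' : 0 < 1 - P.p := by linarith
  have hm0 : (0 : ℝ) < m := by exact_mod_cast hm
  have hm1 : (1 : ℝ) ≤ m := by exact_mod_cast hm
  have hτ' : (1 : ℝ) ≤ τ := by exact_mod_cast hτ
  have hs' : (s : ℝ) ≤ τ := by exact_mod_cast hs.le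
  have ht' : (1 : ℝ) ≤ t := by exact_mod_cast ht1
  have hτT' : (τ : ℝ) ≤ P.T := by exact_mod_cast hτT
  set ℓ := Real.log (2 * P.T / P.delta) with hℓ
  have hℓ0 : 1 / 2 ≤ ℓ := half_le_log hδ hδ1 (hτ.trans hτT)
  -- Multiplication by `1 - p` keeps the bound free of `p`. The case `s = 0`, the initial model, is
  -- included.
  have hregs : (1 - P.p) * P.reg s ≤ 3 * (3 * (τ * (2 * ℓ))) + P.lam * (τ * (2 * ℓ)) := by
    have h1 : √(8 * s * Real.log (2 * s / P.delta)) ≤ 3 * (τ * (2 * ℓ)) := by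
      rcases Nat.eq_zero_or_pos s with h0 | h0
      · rw [h0]; simp; positivity
      have hs1 : (1 : ℝ) ≤ s := by exact_mod_cast h0
      have hlog : Real.log (2 * s / P.delta) ≤ ℓ := by
        refine Real.log_le_log (by positivity) ?_
        have : (s : ℝ) ≤ P.T := hs'.trans hτT'
        gcongr
      have hlog0 := half_le_log hδ hδ1 h0
      refine Real.sqrt_le_iff.mpr ⟨by positivity, ?_⟩
      have h2 : 8 * (s : ℝ) * Real.log (2 * s / P.delta) ≤ 8 * τ * ℓ := by
        have : 0 ≤ Real.log (2 * s / P.delta) := by linarith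
        gcongr
      have h3 : τ * ℓ ≤ (τ * (2 * ℓ)) ^ 2 := by
        have h5 : τ * ℓ * 1 ≤ τ * ℓ * (4 * (τ * ℓ)) := by
          refine mul_le_mul_of_nonneg_left ?_ (by positivity)
          nlinarith only [hτ', hℓ0]
        nlinarith only [h5]
      have h4 : 0 ≤ (τ * (2 * ℓ)) ^ 2 := by positivity
      nlinarith only [h2, h3, h4]
    have hr0 : 0 ≤ √(8 * s * Real.log (2 * s / P.delta)) := Real.sqrt_nonneg _
    set r := √(8 * s * Real.log (2 * s / P.delta))
    have h2 : (1 - P.p) * (r / m) ≤ r := by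
      have : r / m ≤ r := div_le_self hr0 hm1
      have h0 : 0 ≤ r / m := by positivity
      nlinarith only [this, h0, hp0]
    have hsm : 1 ≤ √(m : ℝ) := Real.one_le_sqrt.mpr hm1
    have h3 : (1 - P.p) * (2 * r / ((1 - P.p) * √m)) ≤ 2 * r := by
      have e : (1 - P.p) * (2 * r / ((1 - P.p) * √m)) = 2 * r / √m := by field_simp
      rw [e]
      exact div_le_self (by positivity) hsm
    have h4 : (1 - P.p) * P.lam ≤ P.lam * (τ * (2 * ℓ)) := by
      have : 1 ≤ τ * (2 * ℓ) := by nlinarith only [hτ', hℓ0]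
      nlinarith only [this, hp0, hlam]
    have e : P.reg s = r / m + 2 * r / ((1 - P.p) * √m) + P.lam := rfl
    rw [e, mul_add, mul_add]
    linarith
  set X := (37 + 4 * P.lam) * (τ * ℓ) with hX
  have hX0 : 0 ≤ X := by positivity
  have hentry : ∀ i j, |estMat P z s i j| ≤ X / (1 - P.p) := by
    intro i j
    refine (abs_estMat_apply_le hm hp hlam z s i j).trans ?_
    have e : (s : ℝ) / (2 * (1 - P.p)) * (1 - P.p) = s / 2 := by field_simp
    have : (τ : ℝ) / 2 ≤ τ * ℓ := by nlinarith only [hτ', hℓ0]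
    rw [le_div_iff₀ hp', add_mul, e, hX]
    linarith only [this, hs', hregs]
  have hdets : |(estMat P z s).det| ≤ d.factorial * (X / (1 - P.p)) ^ d := by
    have := Matrix.det_le (A := estMat P z s) (abv := AbsoluteValue.abs) (x := X / (1 - P.p)) hentry
    simpa using this
  have hbase : (1 + P.eta) * d.factorial * X / (1 - P.p) ≤ 8 / 5 * P.reg t := by
    have h1 : (1 + P.eta) * d.factorial * X ≤ √t / √m := by
      rw [le_div_iff₀ (by positivity)]
      refine Real.le_sqrt_of_sq_le ?_
      rw [mul_pow, Real.sq_sqrt hm0.le, mul_comm]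
      exact hlarge
    have h2 : √t / √m / (1 - P.p) ≤ P.reg t := by
      refine le_trans ?_ ((le_add_of_nonneg_right hlam.le).trans
        (reg_ge hp rfl hδ ht1 (le_refl t)))
      have h3 : √t ≤ 4 * √2 * √(t * Real.log (2 * t / P.delta)) := by
        have h0 := half_le_log hδ hδ1 ht1
        rw [show (4 : ℝ) * √2 = √(4 ^ 2 * 2) by
          rw [Real.sqrt_mul (by norm_num), Real.sqrt_sq (by norm_num)],
          ← Real.sqrt_mul (by norm_num)]
        refine Real.sqrt_le_sqrt ?_
        nlinarith only [h0, ht']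
      calc √t / √m / (1 - P.p) = √t / ((1 - P.p) * √m) := by rw [div_div, mul_comm]
        _ ≤ 4 * √2 * √(t * Real.log (2 * t / P.delta)) / ((1 - P.p) * √m) := by gcongr
        _ = _ := by ring
    have h4 : (1 + P.eta) * d.factorial * X / (1 - P.p) ≤ √t / √m / (1 - P.p) := by gcongr
    have := ht.one_le_reg
    linarith
  have hlow : (8 / 5 * P.reg t) ^ d ≤ (estMat P z t).det := by
    have hr := ht.one_le_reg
    have := (det_le_det_and_quad_inv_le (posDef_smul_one (d := d)
      (by linarith : 0 < 8 / 5 * P.reg t)) ht.posDef fun u => by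
        rw [quad_one]
        linarith [ht.lower u, gram_quad_nonneg P.L x t u]).1
    simpa [det_smul] using this
  have hfac : (1 : ℝ) ≤ (1 + P.eta) * d.factorial := by
    have : (1 : ℝ) ≤ d.factorial := by exact_mod_cast Nat.succ_le_of_lt (Nat.factorial_pos d)
    nlinarith only [this, hη]
  have h1 : (1 + P.eta) * (estMat P z s).det ≤ (8 / 5 * P.reg t) ^ d := by
    calc (1 + P.eta) * (estMat P z s).det
        ≤ (1 + P.eta) * (d.factorial * (X / (1 - P.p)) ^ d) := by
          gcongr
          exact (le_abs_self _).trans hdets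
      _ = ((1 + P.eta) * d.factorial) ^ 1 * (X / (1 - P.p)) ^ d := by ring
      _ ≤ ((1 + P.eta) * d.factorial) ^ d * (X / (1 - P.p)) ^ d := by
          gcongr
          exact hd
      _ = ((1 + P.eta) * d.factorial * X / (1 - P.p)) ^ d := by rw [← mul_pow]; ring
      _ ≤ _ := by gcongr
  linarith

end Growth


/-! ### Optimism -/

section Optimism

variable {d m : ℕ}

theorem inner_eq_dotProduct (x y : EuclideanSpace ℝ (Fin d)) :
    inner ℝ x y = x.ofLp ⬝ᵥ y.ofLp := by
  rw [EuclideanSpace.inner_eq_star_dotProduct, dotProduct_comm]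
  simp

theorem ValidAt.abs_inner_sub_le {P : Params d m} {S : ℝ} {θ : Fin d → ℝ} {x : ℕ → Fin d → ℝ}
    {z : ℕ → Report d m} {t : ℕ} (h : ValidAt P S θ x z t) (y : Fin d → ℝ) :
    |y ⬝ᵥ ((1 / P.L) • ((estMat P z t)⁻¹ *ᵥ estVec P z t)) - y ⬝ᵥ θ| ≤
      S * √(3 * P.reg t) * √(y ⬝ᵥ ((estMat P z t)⁻¹ *ᵥ y)) := by
  have h1 := abs_dotProduct_inv_mulVec_le h.posDef h.conf y
  rwa [mulVec_sub, mulVec_smul, mulVec_mulVec, posDef_inv_mul_cancel h.posDef, one_mulVec,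
    dotProduct_sub] at h1

/-- The remaining summands of `β` are nonnegative; this one already equals the radius provided by
`ValidAt`. -/
theorem le_width {P : Params d m} (hσ : 0 ≤ P.σ) (hδ : 0 < P.delta) (hδ1 : P.delta < 1)
    {t : ℕ} (ht : 1 ≤ t) : P.S * √(3 * P.reg t) ≤ P.width t := by
  have h0 := half_le_log hδ hδ1 ht
  unfold Params.width
  have h1 : 0 ≤ P.σ * √(8 * Real.log (2 * t / P.delta) + d * Real.log (3 + t * P.L ^ 2 / P.reg t)) :=
    by positivity
  have h2 : 0 ≤ d / √(P.reg t) * (2 * √(P.p * (1 - P.p / 2) * t * m * Real.log (2 * t / P.delta))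
        + 8 * Real.log (2 * t / P.delta) / 3
        + √8 / m * √(t * Real.log (2 * t / P.delta))) := by
    have : 0 ≤ Real.log (2 * t / P.delta) := by linarith
    positivity
  linarith

variable {Ω : Type*} [mΩ : MeasurableSpace Ω] {μ : Measure Ω}
  {P : Params d m} {K : ℕ} {θstar : EuclideanSpace ℝ (Fin d)}

/-- The regret of round `t`. -/
noncomputable def Run.roundRegret (R : Run μ P K θstar) (ω : Ω) (t : ℕ) : ℝ :=
  (⨆ a : Fin K, inner ℝ (R.context t ω a) θstar) - inner ℝ (R.context t ω (R.action t ω)) θstar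

theorem Run.roundRegret_le (R : Run μ P K θstar) (hL : 0 ≤ P.L) {S : ℝ} (hθ : ‖θstar‖ ≤ S)
    (ω : Ω) {t : ℕ} (ht : t < P.T) : R.roundRegret ω t ≤ 2 * (P.L * S) := by
  have hb : ∀ a, |inner ℝ (R.context t ω a) θstar| ≤ P.L * S := fun a =>
    (abs_real_inner_le_norm _ _).trans
      (mul_le_mul (R.norm_context_le t ht ω a) hθ (norm_nonneg _) hL)
  have : Nonempty (Fin K) := ⟨R.action t ω⟩
  have h1 : (⨆ a : Fin K, inner ℝ (R.context t ω a) θstar) ≤ P.L * S :=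
    ciSup_le fun a => (abs_le.mp (hb a)).2
  have h2 := (abs_le.mp (hb (R.action t ω))).1
  unfold Run.roundRegret
  linarith

/-- The optimism argument: the index of the played arm is at least the optimal mean, and it exceeds
the mean of the played arm by at most two widths. -/
theorem Run.roundRegret_le_of_validAt (R : Run μ P K θstar) {ω : Ω} {t j : ℕ} (ht : t < P.T)
    (hσ : 0 ≤ P.σ) (hδ : 0 < P.delta) (hδ1 : P.delta < 1) (hj : 1 ≤ j)
    (hstate : (stateAt P (fun s => R.report s ω) (fun k => R.perm k ω) t).t = j)
    (h : ValidAt P P.S θstar.ofLp (R.feature ω) (fun s => R.report s ω) j) :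
    R.roundRegret ω t ≤ 2 * P.width j *
      √(R.feature ω t ⬝ᵥ ((estMat P (fun s => R.report s ω) j)⁻¹ *ᵥ R.feature ω t)) := by
  have hopt := R.action_optimistic t ht ω
  set z : ℕ → Report d m := fun s => R.report s ω
  have inv := stateInvariant_stateAfter P z (fun k => R.perm k ω) (t / P.batchLength)
  set s := stateAfter P z (fun k => R.perm k ω) (t / P.batchLength)
  change s.t = j at hstate
  have hidx : ∀ y : EuclideanSpace ℝ (Fin d), index P s y =
      y.ofLp ⬝ᵥ ((1 / P.L) • ((estMat P z j)⁻¹ *ᵥ estVec P z j)) +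
        P.width j * √(y.ofLp ⬝ᵥ ((estMat P z j)⁻¹ *ᵥ y.ofLp)) := by
    intro y
    rw [index, inner_eq_dotProduct, inv.θ_eq, inv.V_eq, inv.B_eq, hstate]
  have hw := le_width (P := P) hσ hδ hδ1 hj
  have hdev : ∀ y : EuclideanSpace ℝ (Fin d),
      |y.ofLp ⬝ᵥ ((1 / P.L) • ((estMat P z j)⁻¹ *ᵥ estVec P z j)) - y.ofLp ⬝ᵥ θstar.ofLp| ≤
        P.width j * √(y.ofLp ⬝ᵥ ((estMat P z j)⁻¹ *ᵥ y.ofLp)) := fun y =>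
    (h.abs_inner_sub_le y.ofLp).trans (mul_le_mul_of_nonneg_right hw (Real.sqrt_nonneg _))
  have : Nonempty (Fin K) := ⟨R.action t ω⟩
  have hsup : (⨆ a : Fin K, inner ℝ (R.context t ω a) θstar) ≤
      index P s (R.context t ω (R.action t ω)) := by
    refine ciSup_le fun a => le_trans ?_ (hopt a)
    change _ ≤ index P s (R.context t ω a)
    rw [hidx, inner_eq_dotProduct]
    have := (abs_le.mp (hdev (R.context t ω a))).1
    linarith
  rw [hidx] at hsup
  have h3 := (abs_le.mp (hdev (R.context t ω (R.action t ω)))).2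
  unfold Run.roundRegret
  rw [inner_eq_dotProduct (R.context t ω (R.action t ω))]
  change _ ≤ 2 * P.width j * √((R.context t ω (R.action t ω)).ofLp ⬝ᵥ
    ((estMat P z j)⁻¹ *ᵥ (R.context t ω (R.action t ω)).ofLp))
  linarith

end Optimism

/-! ### The elliptical potential -/

section Potential

variable {d : ℕ}

theorem det_one_add_gram_mono (L : ℝ) (x : ℕ → Fin d → ℝ) {s t : ℕ} (hst : s ≤ t) :
    (1 + gram L x s).det ≤ (1 + gram L x t).det :=
  (det_le_det_and_quad_inv_le (posDef_one_add_gram L x s) (posDef_one_add_gram L x t) fun u => by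
    rw [quad_one_add_gram, quad_one_add_gram]
    exact add_le_add_right (gram_quad_mono L x hst u) _).1

theorem quad_inv_one_add_gram_le (L : ℝ) (x : ℕ → Fin d → ℝ) {s t : ℕ} (hst : s ≤ t)
    (y : Fin d → ℝ) : y ⬝ᵥ ((1 + gram L x s)⁻¹ *ᵥ y) ≤
      (1 + gram L x t).det / (1 + gram L x s).det * (y ⬝ᵥ ((1 + gram L x t)⁻¹ *ᵥ y)) :=
  (det_le_det_and_quad_inv_le (posDef_one_add_gram L x s) (posDef_one_add_gram L x t) (fun u => by
    rw [quad_one_add_gram, quad_one_add_gram]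
    exact add_le_add_right (gram_quad_mono L x hst u) _)).2 y

/-- The logarithm of the determinant of the regularized design matrix. -/
noncomputable def logDet (L : ℝ) (x : ℕ → Fin d → ℝ) (t : ℕ) : ℝ := Real.log (1 + gram L x t).det

theorem logDet_zero (L : ℝ) (x : ℕ → Fin d → ℝ) : logDet L x 0 = 0 := by
  simp [logDet, gram]

theorem logDet_mono (L : ℝ) (x : ℕ → Fin d → ℝ) : Monotone (logDet L x) := fun s _ hst =>
  Real.log_le_log (posDef_one_add_gram L x s).det_pos (det_one_add_gram_mono L x hst)

/-- The update multiplies the determinant by `1 + v` with `v = q / (2 L ^ 2) ≤ 1`, and `v ≤ 2 log (1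
+ v)` on this range. -/
theorem quad_inv_le_logDet_sub {L : ℝ} (hL : 0 < L) {x : ℕ → Fin d → ℝ} {t : ℕ}
    (hx : x t ⬝ᵥ x t ≤ L ^ 2) :
    x t ⬝ᵥ ((1 + gram L x t)⁻¹ *ᵥ x t) ≤ 4 * L ^ 2 * (logDet L x (t + 1) - logDet L x t) := by
  set W := 1 + gram L x t with hW
  have hWp : W.PosDef := posDef_one_add_gram L x t
  set q := x t ⬝ᵥ (W⁻¹ *ᵥ x t) with hq
  have hq0 : 0 ≤ q := posDef_quad_nonneg hWp.inv _
  have hqL : q ≤ L ^ 2 := by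
    have := quad_inv_le_of_le (PosDef.one (n := Fin d) (R := ℝ)) hWp (fun u => by
      rw [one_mulVec, quad_one_add_gram]
      linarith [gram_quad_nonneg L x t u]) (x t)
    rw [inv_one, one_mulVec] at this
    exact this.trans hx
  set c : ℝ := (√2 * L)⁻¹ with hc
  have hcc : c * c = 1 / (2 * L ^ 2) := by
    rw [hc, ← mul_inv, one_div]
    congr 1
    have := Real.mul_self_sqrt (show (0 : ℝ) ≤ 2 by norm_num)
    linear_combination L ^ 2 * this
  have hstep : 1 + gram L x (t + 1) = W + vecMulVec (c • x t) (c • x t) := by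
    rw [hW, gram, gram, Finset.sum_range_succ, ← add_assoc]
    congr 1
    ext i j
    simp only [Matrix.smul_apply, vecMulVec_apply, Pi.smul_apply, smul_eq_mul, ← hcc]
    ring
  set v := q / (2 * L ^ 2) with hv
  have hv0 : 0 ≤ v := by positivity
  have hv1 : v ≤ 1 := by
    rw [hv, div_le_one (by positivity)]; nlinarith
  have hdet : (1 + gram L x (t + 1)).det = W.det * (1 + v) := by
    rw [hstep, det_add_vecMulVec_self hWp, mulVec_smul, smul_dotProduct, dotProduct_smul,
      smul_eq_mul, smul_eq_mul, ← mul_assoc, hcc, hv]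
    ring
  have hlog : logDet L x (t + 1) - logDet L x t = Real.log (1 + v) := by
    rw [logDet, logDet, hdet, Real.log_mul hWp.det_pos.ne' (by positivity)]
    ring
  rw [hlog]
  have h2 : v ≤ 2 * Real.log (1 + v) := by
    have h3 := Real.one_sub_inv_le_log_of_pos (by positivity : 0 < 1 + v)
    have h4 : v / 2 ≤ 1 - (1 + v)⁻¹ := by
      have e : 1 - (1 + v)⁻¹ = v / (1 + v) := by field_simp; ring
      rw [e]
      exact div_le_div_of_nonneg_left hv0 (by positivity) (by linarith)
    linarith
  calc q = 2 * L ^ 2 * v := by rw [hv]; field_simp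
    _ ≤ 2 * L ^ 2 * (2 * Real.log (1 + v)) := by gcongr
    _ = _ := by ring

theorem logDet_le {L : ℝ} (hL : 0 < L) {x : ℕ → Fin d → ℝ} {t : ℕ}
    (hx : ∀ s < t, x s ⬝ᵥ x s ≤ L ^ 2) : logDet L x t ≤ d * Real.log (1 + t / 2) := by
  have h1 : (0 : ℝ) < 1 + t / 2 := by positivity
  have h := (det_le_det_and_quad_inv_le (posDef_one_add_gram L x t) (posDef_smul_one h1) fun u => by
    rw [quad_one_add_gram, quad_one]
    linarith [gram_quad_le hL hx u]).1
  rw [det_smul, det_one, Fintype.card_fin, mul_one] at h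
  calc logDet L x t ≤ Real.log ((1 + (t : ℝ) / 2) ^ d) :=
        Real.log_le_log (posDef_one_add_gram L x t).det_pos h
    _ = _ := by rw [Real.log_pow]

/-- Split the difference with lag `l` into `l` unit increments; for each of them the sum over `t`
telescopes. Truncated subtraction makes the terms before time 0 equal to `N 0 = 0`. -/
theorem sum_sub_shift_le {N : ℕ → ℝ} (hN : Monotone N) (h0 : N 0 = 0) (l T : ℕ) :
    ∑ t ∈ Finset.range T, (N t - N (t - l)) ≤ l * N T := by
  have h1 : ∀ t, N t - N (t - l) = ∑ i ∈ Finset.range l, (N (t - i) - N (t - (i + 1))) := by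
    intro t
    rw [Finset.sum_range_sub' (fun i => N (t - i))]
    simp
  simp_rw [h1]
  rw [Finset.sum_comm]
  calc _ ≤ ∑ _i ∈ Finset.range l, N T := by
        refine Finset.sum_le_sum fun i _ => ?_
        have h2 : ∀ t, N (t - i) - N (t - (i + 1)) = N (t + 1 - (i + 1)) - N (t - (i + 1)) :=
          fun t => by rw [Nat.add_sub_add_right]
        simp_rw [h2]
        rw [Finset.sum_range_sub (fun t => N (t - (i + 1)))]
        have : N (T - (i + 1)) ≤ N T := hN (Nat.sub_le _ _)
        simp only [zero_tsub, h0]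
        linarith
    _ = l * N T := by simp

end Potential


/-! ### The regret on the good event -/

section RegretBound

variable {Ω : Type*} [mΩ : MeasurableSpace Ω] {μ : Measure Ω} {d m : ℕ}
  {P : Params d m} {K : ℕ} {θstar : EuclideanSpace ℝ (Fin d)}

/-- The model has seen nothing after the last complete batch, which ended less than `l` rounds ago.
If the determinant of `1 + gram` has at most doubled since then, the delay costs a factor `√2`.
Otherwise `logDet` has grown by at least `log 2 > 1 / 2` over the last `l` rounds, and the trivial
bound `2 L S` is charged to this growth. -/
theorem Run.roundRegret_le_potential (R : Run μ P K θstar) (hd : 0 < d) (hm : 0 < m)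
    (hL : 0 < P.L) (hS : 0 < P.S)
    (hσ : 0 ≤ P.σ) (hp0 : 0 ≤ P.p) (hp : P.p < 1) (hδ : 0 < P.delta) (hδ1 : P.delta < 1)
    (hlam : 0 < P.lam) (hη : 0 < P.eta) (hθ : ‖θstar‖ ≤ P.S) {ω : Ω} {τ t₁ : ℕ} (hτ : 1 ≤ τ)
    (hτt : τ ≤ t₁)
    (hvalid : ∀ t, τ ≤ t → t ≤ P.T →
      ValidAt P P.S θstar.ofLp (R.feature ω) (fun s => R.report s ω) t)
    (ht₁ : m * ((1 + P.eta) * d.factorial *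
      ((37 + 4 * P.lam) * (τ * Real.log (2 * P.T / P.delta)))) ^ 2 ≤ t₁)
    (hl : 0 < P.batchLength) {β : ℝ} (hβ : ∀ t, 1 ≤ t → t ≤ P.T → P.width t ≤ β) {t : ℕ}
    (ht : t₁ + P.batchLength ≤ t) (htT : t < P.T) :
    R.roundRegret ω t ≤
      2 * β * √(2 * ((3 / 2) ^ d * (1 + P.eta))) *
        √(R.feature ω t ⬝ᵥ ((1 + gram P.L (R.feature ω) t)⁻¹ *ᵥ R.feature ω t)) +
      2 * (P.L * P.S) * (2 * (logDet P.L (R.feature ω) t -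
        logDet P.L (R.feature ω) (t - P.batchLength))) := by
  set l := P.batchLength with hldef
  set x := R.feature ω with hx
  set z : ℕ → Report d m := fun s => R.report s ω with hz
  set k := t / l with hk
  have hkl : k * l ≤ t := Nat.div_mul_le_self t l
  have hkl2 : t < (k + 1) * l := (Nat.div_lt_iff_lt_mul hl).mp (Nat.lt_succ_self _)
  have hkl3 : t - l ≤ k * l := by rw [add_one_mul] at hkl2; omega
  have hkt₁ : t₁ ≤ k * l := by rw [add_one_mul] at hkl2; omega
  have hβ0 : 0 ≤ β := by
    have := le_width (P := P) hσ hδ hδ1 (t := 1) le_rfl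
    have h2 : 0 ≤ P.S * √(3 * P.reg 1) := by positivity
    exact (h2.trans this).trans (hβ 1 le_rfl (by omega))
  have hmono := logDet_mono P.L x
  have hlast : 0 ≤ 2 * (P.L * P.S) * (2 * (logDet P.L x t - logDet P.L x (t - l))) := by
    have := hmono (Nat.sub_le t l)
    have : 0 ≤ logDet P.L x t - logDet P.L x (t - l) := by linarith
    positivity
  have hq0 : 0 ≤ x t ⬝ᵥ ((1 + gram P.L x t)⁻¹ *ᵥ x t) :=
    posDef_quad_nonneg (posDef_one_add_gram P.L x t).inv _
  by_cases hdouble : (1 + gram P.L x t).det ≤ 2 * (1 + gram P.L x (k * l)).det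
  · refine le_trans ?_ (le_add_of_nonneg_right hlast)
    have inv := stateInvariant_stateAfter P z (fun k => R.perm k ω) k
    set s := stateAfter P z (fun k => R.perm k ω) k with hs
    have hst : s.t ≤ k * l := inv.t_le
    have hvt := hvalid (k * l) (hτt.trans hkt₁) (by omega)
    -- After `t₁` no model from the uncontrolled initial period is in use any more.
    have hsτ : τ ≤ s.t := by
      rcases inv.det_lt with h | h
      · rw [h]; exact hτt.trans hkt₁
      · refine le_of_det_lt hd hm hp0 hp hδ hδ1 hlam hη hvt hτ (by omega) (by omega) ?_
          (by rw [inv.V_eq] at h; exact h)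
        refine ht₁.trans ?_
        exact_mod_cast hkt₁
    have hvs := hvalid s.t hsτ (hst.trans (by omega))
    have hdet : (estMat P z (k * l)).det ≤ (1 + P.eta) * (estMat P z s.t).det := by
      rcases inv.det_lt with h | h
      · rw [h]
        exact le_mul_of_one_le_left hvt.posDef.det_pos.le (by linarith)
      · rw [inv.V_eq] at h; exact h.le
    have h1 := R.roundRegret_le_of_validAt htT hσ hδ hδ1 (hτ.trans hsτ) rfl hvs
    have h2 := hvs.quad_inv_le hp hδ hδ1 hvt (hτ.trans hsτ) inv.t_le hη hdet (x t)
    have h3 : x t ⬝ᵥ ((1 + gram P.L x (k * l))⁻¹ *ᵥ x t) ≤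
        2 * (x t ⬝ᵥ ((1 + gram P.L x t)⁻¹ *ᵥ x t)) := by
      refine (quad_inv_one_add_gram_le P.L x hkl (x t)).trans ?_
      refine mul_le_mul_of_nonneg_right ?_ hq0
      rwa [div_le_iff₀ (posDef_one_add_gram P.L x (k * l)).det_pos]
    have h4 : x t ⬝ᵥ ((estMat P z s.t)⁻¹ *ᵥ x t) ≤ 2 * ((3 / 2) ^ d * (1 + P.eta)) *
        (x t ⬝ᵥ ((1 + gram P.L x t)⁻¹ *ᵥ x t)) := by
      refine h2.trans ((mul_le_mul_of_nonneg_left h3 (by positivity)).trans_eq (by ring))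
    refine h1.trans ?_
    rw [mul_assoc (2 * β), ← Real.sqrt_mul (by positivity)]
    have hw := hβ s.t (hτ.trans hsτ) (hst.trans (by omega))
    exact mul_le_mul (by linarith) (Real.sqrt_le_sqrt h4) (Real.sqrt_nonneg _) (by positivity)
  · have h1 := R.roundRegret_le hL.le hθ ω htT
    have hD := (posDef_one_add_gram P.L x (k * l)).det_pos
    have h2 : Real.log 2 + logDet P.L x (k * l) ≤ logDet P.L x t := by
      rw [logDet, logDet, ← Real.log_mul (by norm_num) hD.ne']
      exact Real.log_le_log (by positivity) (not_le.mp hdouble).le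
    have h3 := hmono hkl3
    have h4 := Real.log_two_gt_d9
    have h5 : 1 ≤ 2 * (logDet P.L x t - logDet P.L x (t - l)) := by linarith
    have h6 : 0 ≤ 2 * β * √(2 * ((3 / 2) ^ d * (1 + P.eta))) *
        √(x t ⬝ᵥ ((1 + gram P.L x t)⁻¹ *ᵥ x t)) := by positivity
    have h7 := le_mul_of_one_le_right (by positivity : 0 ≤ 2 * (P.L * P.S)) h5
    linarith

/-- The regret on the event where the statistics are accurate from round `τ` on. -/
theorem Run.regret_le [IsProbabilityMeasure μ] (R : Run μ P K θstar) (hd : 0 < d) (hm : 0 < m)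
    (hL : 0 < P.L) (hS : 0 < P.S)
    (hσ : 0 ≤ P.σ) (hp0 : 0 ≤ P.p) (hp : P.p < 1) (hδ : 0 < P.delta) (hδ1 : P.delta < 1)
    (hlam : 0 < P.lam) (hη : 0 < P.eta) (hθ : ‖θstar‖ ≤ P.S) (hT : 1 ≤ P.T) {ω : Ω} {τ t₁ : ℕ}
    (hτ : 1 ≤ τ) (hτt : τ ≤ t₁)
    (hvalid : ∀ t, τ ≤ t → t ≤ P.T →
      ValidAt P P.S θstar.ofLp (R.feature ω) (fun s => R.report s ω) t)
    (ht₁ : m * ((1 + P.eta) * d.factorial *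
      ((37 + 4 * P.lam) * (τ * Real.log (2 * P.T / P.delta)))) ^ 2 ≤ t₁)
    (hl : 0 < P.batchLength) {β : ℝ} (hβ : ∀ t, 1 ≤ t → t ≤ P.T → P.width t ≤ β) :
    R.regret ω ≤ 2 * (P.L * P.S) * t₁ +
      2 * (P.L * P.S) * (1 + 2 * d * Real.log (2 * P.T / P.delta)) * P.batchLength +
      4 * P.L * √(2 * ((3 / 2) ^ d * (1 + P.eta)) * d * Real.log (2 * P.T / P.delta)) * β * √P.T := by
  set l := P.batchLength with hldef
  set x := R.feature ω with hx
  set ℓ := Real.log (2 * P.T / P.delta) with hℓ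
  set G := 2 * ((3 / 2 : ℝ) ^ d * (1 + P.eta)) with hG
  have hT' : (1 : ℝ) ≤ P.T := by exact_mod_cast hT
  have hβ0 : 0 ≤ β := by
    have := le_width (P := P) hσ hδ hδ1 (t := 1) le_rfl
    have h2 : 0 ≤ P.S * √(3 * P.reg 1) := by positivity
    exact (h2.trans this).trans (hβ 1 le_rfl hT)
  have hLS : 0 < P.L * P.S := by positivity
  have hmono := logDet_mono P.L x
  have hxL : ∀ s < P.T, x s ⬝ᵥ x s ≤ P.L ^ 2 := fun s hs => R.feature_dot_self_le hs ω
  have hlogT : logDet P.L x P.T ≤ d * ℓ := by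
    refine (logDet_le hL hxL).trans (mul_le_mul_of_nonneg_left ?_ (Nat.cast_nonneg d))
    refine Real.log_le_log (by positivity) ?_
    rw [le_div_iff₀ hδ]
    nlinarith
  set q : ℕ → ℝ := fun t => x t ⬝ᵥ ((1 + gram P.L x t)⁻¹ *ᵥ x t) with hq
  have hq0 : ∀ t, 0 ≤ q t := fun t => posDef_quad_nonneg (posDef_one_add_gram P.L x t).inv _
  -- The trivial bound is used for `l` rounds beyond `t₁`, so that in every later round the last
  -- complete batch ended no earlier than `t₁`.
  have hround : ∀ t ∈ Finset.range P.T, R.roundRegret ω t ≤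
      (if t < t₁ + l then 2 * (P.L * P.S) else 0) + (2 * β * √G * √(q t) +
        2 * (P.L * P.S) * 2 * (logDet P.L x t - logDet P.L x (t - l))) := by
    intro t ht
    rw [Finset.mem_range] at ht
    split_ifs with h
    · have h1 := R.roundRegret_le hL.le hθ ω ht
      have h2 : 0 ≤ logDet P.L x t - logDet P.L x (t - l) := by
        have := hmono (Nat.sub_le t l); linarith
      have h3 : 0 ≤ 2 * β * √G * √(q t) +
        2 * (P.L * P.S) * 2 * (logDet P.L x t - logDet P.L x (t - l)) := by positivity
      linarith
    · have := R.roundRegret_le_potential hd hm hL hS hσ hp0 hp hδ hδ1 hlam hη hθ hτ hτt hvalid ht₁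
        hl hβ (not_lt.mp h) ht
      rw [zero_add, mul_assoc (2 * (P.L * P.S))]
      exact this
  have hsum1 : ∑ t ∈ Finset.range P.T, (if t < t₁ + l then 2 * (P.L * P.S) else 0) ≤
      2 * (P.L * P.S) * (t₁ + l) := by
    rw [← Finset.sum_filter, Finset.sum_const, nsmul_eq_mul, mul_comm]
    refine mul_le_mul_of_nonneg_left ?_ (by positivity)
    have : (Finset.filter (fun t => t < t₁ + l) (Finset.range P.T)).card ≤ t₁ + l := by
      calc _ ≤ (Finset.range (t₁ + l)).card :=
            Finset.card_le_card fun t ht => by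
              rw [Finset.mem_filter] at ht; exact Finset.mem_range.mpr ht.2
        _ = _ := Finset.card_range _
    exact_mod_cast this
  have hsumq : ∑ t ∈ Finset.range P.T, q t ≤ 4 * P.L ^ 2 * (d * ℓ) := by
    calc ∑ t ∈ Finset.range P.T, q t ≤ ∑ t ∈ Finset.range P.T,
          4 * P.L ^ 2 * (logDet P.L x (t + 1) - logDet P.L x t) :=
          Finset.sum_le_sum fun t ht => quad_inv_le_logDet_sub hL (hxL t (Finset.mem_range.mp ht))
      _ = 4 * P.L ^ 2 * logDet P.L x P.T := by
          rw [← Finset.mul_sum, Finset.sum_range_sub, logDet_zero, sub_zero]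
      _ ≤ _ := by gcongr
  have hsumsqrt : ∑ t ∈ Finset.range P.T, √(q t) ≤ √P.T * (2 * P.L * √(d * ℓ)) := by
    have h1 := Real.sum_sqrt_mul_sqrt_le (s := Finset.range P.T) (f := fun _ => (1 : ℝ)) (g := q)
      (fun _ => zero_le_one) hq0
    simp only [Real.sqrt_one, one_mul, Finset.sum_const, Finset.card_range, nsmul_eq_mul,
      mul_one] at h1
    refine h1.trans (mul_le_mul_of_nonneg_left ?_ (Real.sqrt_nonneg _))
    refine (Real.sqrt_le_sqrt hsumq).trans_eq ?_
    rw [show 4 * P.L ^ 2 * (d * ℓ) = (2 * P.L) ^ 2 * (d * ℓ) by ring,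
      Real.sqrt_mul (by positivity), Real.sqrt_sq (by positivity)]
  have hsumN := sum_sub_shift_le hmono (logDet_zero P.L x) l P.T
  have hsumN2 : ∑ t ∈ Finset.range P.T, (logDet P.L x t - logDet P.L x (t - l)) ≤ l * (d * ℓ) :=
    hsumN.trans (mul_le_mul_of_nonneg_left hlogT (Nat.cast_nonneg l))
  calc R.regret ω = ∑ t ∈ Finset.range P.T, R.roundRegret ω t := rfl
    _ ≤ _ := Finset.sum_le_sum hround
    _ = ∑ t ∈ Finset.range P.T, (if t < t₁ + l then 2 * (P.L * P.S) else 0) +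
        (2 * β * √G * ∑ t ∈ Finset.range P.T, √(q t) + 2 * (P.L * P.S) * 2 *
          ∑ t ∈ Finset.range P.T, (logDet P.L x t - logDet P.L x (t - l))) := by
        rw [Finset.sum_add_distrib, Finset.sum_add_distrib, Finset.mul_sum, Finset.mul_sum]
    _ ≤ 2 * (P.L * P.S) * (t₁ + l) + (2 * β * √G * (√P.T * (2 * P.L * √(d * ℓ))) +
        2 * (P.L * P.S) * 2 * (l * (d * ℓ))) := by gcongr
    _ = _ := by
        have e : √(G * d * ℓ) = √G * √(d * ℓ) := by
          rw [mul_assoc G, Real.sqrt_mul (by rw [hG]; positivity)]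
        rw [e]
        ring

end RegretBound


/-! ### Bounds for the parameters -/

section ParameterBounds

variable {d m : ℕ}

theorem one_div_flipProb_le (hd : 0 < d) (hm : 0 < m) {ε₀ : ℝ} (hε : 0 < ε₀) :
    1 / flipProb d m ε₀ ≤ (Real.exp ε₀ + 1) / 2 := by
  have hd' : (1 : ℝ) ≤ d := by exact_mod_cast hd
  have hm' : (1 : ℝ) ≤ m := by exact_mod_cast hm
  rw [flipProb, one_div_div]
  have h : 2 * ε₀ / (m * d * (d + 3)) ≤ ε₀ := by
    rw [div_le_iff₀ (by positivity)]
    have : (2 : ℝ) ≤ m * d * (d + 3) := by nlinarith [mul_pos (by linarith : (0:ℝ) < m) (by linarith : (0:ℝ) < d)]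
    nlinarith only [this, hε]
  have := Real.exp_le_exp.mpr h
  linarith

/-- With `b = exp (-2 ε₀ / N)` the left side is `(1 + b) / (1 - b)`. As `b ^ N = exp (-2 ε₀)`,
Bernoulli's inequality gives `1 - exp (-2 ε₀) ≤ N (1 - b)`. -/
theorem one_div_one_sub_flipProb_le (hd : 0 < d) (hm : 0 < m) {ε₀ : ℝ} (hε : 0 < ε₀) :
    1 / (1 - flipProb d m ε₀) ≤
      2 * (m * d * (d + 3)) * ((Real.exp ε₀ + 1) / (Real.exp ε₀ - 1)) := by
  have hd' : (0 : ℝ) < d := by exact_mod_cast hd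
  have hm' : (0 : ℝ) < m := by exact_mod_cast hm
  set N : ℕ := m * d * (d + 3) with hN
  have hNr : (m : ℝ) * d * (d + 3) = N := by rw [hN]; push_cast; ring
  have hN0 : (0 : ℝ) < N := by rw [← hNr]; positivity
  rw [flipProb, hNr]
  set e := Real.exp ε₀ with he
  have he1 : 1 < e := by rw [he]; exact Real.one_lt_exp_iff.mpr hε
  set b := Real.exp (-(2 * ε₀ / N)) with hb
  have hb0 : 0 < b := Real.exp_pos _
  have hb1 : b ≤ 1 := Real.exp_le_one_iff.mpr (by rw [neg_nonpos]; positivity)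
  have hab : Real.exp (2 * ε₀ / N) = b⁻¹ := by rw [hb, Real.exp_neg, inv_inv]
  have hbN : b ^ N * e ^ 2 = 1 := by
    rw [hb, he, ← Real.exp_nat_mul, ← Real.exp_nat_mul, ← Real.exp_add, Real.exp_eq_one_iff]
    field_simp
    push_cast
    ring
  have hbern : 1 + N * (b - 1) ≤ b ^ N := by
    have := one_add_mul_le_pow (by linarith : (-2 : ℝ) ≤ b - 1) N
    simpa using this
  have hkey : (e - 1) * (e + 1) ≤ N * (1 - b) * e ^ 2 := by
    have := mul_le_mul_of_nonneg_right hbern (sq_nonneg e)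
    nlinarith only [this, hbN]
  have hb1' : 0 < 1 - b := by
    by_contra! h
    have : N * (1 - b) * e ^ 2 ≤ 0 :=
      mul_nonpos_of_nonpos_of_nonneg (mul_nonpos_of_nonneg_of_nonpos hN0.le h) (sq_nonneg e)
    nlinarith only [this, hkey, he1]
  have e1 : 1 / (1 - 2 / (Real.exp (2 * ε₀ / N) + 1)) = (1 + b) / (1 - b) := by
    rw [hab]
    have h1 : 1 - 2 / (b⁻¹ + 1) = (1 - b) / (1 + b) := by
      field_simp
      ring
    rw [h1, one_div_div]
  rw [e1, ← mul_div_assoc, div_le_div_iff₀ hb1' (by linarith)]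
  have h2 : (e - 1) * (e + 1) ^ 2 ≤ N * (1 - b) * (e + 1) ^ 3 := by
    have h3 := mul_le_mul_of_nonneg_right hkey (by linarith : 0 ≤ e + 1)
    have h4 : e ^ 2 ≤ (e + 1) ^ 2 := pow_le_pow_left₀ (by linarith) (by linarith) 2
    have h5 : N * (1 - b) * e ^ 2 * (e + 1) ≤ N * (1 - b) * (e + 1) ^ 2 * (e + 1) := by gcongr
    nlinarith only [h3, h5]
  have h6 : e - 1 ≤ N * (1 - b) * (e + 1) := by
    have h7 : 0 < (e + 1) ^ 2 := by positivity
    refine le_of_mul_le_mul_right ?_ h7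
    linarith
  nlinarith only [h6, mul_nonneg (sub_nonneg.mpr hb1) (sub_nonneg.mpr he1.le)]

theorem sqrt_le_two_mul {y : ℝ} (hy : 1 / 2 ≤ y) : √y ≤ 2 * y := by
  refine Real.sqrt_le_iff.mpr ⟨by linarith, ?_⟩
  nlinarith only [hy]

theorem Params.reg_le {P : Params d m} (hm : 0 < m) (hp0 : 0 ≤ P.p) (hp : P.p < 1)
    (hδ : 0 < P.delta) (hδ1 : P.delta < 1) (hlam : 0 < P.lam) {t : ℕ} (ht : 1 ≤ t)
    (htT : t ≤ P.T) :
    P.reg t ≤ (18 + 2 * P.lam) * (√P.T * Real.log (2 * P.T / P.delta)) / (1 - P.p) := by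
  have hp' : 0 < 1 - P.p := by linarith
  have hm1 : (1 : ℝ) ≤ m := by exact_mod_cast hm
  have hT1 : (1 : ℝ) ≤ P.T := by exact_mod_cast ht.trans htT
  have hreg := Params.reg_mono hp hδ hδ1 ht htT
  refine hreg.trans ?_
  set ℓ := Real.log (2 * P.T / P.delta) with hℓ
  have hℓ0 : 1 / 2 ≤ ℓ := half_le_log hδ hδ1 (ht.trans htT)
  have h1 : √(8 * P.T * ℓ) ≤ 6 * (√P.T * ℓ) := by
    have h8 : √(8 : ℝ) ≤ 3 := Real.sqrt_le_iff.mpr ⟨by norm_num, by norm_num⟩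
    have h2 := sqrt_le_two_mul hℓ0
    rw [Real.sqrt_mul (by positivity), Real.sqrt_mul (by norm_num)]
    calc √8 * √P.T * √ℓ ≤ 3 * √P.T * (2 * ℓ) := by gcongr
      _ = _ := by ring
  have hsT : 1 ≤ √(P.T : ℝ) := Real.one_le_sqrt.mpr hT1
  have hsm : 1 ≤ √(m : ℝ) := Real.one_le_sqrt.mpr hm1
  have hw0 : 0 ≤ √P.T * ℓ := by positivity
  have e : P.reg P.T = √(8 * P.T * ℓ) / m + 2 * √(8 * P.T * ℓ) / ((1 - P.p) * √m) + P.lam := rfl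
  rw [e, le_div_iff₀ hp', add_mul, add_mul]
  have a1 : √(8 * P.T * ℓ) / m * (1 - P.p) ≤ 6 * (√P.T * ℓ) := by
    have : √(8 * P.T * ℓ) / m ≤ 6 * (√P.T * ℓ) := (div_le_self (Real.sqrt_nonneg _) hm1).trans h1
    have hpos : 0 ≤ √(8 * P.T * ℓ) / m := by positivity
    nlinarith only [this, hp0, hpos]
  have a2 : 2 * √(8 * P.T * ℓ) / ((1 - P.p) * √m) * (1 - P.p) ≤ 12 * (√P.T * ℓ) := by
    have e2 : 2 * √(8 * P.T * ℓ) / ((1 - P.p) * √m) * (1 - P.p) = 2 * √(8 * P.T * ℓ) / √m := by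
      field_simp
    rw [e2]
    exact (div_le_self (by positivity) hsm).trans (by linarith)
  have a3 : P.lam * (1 - P.p) ≤ 2 * P.lam * (√P.T * ℓ) := by
    have : 1 / 2 ≤ √P.T * ℓ := by nlinarith only [hsT, hℓ0]
    nlinarith only [this, hp0, hlam]
  linarith

theorem Params.reg_lower_bounds {P : Params d m} (hm : 0 < m) (hp0 : 0 ≤ P.p) (hp : P.p < 1)
    (hδ : 0 < P.delta) (hδ1 : P.delta < 1) (hlam : 0 < P.lam) {t : ℕ} (ht : 1 ≤ t) :
    P.lam ≤ P.reg t ∧ √(t * Real.log (2 * t / P.delta)) ≤ √m * P.reg t ∧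
      1 / √(P.reg t) ≤ m := by
  have hp' : 0 < 1 - P.p := by linarith
  have hm1 : (1 : ℝ) ≤ m := by exact_mod_cast hm
  have ht1 : (1 : ℝ) ≤ t := by exact_mod_cast ht
  have hregge := reg_ge (P := P) hp rfl hδ ht (le_refl t)
  set ℓt := Real.log (2 * t / P.delta) with hℓt
  have hℓt0 : 1 / 2 ≤ ℓt := half_le_log hδ hδ1 ht
  set Λ := P.reg t with hΛ
  have hsm1 : 1 ≤ √(m : ℝ) := Real.one_le_sqrt.mpr hm1
  have hsmm : √(m : ℝ) * √m = m := Real.mul_self_sqrt (by linarith)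
  have hsm : √(m : ℝ) ≤ m := by nlinarith only [hsm1, hsmm]
  have hs2 : 1 ≤ √(2 : ℝ) := Real.one_le_sqrt.mpr (by norm_num)
  have hw : 4 * (√(t * ℓt) / √m) ≤ Λ := by
    have h1 : √(t * ℓt) / √m ≤ √(t * ℓt) / ((1 - P.p) * √m) :=
      div_le_div_of_nonneg_left (Real.sqrt_nonneg _) (by positivity)
        (mul_le_of_le_one_left (Real.sqrt_nonneg _) (by linarith))
    have h2 : 4 * (√(t * ℓt) / ((1 - P.p) * √m)) ≤
        4 * √2 * (√(t * ℓt) / ((1 - P.p) * √m)) :=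
      mul_le_mul_of_nonneg_right (by linarith) (by positivity)
    linarith
  have hw0 : 0 ≤ √(t * ℓt) / √m := by positivity
  have htl : √(t * ℓt) ≤ √m * Λ := by
    have h3 : √(t * ℓt) / √m ≤ Λ := by linarith
    rwa [div_le_iff₀ (by positivity), mul_comm Λ] at h3
  have hΛlam : P.lam ≤ Λ := by
    have : 0 ≤ 4 * √2 * (√(t * ℓt) / ((1 - P.p) * √m)) := by positivity
    linarith
  have hΛ0 : 0 < Λ := by linarith
  have hhalf : 1 / 2 ≤ √(t * ℓt) := by
    refine Real.le_sqrt_of_sq_le ?_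
    nlinarith only [ht1, hℓt0]
  have hmΛ : 1 ≤ m * (m * Λ) := by
    have h1 : 1 / 2 / √m ≤ √(t * ℓt) / √m := by gcongr
    have h2 : 1 / √m ≤ Λ := by
      have : 1 / √(m : ℝ) = 2 * (1 / 2 / √m) := by ring
      linarith
    rw [div_le_iff₀ (by positivity)] at h2
    have h3 : Λ * √m ≤ Λ * m := mul_le_mul_of_nonneg_left hsm hΛ0.le
    have h4 : m * Λ ≤ m * (m * Λ) := le_mul_of_one_le_left (by positivity) hm1
    linarith
  have hsΛ : 0 < √Λ := Real.sqrt_pos.mpr hΛ0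
  have hinv : 1 / √Λ ≤ m := by
    rw [div_le_iff₀ hsΛ]
    have : 1 ≤ (m * √Λ) ^ 2 := by
      rw [mul_pow, Real.sq_sqrt hΛ0.le, sq, mul_assoc]; exact hmΛ
    exact (one_le_sq_iff₀ (by positivity)).mp this
  exact ⟨hΛlam, htl, hinv⟩

/-- The constant of the confidence width. -/
noncomputable def widthConst (d m : ℕ) (L S σ lam : ℝ) : ℝ :=
  2 * σ * √(8 + d * (1 + 2 * Real.log (3 + L ^ 2 / lam))) +
    (2 * S + 5 * d * m) * (2 * √(18 + 2 * lam)) + 3 * d * m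

set_option maxHeartbeats 600000 in
-- `√(λ(t))` has order `T ^ (1 / 4) / √(1 - p)` up to logarithms, which sets the rate. In the last
-- summand of `β`, the bound `√(t log) ≤ √m λ(t)` turns the division by `√(λ(t))` into a multiple of
-- `√(λ(t))`.
theorem Params.width_le {P : Params d m} (hm : 0 < m) (hp0 : 0 ≤ P.p) (hp : P.p < 1)
    (hδ : 0 < P.delta) (hδ1 : P.delta < 1) (hlam : 0 < P.lam) (hσ : 0 ≤ P.σ) (hS : 0 ≤ P.S)
    {t : ℕ} (ht : 1 ≤ t) (htT : t ≤ P.T) :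
    P.width t ≤ widthConst d m P.L P.S P.σ P.lam *
      (Real.log (2 * P.T / P.delta) * √√P.T / √(1 - P.p)) := by
  have hp' : 0 < 1 - P.p := by linarith
  have hm1 : (1 : ℝ) ≤ m := by exact_mod_cast hm
  have ht1 : (1 : ℝ) ≤ t := by exact_mod_cast ht
  have htT' : (t : ℝ) ≤ P.T := by exact_mod_cast htT
  have hT1 : (1 : ℝ) ≤ P.T := ht1.trans htT'
  have hregle := Params.reg_le hm hp0 hp hδ hδ1 hlam ht htT
  obtain ⟨hΛlam, htl, hinv⟩ := Params.reg_lower_bounds hm hp0 hp hδ hδ1 hlam ht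
  set ℓ := Real.log (2 * P.T / P.delta) with hℓ
  have hℓ0 : 1 / 2 ≤ ℓ := half_le_log hδ hδ1 (ht.trans htT)
  set ℓt := Real.log (2 * t / P.delta) with hℓt
  have hℓt0 : 1 / 2 ≤ ℓt := half_le_log hδ hδ1 ht
  have hℓtℓ : ℓt ≤ ℓ := Real.log_le_log (by positivity) (by gcongr)
  set Λ := P.reg t with hΛ
  set q := √√(P.T : ℝ) with hq
  set g := √(1 - P.p) with hg
  have hg0 : 0 < g := Real.sqrt_pos.mpr hp'
  have hg1 : g ≤ 1 := Real.sqrt_le_one.mpr (by linarith)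
  have hq1 : 1 ≤ q := Real.one_le_sqrt.mpr (Real.one_le_sqrt.mpr hT1)
  set X := ℓ * q / g with hX
  have hℓX : ℓ ≤ X := by
    rw [hX, le_div_iff₀ hg0]
    nlinarith only [hq1, hg1, hℓ0, hg0]
  have hsm1 : 1 ≤ √(m : ℝ) := Real.one_le_sqrt.mpr hm1
  have hsmm : √(m : ℝ) * √m = m := Real.mul_self_sqrt (by linarith)
  have hsm : √(m : ℝ) ≤ m := by nlinarith only [hsm1, hsmm]
  have hΛ0 : 0 < Λ := by linarith
  have hsΛ : 0 < √Λ := Real.sqrt_pos.mpr hΛ0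
  have hΛΛ : √Λ * √Λ = Λ := Real.mul_self_sqrt hΛ0.le
  have htΛ : √(t * ℓt) / √Λ ≤ √m * √Λ := by
    rw [div_le_iff₀ hsΛ, mul_assoc, hΛΛ]; exact htl
  have hsX : √Λ ≤ 2 * √(18 + 2 * P.lam) * X := by
    have h1 := Real.sqrt_le_sqrt hregle
    rw [Real.sqrt_div (by positivity), Real.sqrt_mul (by positivity),
      Real.sqrt_mul (Real.sqrt_nonneg _)] at h1
    refine h1.trans ?_
    have h2 := sqrt_le_two_mul hℓ0
    calc √(18 + 2 * P.lam) * (q * √ℓ) / g ≤ √(18 + 2 * P.lam) * (q * (2 * ℓ)) / g := by gcongr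
      _ = _ := by rw [hX]; ring
  have hX0 : 0 ≤ X := by linarith
  have t1 : P.σ * √(8 * ℓt + d * Real.log (3 + t * P.L ^ 2 / Λ)) ≤
      2 * P.σ * √(8 + d * (1 + 2 * Real.log (3 + P.L ^ 2 / P.lam))) * X := by
    set E := Real.log (3 + P.L ^ 2 / P.lam) with hE
    have hE0 : 0 ≤ E := Real.log_nonneg (by
      have : 0 ≤ P.L ^ 2 / P.lam := by positivity
      linarith)
    have h1 : Real.log (3 + t * P.L ^ 2 / Λ) ≤ (1 + 2 * E) * ℓ := by
      have h2 : 3 + t * P.L ^ 2 / Λ ≤ (3 + P.L ^ 2 / P.lam) * (2 * P.T / P.delta) := by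
        have h3 : t * P.L ^ 2 / Λ ≤ P.T * (P.L ^ 2 / P.lam) := by
          rw [← mul_div_assoc]; gcongr
        have h4 : (P.T : ℝ) ≤ 2 * P.T / P.delta := by
          rw [le_div_iff₀ hδ]; nlinarith only [hT1, hδ1]
        have h5 : 0 ≤ P.L ^ 2 / P.lam := by positivity
        calc 3 + t * P.L ^ 2 / Λ ≤ (3 + P.L ^ 2 / P.lam) * P.T := by nlinarith only [h3, hT1, h5]
          _ ≤ _ := by gcongr
      have h6 : Real.log (3 + t * P.L ^ 2 / Λ) ≤ E + ℓ := by
        rw [hE, hℓ, ← Real.log_mul (by positivity) (by positivity)]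
        exact Real.log_le_log (by positivity) h2
      nlinarith only [h6, hℓ0, hE0]
    have h7 : √(8 * ℓt + d * Real.log (3 + t * P.L ^ 2 / Λ)) ≤
        √(8 + d * (1 + 2 * E)) * (2 * ℓ) := by
      refine (Real.sqrt_le_sqrt (show _ ≤ (8 + d * (1 + 2 * E)) * ℓ from ?_)).trans ?_
      · have := mul_le_mul_of_nonneg_left h1 (Nat.cast_nonneg (α := ℝ) d)
        nlinarith only [this, hℓtℓ]
      · rw [Real.sqrt_mul (by positivity)]
        exact mul_le_mul_of_nonneg_left (sqrt_le_two_mul hℓ0) (Real.sqrt_nonneg _)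
    calc _ ≤ P.σ * (√(8 + d * (1 + 2 * E)) * (2 * ℓ)) := by gcongr
      _ ≤ P.σ * (√(8 + d * (1 + 2 * E)) * (2 * X)) := by gcongr
      _ = _ := by ring
  have t2 : P.S * √(3 * Λ) ≤ 2 * P.S * √Λ := by
    rw [Real.sqrt_mul (by norm_num)]
    have : √(3 : ℝ) ≤ 2 := Real.sqrt_le_iff.mpr ⟨by norm_num, by norm_num⟩
    calc P.S * (√3 * √Λ) ≤ P.S * (2 * √Λ) := by gcongr
      _ = _ := by ring
  have t3 : d / √Λ * (2 * √(P.p * (1 - P.p / 2) * t * m * ℓt) + 8 * ℓt / 3 +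
      √8 / m * √(t * ℓt)) ≤ 5 * d * m * √Λ + 3 * d * m * ℓ := by
    have h1 : √(P.p * (1 - P.p / 2) * t * m * ℓt) ≤ √m * √(t * ℓt) := by
      rw [← Real.sqrt_mul (by linarith)]
      refine Real.sqrt_le_sqrt ?_
      have : P.p * (1 - P.p / 2) ≤ 1 := by nlinarith only [hp0, hp]
      have h0 : 0 ≤ t * m * ℓt := by positivity
      nlinarith only [this, h0]
    have h8 : √(8 : ℝ) ≤ 3 := Real.sqrt_le_iff.mpr ⟨by norm_num, by norm_num⟩
    have h2 : √8 / m * √(t * ℓt) ≤ 3 * (√m * √(t * ℓt)) := by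
      have : √8 / m ≤ 3 * √m := by
        rw [div_le_iff₀ (by linarith)]
        nlinarith only [h8, hsm1, hm1]
      calc _ ≤ 3 * √m * √(t * ℓt) := by gcongr
        _ = _ := by ring
    calc _ ≤ d / √Λ * (2 * (√m * √(t * ℓt)) + 3 * ℓ + 3 * (√m * √(t * ℓt))) := by
          have : 8 * ℓt / 3 ≤ 3 * ℓ := by linarith
          gcongr
      _ = 5 * d * √m * (√(t * ℓt) / √Λ) + 3 * d * ℓ * (1 / √Λ) := by ring
      _ ≤ 5 * d * √m * (√m * √Λ) + 3 * d * ℓ * m := by gcongr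
      _ = 5 * d * (√m * √m) * √Λ + 3 * d * m * ℓ := by ring
      _ = _ := by rw [hsmm]
  have e : P.width t = P.σ * √(8 * ℓt + d * Real.log (3 + t * P.L ^ 2 / Λ)) + P.S * √(3 * Λ) +
      d / √Λ * (2 * √(P.p * (1 - P.p / 2) * t * m * ℓt) + 8 * ℓt / 3 + √8 / m * √(t * ℓt)) := rfl
  rw [e]
  have t4 : (2 * P.S + 5 * d * m) * √Λ ≤ (2 * P.S + 5 * d * m) * (2 * √(18 + 2 * P.lam) * X) :=
    mul_le_mul_of_nonneg_left hsX (by positivity)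
  have t5 : 3 * d * m * ℓ ≤ 3 * d * m * X := mul_le_mul_of_nonneg_left hℓX (by positivity)
  rw [widthConst]
  linarith

/-- Any admissible length bounds the least one, so it is enough to test `n = ⌈a⌉ + ⌈b⌉`. From `n ≥
a` follows `n p ≥ 800 G`, which makes the inner square root at most `1 / 20`. From `n ≥ b` follows
`A ≥ 1`, and then `A ^ 2 + 4 A ≥ (A + 11 / 10) ^ 2`. -/
theorem Params.batchLength_bounds {P : Params d m} (hd : 0 < d) (hm : 0 < m) (hT : 1 ≤ P.T)
    (hp0 : 0 < P.p) (hp : P.p < 1) (hε : 0 < P.eps) (hδ : 0 < P.deltaPriv)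
    (hδ1 : P.deltaPriv < 1) :
    0 < P.batchLength ∧ P.batchLength ≤
      (1 + 2 * Real.log (4 * m)) * (804 * (Real.log (2 * P.T / P.deltaPriv) / P.p) +
        96 * d * (d + 3) * (Real.log (2 * P.T / P.deltaPriv) ^ 2 * √P.T / P.eps)) := by
  have hm1 : (1 : ℝ) ≤ m := by exact_mod_cast hm
  have hd1 : (1 : ℝ) ≤ d := by exact_mod_cast hd
  have hT1 : (1 : ℝ) ≤ P.T := by exact_mod_cast hT
  set ℓ := Real.log (2 * P.T / P.deltaPriv) with hℓ
  have hℓ0 : 1 / 2 ≤ ℓ := half_le_log hδ hδ1 hT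
  set G := Real.log (8 * m * P.T / P.deltaPriv) with hG
  have hGeq : G = Real.log (4 * m) + ℓ := by
    rw [hG, hℓ, ← Real.log_mul (by positivity) (by positivity)]
    congr 1; ring
  have hlm : 0 ≤ Real.log (4 * m) := Real.log_nonneg (by linarith)
  have hG0 : 1 / 2 ≤ G := by linarith
  have hGle : G ≤ (1 + 2 * Real.log (4 * m)) * ℓ := by rw [hGeq]; nlinarith only [hlm, hℓ0]
  have hG' : Real.log (2 * m * P.T / P.deltaPriv) ≤ G := by
    refine Real.log_le_log (by positivity) ?_
    gcongr
    norm_num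
  have hsq : √(2 * P.T * ℓ) ≤ 3 * (ℓ * √P.T) := by
    have h2 : √(2 : ℝ) ≤ 3 / 2 := Real.sqrt_le_iff.mpr ⟨by norm_num, by norm_num⟩
    rw [Real.sqrt_mul (by positivity), Real.sqrt_mul (by norm_num)]
    calc √2 * √P.T * √ℓ ≤ 3 / 2 * √P.T * (2 * ℓ) := by
          gcongr; exact sqrt_le_two_mul hℓ0
      _ = _ := by ring
  have hs0 : 0 < √(2 * P.T * ℓ) := Real.sqrt_pos.mpr (by positivity)
  set a := 800 * G / P.p with ha
  set b := 32 * d * (d + 3) * G * √(2 * P.T * ℓ) / P.eps with hb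
  have ha0 : 0 < a := by positivity
  have hb0 : 0 < b := by positivity
  set n := ⌈a⌉₊ + ⌈b⌉₊ with hn
  have hna : a ≤ n := by
    rw [hn]; push_cast
    linarith [Nat.le_ceil a, Nat.cast_nonneg (α := ℝ) ⌈b⌉₊]
  have hnb : b ≤ n := by
    rw [hn]; push_cast
    linarith [Nat.le_ceil b, Nat.cast_nonneg (α := ℝ) ⌈a⌉₊]
  have hnle : (n : ℝ) ≤ a + b + 2 := by
    rw [hn]; push_cast
    linarith [Nat.ceil_lt_add_one ha0.le, Nat.ceil_lt_add_one hb0.le]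
  have hn0 : (0 : ℝ) < n := by linarith
  have hnp : 800 * G ≤ n * P.p := by rwa [ha, div_le_iff₀ hp0] at hna
  have hadm : P.AdmissibleLength n := by
    unfold Params.AdmissibleLength
    rw [← hG, ← hℓ]
    refine ⟨by linarith, ?_⟩
    set A := (P.eps * n / (32 * d * (d + 3) * G * √(2 * P.T * ℓ))) ^ 2 with hA
    have hA1 : 1 ≤ A := by
      refine one_le_pow₀ ?_
      rw [one_le_div (by positivity), mul_comm P.eps]
      rwa [hb, div_le_iff₀ hε] at hnb
    have h1 : √(2 * Real.log (2 * m * P.T / P.deltaPriv) / n) ≤ 1 / 20 := by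
      refine Real.sqrt_le_iff.mpr ⟨by norm_num, ?_⟩
      rw [div_le_iff₀ hn0]
      nlinarith only [hG', hnp, hp, hn0]
    refine Real.le_sqrt_of_sq_le ?_
    have h2 : 1 - 2 * P.p + 2 * √(2 * Real.log (2 * m * P.T / P.deltaPriv) / n) + A ≤ A + 11 / 10 := by
      linarith
    have h3 : 0 ≤ 1 - 2 * P.p + 2 * √(2 * Real.log (2 * m * P.T / P.deltaPriv) / n) + A := by
      have := Real.sqrt_nonneg (2 * Real.log (2 * m * P.T / P.deltaPriv) / n)
      linarith
    have h4 := pow_le_pow_left₀ h3 h2 2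
    nlinarith only [h4, h2, h3, hA1]
  constructor
  -- The infimum of an empty set of naturals would be 0. The witness `n` excludes this, and 0 itself
  -- is not admissible.
  · rcases Nat.eq_zero_or_pos P.batchLength with h | h
    · have hmem : P.AdmissibleLength P.batchLength :=
        Nat.sInf_mem (s := {l : ℕ | P.AdmissibleLength l}) ⟨n, hadm⟩
      have := hmem.1
      rw [h, Nat.cast_zero, zero_mul, ← hG] at this
      linarith
    · exact h
  · have h1 : P.batchLength ≤ n := Nat.sInf_le hadm
    have h2 : (P.batchLength : ℝ) ≤ n := by exact_mod_cast h1
    have h3 : (2 : ℝ) ≤ 4 * (G / P.p) := by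
      have : G ≤ G / P.p := by
        rw [le_div_iff₀ hp0]; nlinarith only [hG0, hp]
      linarith
    have h4 : b ≤ 96 * d * (d + 3) * (G * (ℓ * √P.T) / P.eps) := by
      calc b ≤ 32 * d * (d + 3) * G * (3 * (ℓ * √P.T)) / P.eps := by rw [hb]; gcongr
        _ = _ := by ring
    set k := 1 + 2 * Real.log (4 * m) with hk
    calc (P.batchLength : ℝ) ≤ 804 * (G / P.p) + 96 * d * (d + 3) * (G * (ℓ * √P.T) / P.eps) := by
          have : a = 800 * (G / P.p) := by rw [ha]; ring
          linarith
      _ ≤ 804 * (k * ℓ / P.p) + 96 * d * (d + 3) * (k * ℓ * (ℓ * √P.T) / P.eps) := by gcongr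
      _ = _ := by ring

end ParameterBounds


/-! ### The regret bound -/

section FinalBound

theorem exists_two_pow_near {y : ℝ} (hy : 1 ≤ y) : ∃ k : ℕ, y ≤ 2 ^ k ∧ (2 : ℝ) ^ k ≤ 2 * y := by
  obtain ⟨n, h1, h2⟩ := exists_nat_pow_near hy (by norm_num : (1 : ℝ) < 2)
  exact ⟨n + 1, h2.le, by rw [pow_succ]; linarith⟩

/-- The logarithm is only known to be at least `1 / 2`, so raising its exponent costs a factor 2 per
degree. -/
theorem pow_le_of_half_le {ℓ : ℝ} (hℓ : 1 / 2 ≤ ℓ) (i j : ℕ) : ℓ ^ i ≤ 2 ^ j * ℓ ^ (i + j) := by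
  have h : 1 ≤ (2 * ℓ) ^ j := one_le_pow₀ (by linarith)
  calc ℓ ^ i ≤ ℓ ^ i * (2 * ℓ) ^ j := le_mul_of_one_le_right (by positivity) h
    _ = _ := by rw [mul_pow, pow_add]; ring

theorem sqrt_sqrt_mul_sqrt {y : ℝ} (hy : 0 < y) : √√y * √y = y ^ (3 / 4 : ℝ) := by
  rw [Real.sqrt_eq_rpow, Real.sqrt_eq_rpow, ← Real.rpow_mul hy.le, ← Real.rpow_add hy]
  norm_num

/-- The multiple of `log (2 T / δ) ^ 4 * δ ^ (-(1 / s ^ 2 - 1))` by which the statistics become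
accurate, where `s = min 1 (L S)`. -/
noncomputable def scaleConst (d m : ℕ) (L S lam : ℝ) : ℝ :=
  16 + 16 * (netConst d / (1 - (2 : ℝ) ^ (-(min 1 (L * S)) ^ 2))) ^ (1 / (min 1 (L * S)) ^ 2) +
    rootConst d m (L * S / 40) lam ^ 4

/-- The constant of the number of rounds whose regret is bounded trivially. -/
noncomputable def burnInConst (d m : ℕ) (L S lam η : ℝ) : ℝ :=
  4 * (m * ((1 + η) * d.factorial * (37 + 4 * lam)) ^ 2) * scaleConst d m L S lam ^ 2 +
    256 * scaleConst d m L S lam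

/-- The constant of the regret bound. -/
noncomputable def regretConst (d m : ℕ) (L S σ lam η : ℝ) : ℝ :=
  2 * (L * S) * burnInConst d m L S lam η +
  2 * (L * S) * (2 + 2 * d) * (1 + 2 * Real.log (4 * m)) * (402 * 4 * 256) +
  2 * (L * S) * (2 + 2 * d) * (1 + 2 * Real.log (4 * m)) * (96 * d * (d + 3) * 128) +
  8 * L * √(2 * ((3 / 2) ^ d * (1 + η)) * d) * widthConst d m L S σ lam *
    √(2 * (m * d * (d + 3))) * 256 + 2 * (L * S) * 1024

theorem netConst_nonneg (d : ℕ) : 0 ≤ netConst d := by unfold netConst; positivity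

theorem rootConst_nonneg (d m : ℕ) {γ lam : ℝ} (hγ : 0 < γ) (hlam : 0 < lam) :
    0 ≤ rootConst d m γ lam := by unfold rootConst; positivity

theorem widthConst_nonneg (d m : ℕ) {L S σ lam : ℝ} (hS : 0 < S) (hσ : 0 < σ)
    (hlam : 0 < lam) : 0 ≤ widthConst d m L S σ lam := by unfold widthConst; positivity

theorem scaleConst_base_nonneg (d : ℕ) (s : ℝ) :
    0 ≤ (netConst d / (1 - (2 : ℝ) ^ (-s ^ 2))) ^ (1 / s ^ 2) := by
  refine Real.rpow_nonneg (div_nonneg (netConst_nonneg d) ?_) _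
  have : (2 : ℝ) ^ (-s ^ 2) ≤ 1 :=
    Real.rpow_le_one_of_one_le_of_nonpos (by norm_num) (by nlinarith [sq_nonneg s])
  linarith

theorem scaleConst_nonneg (d m : ℕ) {L S lam : ℝ} (hL : 0 < L) (hS : 0 < S) (hlam : 0 < lam) :
    0 ≤ scaleConst d m L S lam := by
  have h1 := scaleConst_base_nonneg d (min 1 (L * S))
  have h2 := rootConst_nonneg d m (by positivity : 0 < L * S / 40) hlam
  unfold scaleConst
  positivity

theorem exists_start_scale (d m : ℕ) {L S lam δ ℓ : ℝ} (hL : 0 < L) (hS : 0 < S) (hlam : 0 < lam)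
    (hδ : 0 < δ) (hδ1 : δ < 1) (hℓ : 1 / 2 ≤ ℓ) :
    ∃ k₀ : ℕ,
      (netConst d / (1 - (2 : ℝ) ^ (-(min 1 (L * S)) ^ 2))) ^ (1 / (min 1 (L * S)) ^ 2) *
        δ ^ (-(1 / (min 1 (L * S)) ^ 2 - 1)) ≤ 2 ^ k₀ ∧
      rootConst d m (L * S / 40) lam * ℓ ≤ √√(2 ^ k₀) ∧
      (2 : ℝ) ^ k₀ ≤ 2 * (scaleConst d m L S lam * (ℓ ^ 4 *
        δ ^ (-(1 / (min 1 (L * S)) ^ 2 - 1)))) := by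
  set s := min 1 (L * S) with hsdef
  have hs : 0 < s := lt_min one_pos (by positivity)
  have hs1 : s ≤ 1 := min_le_left _ _
  have hD0 := scaleConst_base_nonneg d s
  set D := (netConst d / (1 - (2 : ℝ) ^ (-s ^ 2))) ^ (1 / s ^ 2) with hD
  have hr0 := rootConst_nonneg d m (by positivity : 0 < L * S / 40) hlam
  set r := rootConst d m (L * S / 40) lam with hr
  have hΔ1 : 1 ≤ δ ^ (-(1 / s ^ 2 - 1)) := by
    refine Real.one_le_rpow_of_pos_of_le_one_of_nonpos hδ hδ1.le ?_
    have : 1 ≤ 1 / s ^ 2 := by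
      rw [le_div_iff₀ (by positivity)]; nlinarith
    linarith
  set Δ := δ ^ (-(1 / s ^ 2 - 1)) with hΔ
  have hℓ0 : 0 ≤ ℓ := by linarith
  have hDΔ : 0 ≤ D * Δ := by positivity
  have hrℓ : 0 ≤ (r * ℓ) ^ 4 := by positivity
  obtain ⟨k, h1, h2⟩ := exists_two_pow_near (by linarith : 1 ≤ 1 + D * Δ + (r * ℓ) ^ 4)
  refine ⟨k, by linarith, ?_, ?_⟩
  · refine Real.le_sqrt_of_sq_le (Real.le_sqrt_of_sq_le ?_)
    calc ((rootConst d m (L * S / 40) lam * ℓ) ^ 2) ^ 2 = (r * ℓ) ^ 4 := by rw [hr]; ring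
      _ ≤ 2 ^ k := by linarith
  · refine h2.trans (mul_le_mul_of_nonneg_left ?_ (by norm_num))
    have hℓ4 := pow_le_of_half_le hℓ 0 4
    norm_num at hℓ4
    have hΔ0 : 0 ≤ Δ := by linarith
    have e : scaleConst d m L S lam * (ℓ ^ 4 * Δ) =
        16 * ℓ ^ 4 * Δ + D * Δ * (16 * ℓ ^ 4) + (r * ℓ) ^ 4 * Δ := by
      rw [scaleConst, ← hsdef, ← hD, ← hr]; ring
    rw [e]
    have a1 : 1 ≤ 16 * ℓ ^ 4 * Δ := one_le_mul_of_one_le_of_one_le hℓ4 hΔ1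
    have a2 : D * Δ ≤ D * Δ * (16 * ℓ ^ 4) := le_mul_of_one_le_right hDΔ hℓ4
    have a3 : (r * ℓ) ^ 4 ≤ (r * ℓ) ^ 4 * Δ := le_mul_of_one_le_right hrℓ hΔ1
    linarith

/-- The burn-in is quadratic in `τ ℓ`, and `τ` has order `ℓ ^ 4 Δ`: this produces `Δ ^ 2` and the
power 10 of the logarithm. The additional `1 + τ` covers rounding up and the start of the first
controlled block. -/
theorem burn_in_le (d m : ℕ) {L S lam η ℓ Δ τ : ℝ} (hL : 0 < L) (hS : 0 < S) (hlam : 0 < lam)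
    (hη : 0 < η) (hℓ : 1 / 2 ≤ ℓ) (hΔ : 1 ≤ Δ) (hτ1 : 1 ≤ τ)
    (hτ : τ ≤ 2 * (scaleConst d m L S lam * (ℓ ^ 4 * Δ))) :
    m * ((1 + η) * d.factorial * ((37 + 4 * lam) * (τ * ℓ))) ^ 2 + 1 + τ ≤
      burnInConst d m L S lam η * (Δ ^ 2 * ℓ ^ 10) := by
  have hK := scaleConst_nonneg d m hL hS hlam
  set k := scaleConst d m L S lam with hk
  set M := m * ((1 + η) * d.factorial * (37 + 4 * lam)) ^ 2 with hM
  have hM0 : 0 ≤ M := by positivity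
  have hℓ0 : 0 ≤ ℓ := by linarith
  have e1 : m * ((1 + η) * d.factorial * ((37 + 4 * lam) * (τ * ℓ))) ^ 2 = M * τ ^ 2 * ℓ ^ 2 := by
    rw [hM]; ring
  have h1 : M * τ ^ 2 * ℓ ^ 2 ≤ M * (2 * (k * (ℓ ^ 4 * Δ))) ^ 2 * ℓ ^ 2 := by gcongr
  have h2 : 2 * (2 * (k * (ℓ ^ 4 * Δ))) ≤ 256 * k * (Δ ^ 2 * ℓ ^ 10) := by
    have h3 := pow_le_of_half_le hℓ 4 6
    norm_num at h3
    have h4 : Δ ≤ Δ ^ 2 := by nlinarith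
    calc 2 * (2 * (k * (ℓ ^ 4 * Δ))) ≤ 2 * (2 * (k * (64 * ℓ ^ 10 * Δ ^ 2))) := by gcongr
      _ = _ := by ring
  rw [e1]
  calc M * τ ^ 2 * ℓ ^ 2 + 1 + τ
      ≤ M * (2 * (k * (ℓ ^ 4 * Δ))) ^ 2 * ℓ ^ 2 + 256 * k * (Δ ^ 2 * ℓ ^ 10) := by linarith
    _ = _ := by rw [burnInConst, ← hk, ← hM]; ring

variable {Ω : Type*} [mΩ : MeasurableSpace Ω] {μ : Measure Ω} {d m : ℕ}
  {P : Params d m} {K : ℕ} {θstar : EuclideanSpace ℝ (Fin d)}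

theorem rate_ge_one {T ε₀ : ℝ} (hT : 1 ≤ T) (hε : 0 < ε₀) :
    1 ≤ T ^ (3 / 4 : ℝ) * √(Real.exp ε₀ + 1) / √(Real.exp ε₀ - 1) := by
  have he := Real.one_lt_exp_iff.mpr hε
  have h0 : 0 < √(Real.exp ε₀ - 1) := Real.sqrt_pos.mpr (by linarith)
  rw [le_div_iff₀ h0, one_mul]
  have h1 : √(Real.exp ε₀ - 1) ≤ √(Real.exp ε₀ + 1) := Real.sqrt_le_sqrt (by linarith)
  have h2 : 1 ≤ T ^ (3 / 4 : ℝ) := Real.one_le_rpow hT (by norm_num)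
  nlinarith [Real.sqrt_nonneg (Real.exp ε₀ + 1)]

set_option maxHeartbeats 1000000 in
/-- On the event where the statistics are accurate from round `2 ^ k₀` on, the regret satisfies the
claimed bound. -/
theorem Run.regret_le_rate [IsProbabilityMeasure μ] (R : Run μ P K θstar) (hd : 0 < d) (hm : 0 < m)
    (hL : 0 < P.L) (hS : 0 < P.S) (hσ : 0 < P.σ) (hε : 0 < P.epsLocal)
    (hPε : P.eps = √(Real.exp P.epsLocal - 1)) (hPδ : P.deltaPriv = P.delta)
    (hδ : 0 < P.delta) (hδ1 : P.delta < 1) (hlam : 0 < P.lam) (hη : 0 < P.eta)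
    (hθ : ‖θstar‖ ≤ P.S) (hT : 2 ≤ P.T) {ω : Ω} {k₀ : ℕ} {Δ : ℝ} (hΔ : 1 ≤ Δ)
    (hτ : (2 : ℝ) ^ k₀ ≤ 2 * (scaleConst d m P.L P.S P.lam *
      (Real.log (2 * P.T / P.delta) ^ 4 * Δ)))
    (hvalid : ∀ t, 2 ^ k₀ ≤ t → t ≤ P.T →
      ValidAt P P.S θstar.ofLp (R.feature ω) (fun s => R.report s ω) t) :
    R.regret ω ≤ regretConst d m P.L P.S P.σ P.lam P.eta * Δ ^ 2 *
      Real.log (2 * P.T / P.delta) ^ 10 *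
      ((P.T : ℝ) ^ (3 / 4 : ℝ) * √(Real.exp P.epsLocal + 1) / √(Real.exp P.epsLocal - 1)
        + Real.log P.T * (Real.exp P.epsLocal + 1) ^ 2 / 4
        + √P.T / √(Real.exp P.epsLocal - 1)) := by
  have hp0 : 0 < P.p := flipProb_pos _ _ _
  have hp : P.p < 1 := flipProb_lt_one hd hm hε
  have hm1 : (1 : ℝ) ≤ m := by exact_mod_cast hm
  have hT1 : (1 : ℝ) ≤ P.T := by exact_mod_cast (show 1 ≤ P.T by omega)
  have hT2 : (2 : ℝ) ≤ P.T := by exact_mod_cast hT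
  have he := Real.one_lt_exp_iff.mpr hε
  have hlm : 0 ≤ Real.log (4 * m) := Real.log_nonneg (by linarith)
  have hF1 := rate_ge_one hT1 hε
  have hpinv : 1 / P.p ≤ (Real.exp P.epsLocal + 1) / 2 := one_div_flipProb_le hd hm hε
  have hpinv2 : 1 / (1 - P.p) ≤ 2 * (m * d * (d + 3)) *
    ((Real.exp P.epsLocal + 1) / (Real.exp P.epsLocal - 1)) := one_div_one_sub_flipProb_le hd hm hε
  have hε1 : 0 < √(Real.exp P.epsLocal - 1) := Real.sqrt_pos.mpr (by linarith)
  obtain ⟨hl, hlle⟩ := Params.batchLength_bounds hd hm (by omega) hp0 hp (by rw [hPε]; exact hε1)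
    (by rw [hPδ]; exact hδ) (by rw [hPδ]; exact hδ1)
  rw [hPδ, hPε] at hlle
  have hwidth := fun t (h1 : 1 ≤ t) (h2 : t ≤ P.T) =>
    Params.width_le hm hp0.le hp hδ hδ1 hlam hσ.le hS.le h1 h2
  have hW := widthConst_nonneg d m (L := P.L) hS hσ hlam
  have hℓ : 1 / 2 ≤ Real.log (2 * P.T / P.delta) := half_le_log hδ hδ1 (by omega)
  have hτ1 : (1 : ℝ) ≤ 2 ^ k₀ := one_le_pow₀ (by norm_num)
  have hburn := burn_in_le d m hL hS hlam hη hℓ hΔ hτ1 hτ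
  set B := m * ((1 + P.eta) * d.factorial *
    ((37 + 4 * P.lam) * ((2 : ℝ) ^ k₀ * Real.log (2 * P.T / P.delta)))) ^ 2 with hB
  have hB0 : 0 ≤ B := by positivity
  have hreg := R.regret_le hd hm hL hS hσ.le hp0.le hp hδ hδ1 hlam hη hθ (by omega) (ω := ω)
    (τ := 2 ^ k₀) (t₁ := ⌈B⌉₊ + 2 ^ k₀) Nat.one_le_two_pow (by omega) hvalid
    (by
      push_cast
      rw [← hB]
      linarith [Nat.le_ceil B]) hl hwidth
  have hburn2 : ((⌈B⌉₊ + 2 ^ k₀ : ℕ) : ℝ) ≤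
      burnInConst d m P.L P.S P.lam P.eta * (Δ ^ 2 * Real.log (2 * P.T / P.delta) ^ 10) := by
    push_cast
    linarith [Nat.ceil_lt_add_one hB0]
  refine hreg.trans ?_
  set ℓ := Real.log (2 * P.T / P.delta) with hℓdef
  set e := Real.exp P.epsLocal with hedef
  set F₁ := (P.T : ℝ) ^ (3 / 4 : ℝ) * √(e + 1) / √(e - 1) with hF₁
  set F₂ := Real.log P.T * (e + 1) ^ 2 / 4 with hF₂
  set F₃ := √P.T / √(e - 1) with hF₃
  set b := burnInConst d m P.L P.S P.lam P.eta with hb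
  set w := widthConst d m P.L P.S P.σ P.lam with hw
  set kl := 1 + 2 * Real.log (4 * m) with hkl
  set n : ℝ := m * d * (d + 3) with hn
  set G := 2 * ((3 / 2 : ℝ) ^ d * (1 + P.eta)) * d with hG
  have hG0 : 0 ≤ G := by positivity
  have hn0 : 0 ≤ n := by positivity
  have hkl0 : 0 ≤ kl := by positivity
  have hℓ0 : 0 ≤ ℓ := by linarith
  have hLS : 0 < P.L * P.S := by positivity
  set H := Δ ^ 2 * ℓ ^ 10 with hH
  have hH0 : 0 ≤ H := by positivity
  have hℓH : ∀ i j : ℕ, i + j = 10 → ℓ ^ i ≤ 2 ^ j * H := by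
    intro i j hij
    have h1 := pow_le_of_half_le hℓ i j
    rw [hij] at h1
    refine h1.trans (mul_le_mul_of_nonneg_left ?_ (by positivity))
    exact le_mul_of_one_le_left (by positivity) (one_le_pow₀ hΔ)
  have hℓ2 : ℓ ^ 2 ≤ 256 * H := by have := hℓH 2 8 rfl; norm_num at this; exact this
  have hℓ3 : ℓ ^ 3 ≤ 128 * H := by have := hℓH 3 7 rfl; norm_num at this; exact this
  have hF₂0 : 0 ≤ F₂ := by have := Real.log_nonneg hT1; positivity
  have hF₃0 : 0 ≤ F₃ := by positivity
  have hF₁0 : 0 ≤ F₁ := by linarith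
  have hb0 : 0 ≤ b := by
    have := scaleConst_nonneg d m hL hS hlam
    rw [hb, burnInConst]; positivity
  -- Here `T ≥ 2` matters: `log T ≥ 1 / 2` lets the second term of the rate pay for the part of the
  -- batch length of order `1 / p`.
  have heF : e + 1 ≤ 4 * F₂ := by
    have hlog : 1 / 2 ≤ Real.log P.T := by
      have h1 := Real.log_le_log (by norm_num) hT2
      have h2 := Real.log_two_gt_d9
      linarith only [h1, h2]
    have h1 : 1 / 2 * (e + 1) ^ 2 ≤ Real.log P.T * (e + 1) ^ 2 := by gcongr
    have h2 : e + 1 ≤ 1 / 2 * (e + 1) ^ 2 := by nlinarith only [he]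
    have e3 : 4 * F₂ = Real.log P.T * (e + 1) ^ 2 := by rw [hF₂]; ring
    linarith only [h1, h2, e3]
  have T1 : 2 * (P.L * P.S) * ((⌈B⌉₊ + 2 ^ k₀ : ℕ) : ℝ) ≤ 2 * (P.L * P.S) * b * H * F₁ := by
    calc _ ≤ 2 * (P.L * P.S) * (b * H) := by gcongr
      _ ≤ 2 * (P.L * P.S) * (b * H) * F₁ := le_mul_of_one_le_right (by positivity) hF1
      _ = _ := by ring
  have T2 : 2 * (P.L * P.S) * (1 + 2 * d * ℓ) * P.batchLength ≤
      2 * (P.L * P.S) * (2 + 2 * d) * kl * (402 * 4 * 256) * H * F₂ +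
      2 * (P.L * P.S) * (2 + 2 * d) * kl * (96 * d * (d + 3) * 128) * H * F₃ := by
    have h1 : 1 + 2 * d * ℓ ≤ (2 + 2 * d) * ℓ := by linarith only [hℓ]
    have h2 : ℓ / P.p ≤ ℓ * (2 * F₂) := by
      rw [div_eq_mul_one_div]
      exact mul_le_mul_of_nonneg_left (by linarith only [hpinv, heF]) hℓ0
    calc 2 * (P.L * P.S) * (1 + 2 * d * ℓ) * P.batchLength
        ≤ 2 * (P.L * P.S) * ((2 + 2 * d) * ℓ) * (kl * (804 * (ℓ * (2 * F₂)) +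
          96 * d * (d + 3) * (ℓ ^ 2 * √P.T / √(e - 1)))) := by
          refine mul_le_mul (by gcongr) (hlle.trans (by gcongr)) (Nat.cast_nonneg _) (by positivity)
      _ = 2 * (P.L * P.S) * (2 + 2 * d) * kl * (402 * 4) * F₂ * ℓ ^ 2 +
          2 * (P.L * P.S) * (2 + 2 * d) * kl * (96 * d * (d + 3)) * F₃ * ℓ ^ 3 := by
          rw [hF₃]; ring
      _ ≤ 2 * (P.L * P.S) * (2 + 2 * d) * kl * (402 * 4) * F₂ * (256 * H) +
          2 * (P.L * P.S) * (2 + 2 * d) * kl * (96 * d * (d + 3)) * F₃ * (128 * H) := by gcongr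
      _ = _ := by ring
  have T3 : 4 * P.L * √(G * ℓ) * (w * (ℓ * √√P.T / √(1 - P.p))) * √P.T ≤
      8 * P.L * √G * w * √(2 * n) * 256 * H * F₁ := by
    have h1 : √(G * ℓ) ≤ √G * (2 * ℓ) := by
      rw [Real.sqrt_mul hG0]
      exact mul_le_mul_of_nonneg_left (sqrt_le_two_mul hℓ) (Real.sqrt_nonneg _)
    have h2 : 1 / √(1 - P.p) ≤ √(2 * n) * (√(e + 1) / √(e - 1)) := by
      have := Real.sqrt_le_sqrt hpinv2
      rwa [Real.sqrt_div zero_le_one, Real.sqrt_one, Real.sqrt_mul (by positivity),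
        Real.sqrt_div (by linarith)] at this
    calc _ = 4 * P.L * √(G * ℓ) * w * ℓ * (√√P.T * √P.T) * (1 / √(1 - P.p)) := by ring
      _ ≤ 4 * P.L * (√G * (2 * ℓ)) * w * ℓ * (√√P.T * √P.T) *
          (√(2 * n) * (√(e + 1) / √(e - 1))) := by gcongr
      _ = 8 * P.L * √G * w * √(2 * n) * F₁ * ℓ ^ 2 := by
          rw [sqrt_sqrt_mul_sqrt (by linarith), hF₁]; ring
      _ ≤ 8 * P.L * √G * w * √(2 * n) * F₁ * (256 * H) := by gcongr
      _ = _ := by ring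
  have e4 : regretConst d m P.L P.S P.σ P.lam P.eta * Δ ^ 2 * ℓ ^ 10 * (F₁ + F₂ + F₃) =
      (2 * (P.L * P.S) * b + 2 * (P.L * P.S) * (2 + 2 * d) * kl * (402 * 4 * 256) +
        2 * (P.L * P.S) * (2 + 2 * d) * kl * (96 * d * (d + 3) * 128) +
        8 * P.L * √G * w * √(2 * n) * 256 + 2 * (P.L * P.S) * 1024) * H * (F₁ + F₂ + F₃) := by
    rw [regretConst, ← hb, ← hkl, ← hG, ← hw, ← hn, hH]; ring
  rw [e4]
  clear_value H F₁ F₂ F₃ b w kl n G ℓ e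
  set c1 := 2 * (P.L * P.S) * b
  set c2 := 2 * (P.L * P.S) * (2 + 2 * d) * kl * (402 * 4 * 256)
  set c3 := 2 * (P.L * P.S) * (2 + 2 * d) * kl * (96 * d * (d + 3) * 128)
  set c4 := 8 * P.L * √G * w * √(2 * n) * 256
  set c5 := 2 * (P.L * P.S) * 1024
  have hc1 : 0 ≤ c1 := by positivity
  have hc2 : 0 ≤ c2 := by positivity
  have hc3 : 0 ≤ c3 := by positivity
  have hc4 : 0 ≤ c4 := by positivity
  have hc5 : 0 ≤ c5 := by positivity
  have key : c1 * H * F₁ + (c2 * H * F₂ + c3 * H * F₃) + c4 * H * F₁ ≤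
      (c1 + c2 + c3 + c4 + c5) * H * (F₁ + F₂ + F₃) := by
    have : 0 ≤ (c1 * H * F₂ + c1 * H * F₃) + (c2 * H * F₁ + c2 * H * F₃) +
      (c3 * H * F₁ + c3 * H * F₂) + (c4 * H * F₂ + c4 * H * F₃) +
      c5 * H * (F₁ + F₂ + F₃) := by positivity
    linarith only [this]
  linarith only [key, T1, T2, T3]

/-- For `T = 1` the term with `log T` vanishes and cannot pay for a batch. The regret of one round
is at most `2 L S`; the first term of the rate is at least 1, and `1024 ℓ ^ 10 ≥ 1` explains the
last summand of `regretConst`. -/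
theorem Run.regret_le_rate_one (R : Run μ P K θstar)
    (hL : 0 < P.L) (hS : 0 < P.S) (hσ : 0 < P.σ) (hε : 0 < P.epsLocal) (hm : 0 < m)
    (hδ : 0 < P.delta) (hδ1 : P.delta < 1) (hlam : 0 < P.lam) (hη : 0 < P.eta)
    (hθ : ‖θstar‖ ≤ P.S) (hT : P.T = 1) (ω : Ω) {Δ : ℝ} (hΔ : 1 ≤ Δ) :
    R.regret ω ≤ regretConst d m P.L P.S P.σ P.lam P.eta * Δ ^ 2 *
      Real.log (2 * P.T / P.delta) ^ 10 *
      ((P.T : ℝ) ^ (3 / 4 : ℝ) * √(Real.exp P.epsLocal + 1) / √(Real.exp P.epsLocal - 1)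
        + Real.log P.T * (Real.exp P.epsLocal + 1) ^ 2 / 4
        + √P.T / √(Real.exp P.epsLocal - 1)) := by
  have hm1 : (1 : ℝ) ≤ m := by exact_mod_cast hm
  have hT1 : (1 : ℝ) ≤ P.T := by rw [hT]; norm_num
  have h1 : R.regret ω ≤ 2 * (P.L * P.S) := by
    have e : R.regret ω = ∑ t ∈ Finset.range P.T, R.roundRegret ω t := rfl
    rw [e, hT, Finset.sum_range_one]
    exact R.roundRegret_le hL.le hθ ω (by omega)
  have hF1 := rate_ge_one hT1 hε
  have hF2 : 0 ≤ Real.log P.T * (Real.exp P.epsLocal + 1) ^ 2 / 4 := by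
    have := Real.log_nonneg hT1; positivity
  have hF3 : 0 ≤ √P.T / √(Real.exp P.epsLocal - 1) := by positivity
  have hℓ : 1 / 2 ≤ Real.log (2 * P.T / P.delta) := half_le_log hδ hδ1 hT.ge
  set ℓ := Real.log (2 * P.T / P.delta)
  have hℓ10 := pow_le_of_half_le hℓ 0 10
  norm_num at hℓ10
  have hC : 2 * (P.L * P.S) * 1024 ≤ regretConst d m P.L P.S P.σ P.lam P.eta := by
    have h2 := scaleConst_nonneg d m hL hS hlam
    have h3 := widthConst_nonneg d m (L := P.L) hS hσ hlam
    have h4 : 0 ≤ Real.log (4 * m) := Real.log_nonneg (by linarith)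
    have h5 : 0 ≤ burnInConst d m P.L P.S P.lam P.eta := by unfold burnInConst; positivity
    rw [regretConst]
    exact le_add_of_nonneg_left (by positivity)
  have hLS : 0 < P.L * P.S := by positivity
  have hΔ2 : 1 ≤ Δ ^ 2 := one_le_pow₀ hΔ
  have h0 : 0 ≤ 2 * (P.L * P.S) * 1024 := by positivity
  calc R.regret ω ≤ 2 * (P.L * P.S) := h1
    _ ≤ 2 * (P.L * P.S) * (1024 * ℓ ^ 10) := le_mul_of_one_le_right (by positivity) hℓ10
    _ = 2 * (P.L * P.S) * 1024 * 1 * ℓ ^ 10 * 1 := by ring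
    _ ≤ _ := by
      refine mul_le_mul (mul_le_mul_of_nonneg_right (mul_le_mul hC hΔ2 zero_le_one (h0.trans hC))
        (by positivity)) (by linarith) zero_le_one ?_
      have := h0.trans hC
      positivity

end FinalBound

end SBLB

/-! ### The theorem: choice of constants and probability of the good event -/

theorem corollary1 (d m : ℕ) (hd : 0 < d) (hm : 0 < m) (L S σ lam η : ℝ)
    (hL : 0 < L) (hS : 0 < S) (hσ : 0 < σ) (hlam : 0 < lam) (hη : 0 < η) :
    (∀ ε₀ : ℝ, 0 < ε₀ →
      SBLB.IsLDP (SBLB.localPrivatizer d m L ε₀) (SBLB.userData d L) ε₀ 0) ∧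
    ∃ (C κ : ℝ) (k : ℕ), 0 ≤ κ ∧ (1 ≤ L * S → κ = 0) ∧
      ∀ (δ ε₀ ε δ₀ : ℝ) (T : ℕ), 0 < δ → δ < 1 → 0 < ε₀ → 1 ≤ T →
        ε = √(Real.exp ε₀ - 1) → δ₀ = δ →
      ∀ (P : SBLB.Params d m),
        P = { T := T, epsLocal := ε₀, eps := ε, deltaPriv := δ₀, delta := δ, lam := lam,
              eta := η, L := L, S := S, σ := σ } →
      ∀ (Ω : Type*) [MeasurableSpace Ω] (μ : MeasureTheory.Measure Ω)
        [MeasureTheory.IsProbabilityMeasure μ] (K : ℕ) (θstar : EuclideanSpace ℝ (Fin d))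
        (_ : ‖θstar‖ ≤ S) (R : SBLB.Run μ P K θstar),
        ENNReal.ofReal (1 - δ) ≤ μ {ω | R.regret ω ≤
          C * δ ^ (-κ) * Real.log (2 * T / δ) ^ k *
            ((T : ℝ) ^ (3 / 4 : ℝ) * √(Real.exp ε₀ + 1) / √(Real.exp ε₀ - 1)
              + Real.log T * (Real.exp ε₀ + 1) ^ 2 / 4
              + √T / √(Real.exp ε₀ - 1))} := by
  refine ⟨fun ε₀ hε => SBLB.localPrivatizer_isLDP hd hm L hε, ?_⟩
  set s := min 1 (L * S) with hsdef
  have hs : 0 < s := lt_min one_pos (by positivity)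
  have hs1 : s ≤ 1 := min_le_left _ _
  have hκ : 0 ≤ 1 / s ^ 2 - 1 := by
    have : 1 ≤ 1 / s ^ 2 := by
      rw [le_div_iff₀ (by positivity)]; nlinarith
    linarith
  -- The exponent `1 / s ^ 2 - 1` of the first controlled scale is doubled because the burn-in is
  -- quadratic in that scale. It is 0 when `s = 1`.
  refine ⟨SBLB.regretConst d m L S σ lam η, 2 * (1 / s ^ 2 - 1), 10, by positivity, ?_, ?_⟩
  · intro h
    rw [hsdef, min_eq_left h]
    norm_num
  intro δ ε₀ ε δ₀ T hδ hδ1 hε hT hεdef hδ₀ P hP Ω _ μ _ K θstar hθ R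
  have hΔ1 : 1 ≤ δ ^ (-(1 / s ^ 2 - 1)) :=
    Real.one_le_rpow_of_pos_of_le_one_of_nonpos hδ hδ1.le (by linarith)
  have hΔ2 : δ ^ (-(2 * (1 / s ^ 2 - 1))) = (δ ^ (-(1 / s ^ 2 - 1))) ^ 2 := by
    rw [← Real.rpow_mul_natCast hδ.le]
    congr 1
    push_cast
    ring
  rw [hΔ2]
  subst hεdef hδ₀ hP
  rcases hT.eq_or_lt with hT1 | hT2
  · refine le_trans ?_ (measure_mono (s := Set.univ) fun ω _ =>
      R.regret_le_rate_one hL hS hσ hε hm hδ hδ1 hlam hη hθ hT1.symm ω hΔ1)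
    rw [measure_univ]
    exact ENNReal.ofReal_le_one.mpr (by linarith)
  · obtain ⟨k₀, h1, h2, h3⟩ := SBLB.exists_start_scale d m hL hS hlam hδ hδ1
      (SBLB.half_le_log hδ hδ1 hT)
    obtain ⟨Bad, hBad, hgood⟩ := R.exists_good_event hd hm hL hε hS hθ rfl hδ hδ1 hs hs1
      (min_le_right _ _) hlam h1 h2
    refine le_trans ?_ (measure_mono (s := Badᶜ) fun ω hω =>
      R.regret_le_rate hd hm hL hS hσ hε rfl rfl hδ hδ1 hlam hη hθ hT2 hΔ1 h3 (hgood ω hω))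
    -- Subadditivity suffices, so measurability of `Bad` is not needed.
    have h4 : 1 ≤ μ Bad + μ Badᶜ := by
      rw [← measure_univ (μ := μ), ← Set.union_compl_self Bad]
      exact measure_union_le _ _
    rw [ENNReal.ofReal_sub _ hδ.le, ENNReal.ofReal_one]
    exact tsub_le_iff_left.mpr (h4.trans (add_le_add_left hBad _))
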